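/- **Theorem A.2 (consistency of the large-strata variance estimators).** *Setting.* Clusters $g=1,2,\dots$ have sizes $N_g$, covariates $C_g$, sets of sampled units $\mathcal M_g\subseteq\{1,\dots,N_g\}$ with $M_g=|\mathcal M_g|$, and individual covariates $X_g=(X_{i,g}:i\le N_g)$. Fix $\pi_1\in(0,1)$, $\pi_2\in(0,1]$ and $\mathcal H=\{0,\pi_2\}$. Clusters are stratified by $S_g=S(C_g,N_g)\in\mathcal S$ with $\mathcal S$ finite, and units by $B_g=(B(X_{i,g}):i\le N_g)$. In the sample $g\le G$, cluster $g$ receives a target treated fraction $H_g\in\mathcal H$ (depending on $G$), and unit $i$ receives $Z_{i,g}=\sum_{h\in\mathcal H}Z_{i,g}(h)I\{H_g=h\}$, where $Z_{i,g}(h)\in\{0,1\}$ are potential treatments. *Homogeneous partial interference* holds: almost surely, the outcome of a unit in a cluster of size $n$ depends on the assignment of all units in all clusters only through its own treatment $z$ and the number $n_1$ of treated units in its cluster; write it $Y_{i,g}(z,n,n_1)$ (set to $0$ if no assignment has these $z,n,n_1$), and put $Y_{i,g}(z,h)=Y_{i,g}(z,N_g,\lfloor N_gh\rfloor)$. Observed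 outcomes are $Y_{i,g}=Y_{i,g}(Z_{i,g},H_g)$. Let $W_g=\big(((Y_{i,g}(z,h))_{z\in\{0,1\},h\in\mathcal H},X_{i,g}:i\le N_g),\mathcal M_g,C_g,N_g\big)$, $Z_g=((Z_{i,g}(h))_{h\in\mathcal H}:i\le N_g)$, and let $A^{(G)}=(A_1,\dots,A_G)$ for any sequence $A$. *Population.* (a) The $(\mathcal M_g,C_g,N_g)$ are i.i.d. (b) Given $(\mathcal M_g,C_g,N_g)_{g\le G}$, the vectors $((Y_{i,g}(z,h))_{z,h},X_{i,g}:i\le N_g)$, $g\le G$, are independent with laws $R(\mathcal M_g,C_g,N_g)$ for a common family $R$. (c) $M_g\ge2$ a.s. and $E[N_g^2]<\infty$. (d) For some constant $K$ and all $g,z,h$, almost surely $E[Y_{i,g}(z,h)^2\mid N_g,C_g,X_g]\le K$ for all $i\le N_g$. (e) $\mathcal M_g\perp((Y_{i,g}(z,h))_{z,h}:i\le N_g)\mid C_g,N_g,X_g$. (f) $E[\frac1{M_g}\sum_{i\in\mathcal M_g}Y_{i,g}(z,h)\mid N_g]=E[\frac1{N_g}\sum_{i\le N_g}Y_{i,g}(z,h)\mid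 N_g]$ a.s. *First stage.* For every $G$, $(W^{(G)},Z^{(G)})\perp H^{(G)}\mid S^{(G)}$. With $D_G(s)=\sum_{g\le G}(I\{H_g=\pi_2\}-\pi_1)I\{S_g=s\}$ and $p(s)=P(S_g=s)$, almost surely the conditional law of $(D_G(s)/\sqrt G)_{s\in\mathcal S}$ given $S^{(G)}$ converges weakly to $N(0,\mathrm{diag}(p(s)\tau(s)))$ as $G\to\infty$, where $0\le\tau(s)\le\pi_1(1-\pi_1)$. *Second stage.* Units in control clusters are untreated: $Z_{i,g}(0)=0$. For every $G$, $W^{(G)}\perp Z^{(G)}\mid B^{(G)}$, and given $B^{(G)}$ the $Z_g$ are independent across $g\le G$ with laws $\kappa(B_g)$ for a common family $\kappa$. For all $i\le N_g$ and $h\in\mathcal H$, $E[Z_{i,g}(h)\mid B_g]=\frac1{M_g}\sum_{j\in\mathcal M_g}Z_{j,g}(h)$ a.s. *Targets* (throughout, $x/0=0$). Let $\bar Y_g(z,\pi_2)$ be the average of $Y_{i,g}(z,\pi_2)$ over $\{i\in\mathcal M_g:Z_{i,g}(\pi_2)=z\}$, let $\bar Y_g(0,0)=\frac1{M_g}\sum_{i\in\mathcal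 M_g}Y_{i,g}(0,0)$, and let $$\tilde Y_g(z,h)=\frac{N_g}{E[N_g]}\Big(\bar Y_g(z,h)-\frac{E[\bar Y_g(z,h)N_g]}{E[N_g]}\Big).$$ Let $m_{z,h}(S_g)=E[\bar Y_g(z,h)\mid S_g]-E[\bar Y_g(z,h)]$, $\mu_{z,h}(S_g)=E[\tilde Y_g(z,h)\mid S_g]$, and $$V_3(z)=\frac{\operatorname{Var}[\bar Y_g(z,\pi_2)]}{\pi_1}+\frac{\operatorname{Var}[\bar Y_g(0,0)]}{1-\pi_1}-\pi_1(1-\pi_1)E\Big[\Big(\frac{m_{z,\pi_2}(S_g)}{\pi_1}+\frac{m_{0,0}(S_g)}{1-\pi_1}\Big)^2\Big]+E\Big[\tau(S_g)\Big(\frac{m_{z,\pi_2}(S_g)}{\pi_1}+\frac{m_{0,0}(S_g)}{1-\pi_1}\Big)^2\Big].$$ $V_4(z)$ is defined in the same way with $\tilde Y_g,\mu$ in place of $\bar Y_g,m$. *Estimators.* Let $G_1,G_0$ be the numbers of clusters $g\le G$ with $H_g=\pi_2$ and $H_g=0$; $G_1(s),G_0(s)$ the numbers of those with also $S_g=s$;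 $G(s)$ the number with $S_g=s$; $M_g^z=\#\{i\in\mathcal M_g:Z_{i,g}=z\}$; $\bar N=\frac1G\sum_{g\le G}N_g$; and $$\bar Y_g^z=\frac1{M_g^z}\sum_{i\in\mathcal M_g}Y_{i,g}I\{H_g=\pi_2,Z_{i,g}=z\}+\frac1{M_g}\sum_{i\in\mathcal M_g}Y_{i,g}I\{H_g=0\},\qquad \tilde Y_g^z=\frac{N_g}{\bar N}\Big(\bar Y_g^z-\frac1{\bar N}\cdot\frac{\sum_{j\le G}\bar Y_j^zN_jI\{H_j=H_g\}}{\#\{j\le G:H_j=H_g\}}\Big).$$ For $a\in\{0,1\}$ let $\bar Y_{a,z}$ and $\hat\mu_{a,z}(s)$ be the averages of $\bar Y_g^z$ over the $G_a$ clusters, respectively the $G_a(s)$ clusters, and $\tilde\mu_{a,z}(s)$ the average of $\tilde Y_g^z$ over the $G_a(s)$ clusters. Then $$\begin{aligned}\hat V_3(z)={}&\frac1{\pi_1}\Big(\frac1{G_1}\sum_{g\le G}(\bar Y_g^z)^2I\{H_g=\pi_2\}-\sum_{s}\frac{G(s)}G\hat\mu_{1,z}(s)^2\Big)+\frac1{1-\pi_1}\Big(\frac1{G_0}\sum_{g\le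 G}(\bar Y_g^z)^2I\{H_g=0\}-\sum_{s}\frac{G(s)}G\hat\mu_{0,0}(s)^2\Big)\\&+\sum_{s}\frac{G(s)}G\Big((\hat\mu_{1,z}(s)-\bar Y_{1,z})-(\hat\mu_{0,0}(s)-\bar Y_{0,0})\Big)^2+\sum_{s}\tau(s)\frac{G(s)}G\Big(\frac{\hat\mu_{1,z}(s)-\bar Y_{1,z}}{\pi_1}+\frac{\hat\mu_{0,0}(s)-\bar Y_{0,0}}{1-\pi_1}\Big)^2,\\ \hat V_4(z)={}&\frac1{\pi_1}\Big(\frac1{G_1}\sum_{g\le G}(\tilde Y_g^z)^2I\{H_g=\pi_2\}-\sum_{s}\frac{G(s)}G\tilde\mu_{1,z}(s)^2\Big)+\frac1{1-\pi_1}\Big(\frac1{G_0}\sum_{g\le G}(\tilde Y_g^z)^2I\{H_g=0\}-\sum_{s}\frac{G(s)}G\tilde\mu_{0,0}(s)^2\Big)\\&+\sum_{s}\frac{G(s)}G\big(\tilde\mu_{1,z}(s)-\tilde\mu_{0,0}(s)\big)^2+\sum_{s}\tau(s)\frac{G(s)}G\Big(\frac{\tilde\mu_{1,z}(s)}{\pi_1}+\frac{\tilde\mu_{0,0}(s)}{1-\pi_1}\Big)^2.\end{aligned}$$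 *Conclusion.* For $z\in\{0,1\}$, the variables $\bar Y_g(z,\pi_2),\bar Y_g(0,0),\tilde Y_g(z,\pi_2),\tilde Y_g(0,0)$ have finite second moments, and, as $G\to\infty$, $\hat V_3(z)\xrightarrow{P}V_3(z)$ and $\hat V_4(z)\xrightarrow{P}V_4(z)$. -/

import Mathlib

open MeasureTheory ProbabilityTheory Filter Topology

/-- Vectors of variable finite length, `(a_i : i < n)` together with their length `n`. -/
abbrev VarVec (α : Type*) : Type _ := Σ n : ℕ, (Fin n → α)

/-- The random vector `(a_i : i < N)` of random length `N`. -/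
def varVec {Ω α : Type*} (N : Ω → ℕ) (a : ℕ → Ω → α) (ω : Ω) : VarVec α :=
  ⟨N ω, fun i => a i ω⟩

theorem measurable_varVec {Ω α : Type*} [MeasurableSpace Ω] [MeasurableSpace α]
    {N : Ω → ℕ} {a : ℕ → Ω → α} (hN : Measurable N) (ha : ∀ i, Measurable (a i)) :
    Measurable (varVec N a) := by
  intro s hs
  have h : varVec N a ⁻¹' s =
      ⋃ n : ℕ, N ⁻¹' {n} ∩ (fun ω => fun i : Fin n => a i ω) ⁻¹'
        ((fun v : Fin n → α => (⟨n, v⟩ : VarVec α)) ⁻¹' s) := by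
    ext ω
    simp only [Set.mem_preimage, Set.mem_iUnion, Set.mem_inter_iff, Set.mem_singleton_iff]
    constructor
    · intro h
      exact ⟨N ω, rfl, h⟩
    · rintro ⟨n, rfl, h⟩
      exact h
  rw [h]
  refine MeasurableSet.iUnion fun n => (hN (measurableSet_singleton n)).inter ?_
  refine (measurable_pi_lambda (fun ω => fun i : Fin n => a i ω) fun i => ha i) ?_
  exact (MeasurableSpace.measurableSet_iInf.1 hs) n

/-- Conditional independence `f ⊥ g | k` of random elements: the conditional probabilities given
the σ-algebra generated by `k` factorize. -/
def CondIndepGiven {Ω α β γ : Type*} [MeasurableSpace Ω] [MeasurableSpace α] [MeasurableSpace β]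
    [mγ : MeasurableSpace γ] (P : Measure Ω) (f : Ω → α) (g : Ω → β) (k : Ω → γ) : Prop :=
  ∀ (s : Set α) (t : Set β), MeasurableSet s → MeasurableSet t →
    P⟦f ⁻¹' s ∩ g ⁻¹' t | mγ.comap k⟧ =ᵐ[P]
      fun ω => (P⟦f ⁻¹' s | mγ.comap k⟧) ω * (P⟦g ⁻¹' t | mγ.comap k⟧) ω

/-- On a standard Borel probability space this is the conditional independence of Mathlib. -/
theorem condIndepGiven_iff_condIndepFun {Ω α β γ : Type*} [mΩ : MeasurableSpace Ω]
    [StandardBorelSpace Ω] [MeasurableSpace α] [MeasurableSpace β] [mγ : MeasurableSpace γ]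
    (P : Measure Ω) [IsFiniteMeasure P] {f : Ω → α} {g : Ω → β} {k : Ω → γ}
    (hf : Measurable f) (hg : Measurable g) (hk : Measurable k) :
    CondIndepGiven P f g k ↔ CondIndepFun (mγ.comap k) hk.comap_le f g P :=
  (condIndepFun_iff_condExp_inter_preimage_eq_mul hf hg).symm

/-- The conditional law of `f 0, f 1, …` given `k 0, k 1, …`: for every sample size `G`,
conditionally on `k 0, …, k (G-1)` the random elements `f 0, …, f (G-1)` are independent and
`f g` has law `K (k g)`, with the same kernel `K` for all `g`. -/
def CondProductLaw {Ω α β : Type*} [MeasurableSpace Ω] [MeasurableSpace α] [MeasurableSpace β]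
    (P : Measure Ω) (f : ℕ → Ω → α) (k : ℕ → Ω → β) (K : Kernel β α) : Prop :=
  ∀ (G : ℕ) (A : Fin G → Set α), (∀ g, MeasurableSet (A g)) →
    P⟦⋂ g : Fin G, f g ⁻¹' A g |
        MeasurableSpace.comap (fun ω (g : Fin G) => k g ω) inferInstance⟧ =ᵐ[P]
      fun ω => ∏ g : Fin G, (K (k g ω)).real (A g)

/-- The random quantities and the design of a two-stage experiment on a probability space.

Clusters are numbered `g = 0, 1, 2, …`, the sample of size `G` consists of the clusters `g < G`,
and the units of cluster `g` are the `i < N g`; values attached to a unit `i ≥ N g` carry no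
meaning.  Individual treatment statuses `z ∈ {0, 1}` are Booleans.  The two target treated
fractions in `{0, π₂}` are Booleans as well: `true` stands for `π₂`, `false` for `0`. -/
structure TwoStageExperiment (Ω 𝒳 𝒞 𝓑 𝒮 : Type*) [MeasurableSpace Ω] [MeasurableSpace 𝒳]
    [MeasurableSpace 𝒞] [MeasurableSpace 𝓑] [MeasurableSpace 𝒮] where
  /-- target proportion of treated clusters -/
  π₁ : ℝ
  /-- target fraction of treated units in treated clusters -/
  π₂ : ℝ
  π₁_pos : 0 < π₁
  π₁_lt_one : π₁ < 1
  π₂_pos : 0 < π₂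
  π₂_le_one : π₂ ≤ 1
  /-- the function forming the strata of clusters from cluster covariates and cluster size -/
  S : 𝒞 × ℕ → 𝒮
  measurable_S : Measurable S
  /-- the function forming the strata of units from individual covariates -/
  B : 𝒳 → 𝓑
  measurable_B : Measurable B
  /-- the imbalance parameter of each stratum of clusters -/
  τ : 𝒮 → ℝ
  /-- cluster sizes -/
  N : ℕ → Ω → ℕ
  measurable_N : ∀ g, Measurable (N g)
  /-- the set of sampled units of each cluster -/
  M : ℕ → Ω → Finset ℕ
  measurable_M : ∀ g, Measurable (M g)
  M_subset : ∀ g ω, M g ω ⊆ Finset.range (N g ω)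
  /-- cluster covariates -/
  C : ℕ → Ω → 𝒞
  measurable_C : ∀ g, Measurable (C g)
  /-- individual covariates of unit `i` in cluster `g` -/
  X : ℕ → ℕ → Ω → 𝒳
  measurable_X : ∀ g i, Measurable (X g i)
  /-- `Yfull g i z n` is the outcome of unit `i` in cluster `g` when the cluster has size `n` and
  `z g' j` is the treatment of unit `j` in cluster `g'`, for all units in all clusters -/
  Yfull : ℕ → ℕ → (ℕ → ℕ → Bool) → ℕ → Ω → ℝ
  measurable_Yfull : ∀ g i z n, Measurable (Yfull g i z n)
  /-- `Zpot g i h` is the potential treatment of unit `i` in cluster `g` under the target treated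
  fraction `h` -/
  Zpot : ℕ → ℕ → Bool → Ω → Bool
  measurable_Zpot : ∀ g i h, Measurable (Zpot g i h)
  /-- `H G g` is the target treated fraction assigned to cluster `g < G` in the sample of size `G` -/
  H : ℕ → ℕ → Ω → Bool
  measurable_H : ∀ G g, Measurable (H G g)

namespace TwoStageExperiment

variable {Ω 𝒳 𝒞 𝓑 𝒮 : Type*} [MeasurableSpace Ω] [MeasurableSpace 𝒳]
    [MeasurableSpace 𝒞] [MeasurableSpace 𝓑] [MeasurableSpace 𝒮]

noncomputable section

/-! ### Potential outcomes -/

/-- The number of treated units in cluster `g` of size `n` under the assignment `z`. -/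
def numTreated (z : ℕ → ℕ → Bool) (g n : ℕ) : ℕ :=
  ((Finset.range n).filter fun j => z g j = true).card

/-- Homogeneous partial interference: the outcome of a unit depends on the assignment only through
its own treatment and the number of treated units in its cluster. -/
def Interference (E : TwoStageExperiment Ω 𝒳 𝒞 𝓑 𝒮) (P : Measure Ω) : Prop :=
  ∀ (g n i : ℕ), i < n → ∀ z z' : ℕ → ℕ → Bool,
    z g i = z' g i → numTreated z g n = numTreated z' g n →
      E.Yfull g i z n =ᵐ[P] E.Yfull g i z' n

open Classical in
/-- `Y_{i,g}(z, n, n₁)`: the outcome under own treatment `z` and cluster size `n`, when `n₁` units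
of the cluster are treated.  By homogeneous partial interference it does not matter which
assignment with these features is used; if there is none, the value is `0` by convention. -/
def Yred (E : TwoStageExperiment Ω 𝒳 𝒞 𝓑 𝒮) (g i : ℕ) (z : Bool) (n n₁ : ℕ) (ω : Ω) : ℝ :=
  if h : ∃ a : ℕ → ℕ → Bool, a g i = z ∧ numTreated a g n = n₁ then
    E.Yfull g i h.choose n ω
  else 0

/-- The number in `{0, π₂}` that a target treated fraction stands for. -/
def frac (E : TwoStageExperiment Ω 𝒳 𝒞 𝓑 𝒮) (h : Bool) : ℝ := if h then E.π₂ else 0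

/-- `Y_{i,g}(z, h) = ∑ₙ Y_{i,g}(z, n, ⌊n h⌋) I{N_g = n}`. -/
def Y (E : TwoStageExperiment Ω 𝒳 𝒞 𝓑 𝒮) (g i : ℕ) (z h : Bool) (ω : Ω) : ℝ :=
  E.Yred g i z (E.N g ω) ⌊(E.N g ω : ℝ) * E.frac h⌋₊ ω

/-! ### Vectors attached to clusters -/

/-- The stratum of cluster `g`. -/
def Sg (E : TwoStageExperiment Ω 𝒳 𝒞 𝓑 𝒮) (g : ℕ) (ω : Ω) : 𝒮 := E.S (E.C g ω, E.N g ω)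

/-- `(M_g, C_g, N_g)`. -/
def base (E : TwoStageExperiment Ω 𝒳 𝒞 𝓑 𝒮) (g : ℕ) (ω : Ω) : Finset ℕ × 𝒞 × ℕ :=
  (E.M g ω, E.C g ω, E.N g ω)

/-- `((Y_{i,g}(z, h))_{z, h} : i < N_g)`. -/
def Yvec (E : TwoStageExperiment Ω 𝒳 𝒞 𝓑 𝒮) (g : ℕ) : Ω → VarVec (Bool → Bool → ℝ) :=
  varVec (E.N g) fun i ω z h => E.Y g i z h ω

/-- `X_g = (X_{i,g} : i < N_g)`. -/
def Xvec (E : TwoStageExperiment Ω 𝒳 𝒞 𝓑 𝒮) (g : ℕ) : Ω → VarVec 𝒳 :=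
  varVec (E.N g) (E.X g)

/-- `((Y_{i,g}(z, h))_{z, h}, X_{i,g} : i < N_g)`. -/
def YXvec (E : TwoStageExperiment Ω 𝒳 𝒞 𝓑 𝒮) (g : ℕ) :
    Ω → VarVec ((Bool → Bool → ℝ) × 𝒳) :=
  varVec (E.N g) fun i ω => (fun z h => E.Y g i z h ω, E.X g i ω)

/-- `B_g = (B(X_{i,g}) : i < N_g)`. -/
def Bvec (E : TwoStageExperiment Ω 𝒳 𝒞 𝓑 𝒮) (g : ℕ) : Ω → VarVec 𝓑 :=
  varVec (E.N g) fun i ω => E.B (E.X g i ω)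

/-- `((Z_{i,g}(h))_h : i < N_g)`. -/
def Zvec (E : TwoStageExperiment Ω 𝒳 𝒞 𝓑 𝒮) (g : ℕ) : Ω → VarVec (Bool → Bool) :=
  varVec (E.N g) fun i ω h => E.Zpot g i h ω

/-- The entry of cluster `g` in `W^{(G)}`. -/
def W (E : TwoStageExperiment Ω 𝒳 𝒞 𝓑 𝒮) (g : ℕ) (ω : Ω) :
    VarVec ((Bool → Bool → ℝ) × 𝒳) × Finset ℕ × 𝒞 × ℕ :=
  (E.YXvec g ω, E.base g ω)

/-! ### Assumptions on the population -/

/-- The assumptions on the distribution of `W^{(G)}`. -/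
structure SamplingAssumption (E : TwoStageExperiment Ω 𝒳 𝒞 𝓑 𝒮) (P : Measure Ω) : Prop where
  /-- (a) the `(M_g, C_g, N_g)` are i.i.d. -/
  base_indep : iIndepFun E.base P
  base_ident : ∀ g, IdentDistrib (E.base g) (E.base 0) P P
  /-- (b) conditionally on all `(M_g, C_g, N_g)`, outcomes and individual covariates are drawn
  from a product of distributions `R(M_g, C_g, N_g)` -/
  outcomes : ∃ R : Kernel (Finset ℕ × 𝒞 × ℕ) (VarVec ((Bool → Bool → ℝ) × 𝒳)),
    IsMarkovKernel R ∧ CondProductLaw P E.YXvec E.base R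
  /-- (c) at least two units are sampled, and cluster sizes have a second moment -/
  two_le_card : ∀ g, ∀ᵐ ω ∂P, 2 ≤ (E.M g ω).card
  size_sq : ∀ g, Integrable (fun ω => (E.N g ω : ℝ) ^ 2) P
  /-- (d) `E[Y_{i,g}(z, h)² | N_g, C_g, X_g] ≤ K` for all `i < N_g` (the integrability keeps the
  conditional expectation from being a default value) -/
  bounded : ∃ K : ℝ, ∀ (z h : Bool) (g i : ℕ),
    Integrable ({ω | i < E.N g ω}.indicator fun ω => E.Y g i z h ω ^ 2) P ∧
    ∀ᵐ ω ∂P, i < E.N g ω →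
      (P[{ω | i < E.N g ω}.indicator fun ω => E.Y g i z h ω ^ 2 |
        MeasurableSpace.comap (fun ω => (E.N g ω, E.C g ω, E.Xvec g ω)) inferInstance]) ω ≤ K
  /-- (e) `M_g ⊥ (Y_{i,g}(z, h))_{i, z, h} | C_g, N_g, X_g` -/
  sampling : ∀ g, CondIndepGiven P (E.M g) (E.Yvec g) fun ω => (E.C g ω, E.N g ω, E.Xvec g ω)
  /-- (f) sampled units represent their cluster on average, given its size -/
  representative : ∀ (z h : Bool) (g : ℕ),
    P[fun ω => (∑ i ∈ E.M g ω, E.Y g i z h ω) / ((E.M g ω).card : ℝ) |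
        MeasurableSpace.comap (E.N g) inferInstance] =ᵐ[P]
      P[fun ω => (∑ i ∈ Finset.range (E.N g ω), E.Y g i z h ω) / (E.N g ω : ℝ) |
        MeasurableSpace.comap (E.N g) inferInstance]

/-! ### Assumptions on the assignment mechanism -/

/-- `p(s) = P(S_g = s)`. -/
def p (E : TwoStageExperiment Ω 𝒳 𝒞 𝓑 𝒮) (P : Measure Ω) (s : 𝒮) : ℝ := P.real (E.Sg 0 ⁻¹' {s})

open Classical in
/-- The imbalance `D_G(s) = ∑_{g < G} (I{H_g = π₂} - π₁) I{S_g = s}`. -/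
def D (E : TwoStageExperiment Ω 𝒳 𝒞 𝓑 𝒮) (G : ℕ) (s : 𝒮) (ω : Ω) : ℝ :=
  ∑ g ∈ Finset.range G,
    ((if E.H G g ω then 1 else 0) - E.π₁) * (if E.Sg g ω = s then 1 else 0)

/-- The conditional law of `(D_G(s) / √G)_s` given `S^{(G)}`, at the outcome `ω`. -/
def condLawD [Fintype 𝒮] (E : TwoStageExperiment Ω 𝒳 𝒞 𝓑 𝒮) (P : Measure Ω) [IsFiniteMeasure P]
    (G : ℕ) (ω : Ω) : ProbabilityMeasure (𝒮 → ℝ) :=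
  ⟨condDistrib (fun ω s => E.D G s ω / Real.sqrt G) (fun ω (g : Fin G) => E.Sg g ω) P
    (fun g : Fin G => E.Sg g ω), inferInstance⟩

/-- The normal law `N(0, diag (p(s) τ(s)))`. -/
def limitLawD [Fintype 𝒮] (E : TwoStageExperiment Ω 𝒳 𝒞 𝓑 𝒮) (P : Measure Ω) :
    ProbabilityMeasure (𝒮 → ℝ) :=
  ⟨Measure.pi fun s => gaussianReal 0 (E.p P s * E.τ s).toNNReal, inferInstance⟩

/-- The assumptions on the first stage. -/
structure FirstStage [Fintype 𝒮] (E : TwoStageExperiment Ω 𝒳 𝒞 𝓑 𝒮) (P : Measure Ω)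
    [IsFiniteMeasure P] : Prop where
  /-- given the strata, the assignment of clusters is independent of `W^{(G)}` and of the potential
  treatments of units, jointly -/
  exogenous : ∀ G : ℕ, CondIndepGiven P
    (fun ω => ((fun g : Fin G => E.W g ω), (fun g : Fin G => E.Zvec g ω)))
    (fun ω (g : Fin G) => E.H G g ω)
    (fun ω (g : Fin G) => E.Sg g ω)
  τ_nonneg : ∀ s, 0 ≤ E.τ s
  τ_le : ∀ s, E.τ s ≤ E.π₁ * (1 - E.π₁)
  /-- almost surely, the law of `(D_G(s) / √G)_s` given `S^{(G)}` converges weakly to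
  `N(0, diag (p(s) τ(s)))` -/
  balance : ∀ᵐ ω ∂P, Tendsto (fun G : ℕ => E.condLawD P G ω) atTop (𝓝 (E.limitLawD P))

/-- The assumptions on the second stage. -/
structure SecondStage (E : TwoStageExperiment Ω 𝒳 𝒞 𝓑 𝒮) (P : Measure Ω) : Prop where
  /-- no unit is treated under the target fraction `0` -/
  control : ∀ g i, ∀ᵐ ω ∂P, i < E.N g ω → E.Zpot g i false ω = false
  /-- given the strata of all units, potential treatments are independent of `W^{(G)}` -/
  exogenous : ∀ G : ℕ, CondIndepGiven P
    (fun ω (g : Fin G) => E.W g ω)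
    (fun ω (g : Fin G) => E.Zvec g ω)
    (fun ω (g : Fin G) => E.Bvec g ω)
  /-- given the strata of all units, the potential treatments are drawn independently across
  clusters by a common mechanism `κ(B_g)` -/
  mechanism : ∃ κ : Kernel (VarVec 𝓑) (VarVec (Bool → Bool)),
    IsMarkovKernel κ ∧ CondProductLaw P E.Zvec E.Bvec κ
  /-- `E[Z_{i,g}(h) | B_g] = M_g⁻¹ ∑_{j ∈ M_g} Z_{j,g}(h)` for all `i < N_g` -/
  proportion : ∀ (g i : ℕ) (h : Bool), ∀ᵐ ω ∂P, i < E.N g ω →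
    (P⟦{ω | i < E.N g ω ∧ E.Zpot g i h ω = true} |
        MeasurableSpace.comap (E.Bvec g) inferInstance⟧) ω =
      (((E.M g ω).filter fun j => E.Zpot g j h ω = true).card : ℝ) / ((E.M g ω).card : ℝ)

/-! ### Population variances -/

/-- `Ȳ_g(z, h)`: for `h = π₂` the average of `Y_{i,g}(z, π₂)` over the sampled units with
`Z_{i,g}(π₂) = z`, for `h = 0` the average of `Y_{i,g}(z, 0)` over all sampled units. -/
def YbarPot (E : TwoStageExperiment Ω 𝒳 𝒞 𝓑 𝒮) (g : ℕ) (z h : Bool) (ω : Ω) : ℝ :=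
  if h then
    (∑ i ∈ (E.M g ω).filter fun i => E.Zpot g i true ω = z, E.Y g i z true ω) /
      (((E.M g ω).filter fun i => E.Zpot g i true ω = z).card : ℝ)
  else (∑ i ∈ E.M g ω, E.Y g i z false ω) / ((E.M g ω).card : ℝ)

/-- `Ỹ_g(z, h) = N_g / E[N_g] * (Ȳ_g(z, h) - E[Ȳ_g(z, h) N_g] / E[N_g])`. -/
def YtildePot (E : TwoStageExperiment Ω 𝒳 𝒞 𝓑 𝒮) (P : Measure Ω) (g : ℕ) (z h : Bool) (ω : Ω) :
    ℝ :=
  (E.N g ω : ℝ) / P[fun ω => (E.N g ω : ℝ)] *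
    (E.YbarPot g z h ω -
      P[fun ω => E.YbarPot g z h ω * (E.N g ω : ℝ)] / P[fun ω => (E.N g ω : ℝ)])

/-- `m_{z,h}(S_g) = E[Ȳ_g(z, h) | S_g] - E[Ȳ_g(z, h)]`. -/
def m (E : TwoStageExperiment Ω 𝒳 𝒞 𝓑 𝒮) (P : Measure Ω) (g : ℕ) (z h : Bool) (ω : Ω) : ℝ :=
  (P[E.YbarPot g z h | MeasurableSpace.comap (E.Sg g) inferInstance]) ω - P[E.YbarPot g z h]

/-- `E[Ỹ_g(z, h) | S_g]`. -/
def mtilde (E : TwoStageExperiment Ω 𝒳 𝒞 𝓑 𝒮) (P : Measure Ω) (g : ℕ) (z h : Bool) : Ω → ℝ :=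
  P[E.YtildePot P g z h | MeasurableSpace.comap (E.Sg g) inferInstance]

/-- `V₃(z)`, computed from cluster `g`. -/
def V₃ (E : TwoStageExperiment Ω 𝒳 𝒞 𝓑 𝒮) (P : Measure Ω) (g : ℕ) (z : Bool) : ℝ :=
  1 / E.π₁ * Var[E.YbarPot g z true; P] + 1 / (1 - E.π₁) * Var[E.YbarPot g false false; P]
    - E.π₁ * (1 - E.π₁) * ∫ ω, (1 / E.π₁ * E.m P g z true ω
        + 1 / (1 - E.π₁) * E.m P g false false ω) ^ 2 ∂P
    + ∫ ω, E.τ (E.Sg g ω) * (1 / E.π₁ * E.m P g z true ω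
        + 1 / (1 - E.π₁) * E.m P g false false ω) ^ 2 ∂P

/-- `V₄(z)`, computed from cluster `g`. -/
def V₄ (E : TwoStageExperiment Ω 𝒳 𝒞 𝓑 𝒮) (P : Measure Ω) (g : ℕ) (z : Bool) : ℝ :=
  1 / E.π₁ * Var[E.YtildePot P g z true; P] + 1 / (1 - E.π₁) * Var[E.YtildePot P g false false; P]
    - E.π₁ * (1 - E.π₁) * ∫ ω, (1 / E.π₁ * E.mtilde P g z true ω
        + 1 / (1 - E.π₁) * E.mtilde P g false false ω) ^ 2 ∂P
    + ∫ ω, E.τ (E.Sg g ω) * (1 / E.π₁ * E.mtilde P g z true ω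
        + 1 / (1 - E.π₁) * E.mtilde P g false false ω) ^ 2 ∂P

/-! ### Observed data and variance estimators in the sample of size `G` -/

/-- The realized treatment `Z_{i,g} = ∑_h Z_{i,g}(h) I{H_g = h}`. -/
def Z (E : TwoStageExperiment Ω 𝒳 𝒞 𝓑 𝒮) (G g i : ℕ) (ω : Ω) : Bool := E.Zpot g i (E.H G g ω) ω

/-- The observed outcome `Y_{i,g} = Y_{i,g}(Z_{i,g}, H_g)`. -/
def Yobs (E : TwoStageExperiment Ω 𝒳 𝒞 𝓑 𝒮) (G g i : ℕ) (ω : Ω) : ℝ :=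
  E.Y g i (E.Z G g i ω) (E.H G g ω) ω

/-- `I{H_g = h}`. -/
def indH (E : TwoStageExperiment Ω 𝒳 𝒞 𝓑 𝒮) (G : ℕ) (h : Bool) (g : ℕ) (ω : Ω) : ℝ :=
  if E.H G g ω = h then 1 else 0

open Classical in
/-- `I{S_g = s}`. -/
def indS (E : TwoStageExperiment Ω 𝒳 𝒞 𝓑 𝒮) (s : 𝒮) (g : ℕ) (ω : Ω) : ℝ :=
  if E.Sg g ω = s then 1 else 0

/-- The observed cluster average
`Ȳ_g^z = (M_g^z)⁻¹ ∑_{i ∈ M_g} Y_{i,g} I{H_g = π₂, Z_{i,g} = z} + M_g⁻¹ ∑_{i ∈ M_g} Y_{i,g} I{H_g = 0}`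
with `M_g^z = #{i ∈ M_g : Z_{i,g} = z}`. -/
def Ybar (E : TwoStageExperiment Ω 𝒳 𝒞 𝓑 𝒮) (G : ℕ) (z : Bool) (g : ℕ) (ω : Ω) : ℝ :=
  (∑ i ∈ E.M g ω, E.Yobs G g i ω * (if E.H G g ω = true ∧ E.Z G g i ω = z then 1 else 0)) /
      (((E.M g ω).filter fun i => E.Z G g i ω = z).card : ℝ)
    + (∑ i ∈ E.M g ω, E.Yobs G g i ω * E.indH G false g ω) / ((E.M g ω).card : ℝ)

/-- The number `G_1` (`h = π₂`) or `G_0` (`h = 0`) of clusters with `H_g = h`. -/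
def count (E : TwoStageExperiment Ω 𝒳 𝒞 𝓑 𝒮) (G : ℕ) (h : Bool) (ω : Ω) : ℝ :=
  ∑ g ∈ Finset.range G, E.indH G h g ω

/-- The number `G_1(s)` (`h = π₂`) or `G_0(s)` (`h = 0`) of clusters with `H_g = h`, `S_g = s`. -/
def countIn (E : TwoStageExperiment Ω 𝒳 𝒞 𝓑 𝒮) (G : ℕ) (h : Bool) (s : 𝒮) (ω : Ω) : ℝ :=
  ∑ g ∈ Finset.range G, E.indH G h g ω * E.indS s g ω

/-- `G(s) / G`, the fraction of clusters in the stratum `s`. -/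
def share (E : TwoStageExperiment Ω 𝒳 𝒞 𝓑 𝒮) (G : ℕ) (s : 𝒮) (ω : Ω) : ℝ :=
  (∑ g ∈ Finset.range G, E.indS s g ω) / G

/-- The average of `U_g` over the clusters with `H_g = h`. -/
def armMean (E : TwoStageExperiment Ω 𝒳 𝒞 𝓑 𝒮) (G : ℕ) (U : ℕ → Ω → ℝ) (h : Bool) (ω : Ω) : ℝ :=
  (∑ g ∈ Finset.range G, U g ω * E.indH G h g ω) / E.count G h ω

/-- The average of `U_g` over the clusters with `H_g = h` and `S_g = s`. -/
def stratumMean (E : TwoStageExperiment Ω 𝒳 𝒞 𝓑 𝒮) (G : ℕ) (U : ℕ → Ω → ℝ) (h : Bool) (s : 𝒮)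
    (ω : Ω) : ℝ :=
  (∑ g ∈ Finset.range G, U g ω * (E.indH G h g ω * E.indS s g ω)) / E.countIn G h s ω

/-- The sample average of cluster sizes. -/
def Nbar (E : TwoStageExperiment Ω 𝒳 𝒞 𝓑 𝒮) (G : ℕ) (ω : Ω) : ℝ :=
  (∑ g ∈ Finset.range G, (E.N g ω : ℝ)) / G

/-- The observed adjusted outcome
`Ỹ_g^z = N_g / N̄ * (Ȳ_g^z - (G_g⁻¹ ∑_j Ȳ_j^z I{H_g = H_j} N_j) / N̄)`
with `N̄` the average cluster size and `G_g = #{j : H_j = H_g}`. -/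
def Ytilde (E : TwoStageExperiment Ω 𝒳 𝒞 𝓑 𝒮) (G : ℕ) (z : Bool) (g : ℕ) (ω : Ω) : ℝ :=
  (E.N g ω : ℝ) / E.Nbar G ω *
    (E.Ybar G z g ω -
      E.armMean G (fun j ω => E.Ybar G z j ω * (E.N j ω : ℝ)) (E.H G g ω) ω / E.Nbar G ω)

/-- The estimator of `V₃(z)`. -/
def V₃hat [Fintype 𝒮] (E : TwoStageExperiment Ω 𝒳 𝒞 𝓑 𝒮) (G : ℕ) (z : Bool) (ω : Ω) : ℝ :=
  1 / E.π₁ * (E.armMean G (fun g ω => E.Ybar G z g ω ^ 2) true ω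
      - ∑ s, E.share G s ω * E.stratumMean G (E.Ybar G z) true s ω ^ 2)
    + 1 / (1 - E.π₁) * (E.armMean G (fun g ω => E.Ybar G z g ω ^ 2) false ω
      - ∑ s, E.share G s ω * E.stratumMean G (E.Ybar G false) false s ω ^ 2)
    + ∑ s, E.share G s ω *
        ((E.stratumMean G (E.Ybar G z) true s ω - E.armMean G (E.Ybar G z) true ω)
        - (E.stratumMean G (E.Ybar G false) false s ω - E.armMean G (E.Ybar G false) false ω)) ^ 2
    + ∑ s, E.τ s * E.share G s ω *
        (1 / E.π₁ * (E.stratumMean G (E.Ybar G z) true s ω - E.armMean G (E.Ybar G z) true ω)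
        + 1 / (1 - E.π₁) * (E.stratumMean G (E.Ybar G false) false s ω
            - E.armMean G (E.Ybar G false) false ω)) ^ 2

/-- The estimator of `V₄(z)`. -/
def V₄hat [Fintype 𝒮] (E : TwoStageExperiment Ω 𝒳 𝒞 𝓑 𝒮) (G : ℕ) (z : Bool) (ω : Ω) : ℝ :=
  1 / E.π₁ * (E.armMean G (fun g ω => E.Ytilde G z g ω ^ 2) true ω
      - ∑ s, E.share G s ω * E.stratumMean G (E.Ytilde G z) true s ω ^ 2)
    + 1 / (1 - E.π₁) * (E.armMean G (fun g ω => E.Ytilde G z g ω ^ 2) false ω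
      - ∑ s, E.share G s ω * E.stratumMean G (E.Ytilde G false) false s ω ^ 2)
    + ∑ s, E.share G s ω *
        (E.stratumMean G (E.Ytilde G z) true s ω
        - E.stratumMean G (E.Ytilde G false) false s ω) ^ 2
    + ∑ s, E.τ s * E.share G s ω *
        (1 / E.π₁ * E.stratumMean G (E.Ytilde G z) true s ω
        + 1 / (1 - E.π₁) * E.stratumMean G (E.Ytilde G false) false s ω) ^ 2

end

end TwoStageExperiment

/-! On the clusters of one arm, an observed cluster average is a potential one (`Ybar_eq_YbarPot`),
hence a function of the tuple `E.cluster g` of potential treatments, outcomes, covariates and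
sampled units. These tuples are i.i.d.: the outcomes are conditionally independent marks on the
i.i.d. triples `(M_g, C_g, N_g)`, and the treatments are marks on the result (`HasMarks`,
`stratifiedDesign`). What remains is a law of large numbers over arms and strata, a moment bound,
and algebra.

Law of large numbers. The assignments `H` may depend on each other, but given the strata they are
independent of the tuples. If `ψ` has mean zero in every stratum, the terms of different clusters
are therefore orthogonal (`integral_cross`), and the sum of `ψ` over an arm has second moment at
most `G * E[ψ²]`. Density of `L²` in `L¹` extends the resulting convergence to integrable `ψ`
(`tendsto_integral_abs`). A general function is its stratum mean plus a centered part; the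
contribution of the mean is governed by the share of clusters in the arm and stratum. That share
converges because `D_G(s)/√G` has a limit law, so that `D_G(s)/G` tends to `0` (`tendstoProb_D`).
Averages within a stratum thus tend to conditional means given the stratum.

Moments. The average `Ȳ_g` runs over a random set of units, but neither sampling nor treatment
carries information on outcomes beyond the covariates. Given these, the event that particular units
are selected acts as a weight depending on covariates alone, so the conditional bound on `Y²`
survives (`setLIntegral_Y_sq_le`). Jensen's inequality then gives `E[(N Ȳ)²] ≤ K E[N²]`.

Algebra. The continuous mapping theorem gives a limit in terms of stratum means. It equals the
target by the within/between decomposition of second moments and the identity `(x - y)² = x²/π +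
y²/(1-π) - π(1-π)(x/π + y/(1-π))²` (`variance_decomposition`). For the adjusted outcomes, the random
normalizations are constant on each arm, come out of the averages and converge separately. -/

open scoped ENNReal

/-! ### Conditional probabilities -/

section CondProb

variable {Ω : Type*} {m mΩ : MeasurableSpace Ω} {P : Measure Ω}

theorem condProb_nonneg (m : MeasurableSpace Ω) (A : Set Ω) : 0 ≤ᵐ[P] P⟦A | m⟧ :=
  condExp_nonneg (Eventually.of_forall fun ω => Set.indicator_nonneg (fun _ _ => zero_le_one) ω)

theorem condProb_le_one [IsProbabilityMeasure P] (hm : m ≤ mΩ) {A : Set Ω} (hA : MeasurableSet A) :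
    P⟦A | m⟧ ≤ᵐ[P] 1 := by
  have h := condExp_mono (m := m) (μ := P) ((integrable_const (1 : ℝ)).indicator hA)
    (integrable_const (1 : ℝ))
    (Eventually.of_forall fun ω => Set.indicator_le_self' (fun _ _ => zero_le_one) ω)
  rw [condExp_const hm] at h
  exact h

theorem condProb_norm_le_one [IsProbabilityMeasure P] (hm : m ≤ mΩ) {A : Set Ω}
    (hA : MeasurableSet A) : ∀ᵐ ω ∂P, ‖(P⟦A | m⟧) ω‖ ≤ 1 := by
  filter_upwards [condProb_nonneg (P := P) m A, condProb_le_one (P := P) hm hA] with ω h0 h1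
  rw [Real.norm_of_nonneg h0]
  exact h1

/-- An integral over an event of the conditioning σ-algebra intersected with another event. -/
theorem setIntegral_inter_condExp [IsProbabilityMeasure P] (hm : m ≤ mΩ) {A D : Set Ω}
    (hA : MeasurableSet A) (hD : MeasurableSet[m] D) {q : Ω → ℝ} (hq : StronglyMeasurable[m] q)
    (hqi : Integrable q P) :
    ∫ ω in A ∩ D, q ω ∂P = ∫ ω in D, (P⟦A | m⟧) ω * q ω ∂P := by
  have hqA : Integrable ((A.indicator fun _ => (1 : ℝ)) * q) P := by
    refine (hqi.indicator hA).congr (Eventually.of_forall fun ω => ?_)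
    by_cases h : ω ∈ A <;> simp [h]
  have h := condExp_mul_of_stronglyMeasurable_right (m := m) (μ := P) hq hqA
    ((integrable_const (1 : ℝ)).indicator hA)
  calc ∫ ω in A ∩ D, q ω ∂P = ∫ ω in D, ((A.indicator fun _ => (1 : ℝ)) * q) ω ∂P := by
        rw [Set.inter_comm, ← setIntegral_indicator hA]
        refine integral_congr_ae (Eventually.of_forall fun ω => ?_)
        by_cases h : ω ∈ A <;> simp [h]
    _ = ∫ ω in D, (P[(A.indicator fun _ => (1 : ℝ)) * q | m]) ω ∂P :=
        (setIntegral_condExp hm hqA hD).symm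
    _ = _ := integral_congr_ae (ae_restrict_of_ae h)

end CondProb

/-! ### Conditional independence as a change of weights -/

section CondIndepGiven

variable {Ω α β γ : Type*} [mΩ : MeasurableSpace Ω] [MeasurableSpace α] [MeasurableSpace β]
    [mγ : MeasurableSpace γ] {P : Measure Ω} {f : Ω → α} {g : Ω → β} {k : Ω → γ}

theorem CondIndepGiven.symm (h : CondIndepGiven P f g k) : CondIndepGiven P g f k := by
  intro s t hs ht
  filter_upwards [h t s ht hs] with ω hω
  rw [Set.inter_comm, hω, mul_comm]

theorem CondIndepGiven.comp {α' β' : Type*} [MeasurableSpace α'] [MeasurableSpace β']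
    (h : CondIndepGiven P f g k) {u : α → α'} {v : β → β'} (hu : Measurable u)
    (hv : Measurable v) : CondIndepGiven P (fun ω => u (f ω)) (fun ω => v (g ω)) k :=
  fun s t hs ht => h (u ⁻¹' s) (v ⁻¹' t) (hu hs) (hv ht)

variable [IsProbabilityMeasure P]

/-- On the `k`-event the two conditional probabilities multiply; that of `g` is `k`-measurable, so
that of `f` can be turned back into an indicator. -/
theorem CondIndepGiven.measureReal_inter (h : CondIndepGiven P f g k) (hf : Measurable f)
    (hg : Measurable g) (hk : Measurable k) {s : Set α} {t : Set β} {D : Set γ}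
    (hs : MeasurableSet s) (ht : MeasurableSet t) (hD : MeasurableSet D) :
    P.real (f ⁻¹' s ∩ k ⁻¹' D ∩ g ⁻¹' t) =
      ∫ ω in f ⁻¹' s ∩ k ⁻¹' D, (P⟦g ⁻¹' t | mγ.comap k⟧) ω ∂P := by
  have hm : mγ.comap k ≤ mΩ := hk.comap_le
  have hD' : MeasurableSet[mγ.comap k] (k ⁻¹' D) := ⟨D, hD, rfl⟩
  have hA : MeasurableSet (f ⁻¹' s ∩ g ⁻¹' t) := (hf hs).inter (hg ht)
  rw [setIntegral_inter_condExp hm (hf hs) hD' stronglyMeasurable_condExp integrable_condExp,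
    ← integral_congr_ae (ae_restrict_of_ae (h s t hs ht)),
    setIntegral_condExp hm ((integrable_const (1 : ℝ)).indicator hA) hD',
    setIntegral_indicator hA, Set.inter_right_comm, Set.inter_comm]
  simp

/-- Rectangles determine a law on the product. Once both measures are known to agree on them,
arbitrary functions of `(f, k)` can be integrated, not only products. -/
theorem CondIndepGiven.map_restrict (h : CondIndepGiven P f g k) (hf : Measurable f)
    (hg : Measurable g) (hk : Measurable k) {t : Set β} (ht : MeasurableSet t) :
    (P.restrict (g ⁻¹' t)).map (fun ω => (f ω, k ω)) =
      (P.withDensity fun ω => ENNReal.ofReal ((P⟦g ⁻¹' t | mγ.comap k⟧) ω)).map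
        (fun ω => (f ω, k ω)) := by
  refine Measure.ext_prod fun {s D} hs hD => ?_
  have hfk : Measurable fun ω => (f ω, k ω) := hf.prodMk hk
  have hset : (fun ω => (f ω, k ω)) ⁻¹' (s ×ˢ D) = f ⁻¹' s ∩ k ⁻¹' D := rfl
  rw [Measure.map_apply hfk (hs.prod hD), Measure.map_apply hfk (hs.prod hD), hset,
    Measure.restrict_apply ((hf hs).inter (hk hD)), withDensity_apply _ ((hf hs).inter (hk hD)),
    ← ofReal_integral_eq_lintegral_ofReal integrable_condExp.integrableOn
      (ae_restrict_of_ae (condProb_nonneg _ _)),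
    ← h.measureReal_inter hf hg hk hs ht hD, ofReal_measureReal]

theorem CondIndepGiven.setLIntegral (h : CondIndepGiven P f g k) (hf : Measurable f)
    (hg : Measurable g) (hk : Measurable k) {t : Set β} (ht : MeasurableSet t)
    {u : α × γ → ℝ≥0∞} (hu : Measurable u) :
    ∫⁻ ω in g ⁻¹' t, u (f ω, k ω) ∂P =
      ∫⁻ ω, ENNReal.ofReal ((P⟦g ⁻¹' t | mγ.comap k⟧) ω) * u (f ω, k ω) ∂P := by
  have hfk : Measurable fun ω => (f ω, k ω) := hf.prodMk hk
  have hq : Measurable fun ω => ENNReal.ofReal ((P⟦g ⁻¹' t | mγ.comap k⟧) ω) :=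
    ((stronglyMeasurable_condExp.mono hk.comap_le).measurable).ennreal_ofReal
  rw [← lintegral_map hu hfk, h.map_restrict hf hg hk ht, lintegral_map hu hfk,
    lintegral_withDensity_eq_lintegral_mul _ hq (g := fun ω => u (f ω, k ω)) (hu.comp hfk)]
  rfl

/-- Both sides integrate `u` against the same image measure, so integrability of `u` is not needed.
-/
theorem CondIndepGiven.setIntegral (h : CondIndepGiven P f g k) (hf : Measurable f)
    (hg : Measurable g) (hk : Measurable k) {t : Set β} (ht : MeasurableSet t)
    {u : α × γ → ℝ} (hu : Measurable u) :
    ∫ ω in g ⁻¹' t, u (f ω, k ω) ∂P =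
      ∫ ω, (P⟦g ⁻¹' t | mγ.comap k⟧) ω * u (f ω, k ω) ∂P := by
  have hfk : Measurable fun ω => (f ω, k ω) := hf.prodMk hk
  have hq : Measurable fun ω => ENNReal.ofReal ((P⟦g ⁻¹' t | mγ.comap k⟧) ω) :=
    ((stronglyMeasurable_condExp.mono hk.comap_le).measurable).ennreal_ofReal
  rw [← integral_map (f := u) hfk.aemeasurable hu.aestronglyMeasurable,
    h.map_restrict hf hg hk ht,
    integral_map hfk.aemeasurable hu.aestronglyMeasurable,
    integral_withDensity_eq_integral_toReal_smul hq (by simp)]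
  refine integral_congr_ae ?_
  filter_upwards [condProb_nonneg (P := P) (mγ.comap k) (g ⁻¹' t)] with ω hω
  rw [ENNReal.toReal_ofReal hω, smul_eq_mul]

end CondIndepGiven

/-! ### Extending an i.i.d. sequence by conditionally independent marks -/

section Marks

variable {Ω α β : Type*} [mΩ : MeasurableSpace Ω] [MeasurableSpace α] [MeasurableSpace β]
    {P : Measure Ω}

/-- The product formula for the joint law of `(k g, f g)`, `g < G`, when given `k` the marks
`f g` are independent with laws `K (k g)`. -/
def HasMarks (P : Measure Ω) (f : ℕ → Ω → α) (k : ℕ → Ω → β) (K : Kernel β α) : Prop :=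
  ∀ (G : ℕ) (A : Fin G → Set α) (B : Fin G → Set β), (∀ g, MeasurableSet (A g)) →
    (∀ g, MeasurableSet (B g)) →
    P.real ((⋂ g : Fin G, f g ⁻¹' A g) ∩ ⋂ g : Fin G, k g ⁻¹' B g) =
      ∫ ω, ∏ g, (B g).indicator (fun b => (K b).real (A g)) (k g ω) ∂P

theorem measurable_indicator_kernel {K : Kernel β α} {A : Set α} {B : Set β}
    (hA : MeasurableSet A) (hB : MeasurableSet B) :
    Measurable (B.indicator fun b => (K b).real A) :=
  (K.measurable_coe hA).ennreal_toReal.indicator hB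

/-- The integrand in `HasMarks` is a product of functions of independent variables, and identical
laws allow each factor to be computed at `k 0`. -/
theorem HasMarks.measure_prod {f : ℕ → Ω → α} {k : ℕ → Ω → β} {K : Kernel β α}
    (h : HasMarks P f k K) (hk : ∀ g, Measurable (k g)) (hki : iIndepFun k P)
    (hkid : ∀ g, IdentDistrib (k g) (k 0) P P)
    (G : ℕ) (A : Fin G → Set α) (B : Fin G → Set β) (hA : ∀ g, MeasurableSet (A g))
    (hB : ∀ g, MeasurableSet (B g)) :
    P.real ((⋂ g : Fin G, f g ⁻¹' A g) ∩ ⋂ g : Fin G, k g ⁻¹' B g) =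
      ∏ g, ∫ ω, (B g).indicator (fun b => (K b).real (A g)) (k 0 ω) ∂P := by
  have hki' : iIndepFun (fun g : Fin G => k g) P := hki.precomp Fin.val_injective
  rw [h G A B hA hB, hki'.integral_fun_prod_comp (fun g => (hk g).aemeasurable)
    (f := fun g => (B g).indicator fun b => (K b).real (A g))
    (fun g => (measurable_indicator_kernel (hA g) (hB g)).aestronglyMeasurable)]
  refine Finset.prod_congr rfl fun g _ => ?_
  exact ((hkid g).comp (measurable_indicator_kernel (hA g) (hB g))).integral_eq

variable [IsProbabilityMeasure P]

theorem HasMarks.measure_single {f : ℕ → Ω → α} {k : ℕ → Ω → β} {K : Kernel β α}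
    [IsMarkovKernel K] (h : HasMarks P f k K) (hk : ∀ g, Measurable (k g)) (hki : iIndepFun k P)
    (hkid : ∀ g, IdentDistrib (k g) (k 0) P P) (g : ℕ) {A : Set α} {B : Set β}
    (hA : MeasurableSet A) (hB : MeasurableSet B) :
    P.real (f g ⁻¹' A ∩ k g ⁻¹' B) = ∫ ω, B.indicator (fun b => (K b).real A) (k 0 ω) ∂P := by
  classical
  -- All other clusters get trivial events; their factors are `1` because `K` is Markov.
  have := h.measure_prod hk hki hkid (g + 1) (fun j => if (j : ℕ) = g then A else Set.univ)
    (fun j => if (j : ℕ) = g then B else Set.univ)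
    (fun j => by split_ifs <;> simp [hA]) (fun j => by split_ifs <;> simp [hB])
  rw [Finset.prod_eq_single (⟨g, by omega⟩ : Fin (g + 1))] at this
  · simp only [if_true] at this
    rw [← this]
    congr 1
    ext ω
    simp only [Set.mem_inter_iff, Set.mem_preimage, Set.mem_iInter]
    constructor
    · rintro ⟨h1, h2⟩
      constructor <;> intro j <;> split_ifs with hj <;> simp [hj, h1, h2]
    · rintro ⟨h1, h2⟩
      exact ⟨by simpa using h1 ⟨g, by omega⟩, by simpa using h2 ⟨g, by omega⟩⟩
  · intro j _ hj
    have hj' : (j : ℕ) ≠ g := fun h => hj (Fin.ext h)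
    simp [hj']
  · simp

theorem HasMarks.identDistrib {f : ℕ → Ω → α} {k : ℕ → Ω → β} {K : Kernel β α}
    [IsMarkovKernel K] (h : HasMarks P f k K) (hf : ∀ g, Measurable (f g))
    (hk : ∀ g, Measurable (k g)) (hki : iIndepFun k P)
    (hkid : ∀ g, IdentDistrib (k g) (k 0) P P) (g : ℕ) :
    IdentDistrib (fun ω => (f g ω, k g ω)) (fun ω => (f 0 ω, k 0 ω)) P P := by
  refine ⟨((hf g).prodMk (hk g)).aemeasurable, ((hf 0).prodMk (hk 0)).aemeasurable, ?_⟩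
  refine Measure.ext_prod fun {A B} hA hB => ?_
  rw [Measure.map_apply ((hf g).prodMk (hk g)) (hA.prod hB),
    Measure.map_apply ((hf 0).prodMk (hk 0)) (hA.prod hB)]
  have h1 := h.measure_single hk hki hkid g hA hB
  rw [← h.measure_single hk hki hkid 0 hA hB] at h1
  exact (measureReal_eq_measureReal_iff).1 h1

/-- Rectangles form a π-system generating each σ-algebra, and on rectangles the product formula is
`measure_prod`. -/
theorem HasMarks.iIndepFun {f : ℕ → Ω → α} {k : ℕ → Ω → β} {K : Kernel β α}
    [IsMarkovKernel K] (h : HasMarks P f k K) (hf : ∀ g, Measurable (f g))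
    (hk : ∀ g, Measurable (k g)) (hki : iIndepFun k P)
    (hkid : ∀ g, IdentDistrib (k g) (k 0) P P) :
    iIndepFun (fun g ω => (f g ω, k g ω)) P := by
  classical
  refine iIndepSets.iIndep (fun g => ((hf g).prodMk (hk g)).comap_le)
    (fun g => (Set.preimage fun ω => (f g ω, k g ω)) ''
      Set.image2 (· ×ˢ ·) {s | MeasurableSet s} {t | MeasurableSet t})
    (fun g => isPiSystem_prod.comap _) (fun g => ?_) ?_
  · rw [← generateFrom_prod, MeasurableSpace.comap_generateFrom]
  · rw [iIndepSets_iff]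
    intro S F hF
    -- Indices outside `S` are padded with trivial rectangles, since the product formula concerns
    -- initial segments of indices.
    have hF' : ∀ g, ∃ A : Set α, ∃ B : Set β, MeasurableSet A ∧ MeasurableSet B ∧
        (g ∈ S → F g = f g ⁻¹' A ∩ k g ⁻¹' B) ∧ (g ∉ S → A = Set.univ ∧ B = Set.univ) := by
      intro g
      by_cases hg : g ∈ S
      · obtain ⟨_, ⟨A, hA, B, hB, rfl⟩, hAB⟩ := hF g hg
        exact ⟨A, B, hA, hB, fun _ => hAB.symm, fun h => absurd hg h⟩
      · exact ⟨Set.univ, Set.univ, .univ, .univ, fun h => absurd h hg, fun _ => ⟨rfl, rfl⟩⟩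
    choose A B hA hB hAB hnot using hF'
    set G := S.sup id + 1 with hG
    have hSG : ∀ g ∈ S, g < G := fun g hg => Nat.lt_succ_of_le (Finset.le_sup (f := id) hg)
    have key := h.measure_prod hk hki hkid G (fun g => A g) (fun g => B g) (fun g => hA g)
      (fun g => hB g)
    have hset : ((⋂ g : Fin G, f g ⁻¹' A g) ∩ ⋂ g : Fin G, k g ⁻¹' B g) = ⋂ g ∈ S, F g := by
      ext ω
      simp only [Set.mem_inter_iff, Set.mem_iInter, Set.mem_preimage]
      constructor
      · rintro ⟨h1, h2⟩ g hg
        rw [hAB g hg]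
        exact ⟨h1 ⟨g, hSG g hg⟩, h2 ⟨g, hSG g hg⟩⟩
      · intro h1
        constructor <;> intro g <;> by_cases hg : (g : ℕ) ∈ S
        · have := h1 g hg; rw [hAB g hg] at this; exact this.1
        · rw [(hnot g hg).1]; trivial
        · have := h1 g hg; rw [hAB g hg] at this; exact this.2
        · rw [(hnot g hg).2]; trivial
    have hprod : ∏ g : Fin G, ∫ ω, (B g).indicator (fun b => (K b).real (A g)) (k 0 ω) ∂P =
        ∏ g ∈ S, P.real (F g) := by
      rw [Fin.prod_univ_eq_prod_range
        (fun g => ∫ ω, (B g).indicator (fun b => (K b).real (A g)) (k 0 ω) ∂P) G,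
        ← Finset.prod_subset (fun g hg => Finset.mem_range.2 (hSG g hg))]
      · refine Finset.prod_congr rfl fun g hg => ?_
        rw [hAB g hg, h.measure_single hk hki hkid g (hA g) (hB g)]
      · intro g _ hg
        rw [(hnot g hg).1, (hnot g hg).2]
        simp
    rw [hset, hprod] at key
    rw [← ENNReal.toReal_eq_toReal_iff' (measure_ne_top _ _)
      (ENNReal.prod_ne_top fun _ _ => measure_ne_top _ _), ENNReal.toReal_prod]
    exact key

theorem CondProductLaw.hasMarks {f : ℕ → Ω → α} {k : ℕ → Ω → β} {K : Kernel β α}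
    (h : CondProductLaw P f k K) (hf : ∀ g, Measurable (f g)) (hk : ∀ g, Measurable (k g)) :
    HasMarks P f k K := by
  intro G A B hA hB
  have hkG : Measurable fun ω (g : Fin G) => k g ω := measurable_pi_lambda _ fun g => hk g
  have hD : MeasurableSet (Set.univ.pi B) := MeasurableSet.univ_pi hB
  have hset : (⋂ g : Fin G, k g ⁻¹' B g) = (fun ω (g : Fin G) => k g ω) ⁻¹' Set.univ.pi B := by
    ext ω; simp
  have hA' : MeasurableSet (⋂ g : Fin G, f g ⁻¹' A g) := .iInter fun g => hf g (hA g)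
  have h1 := setIntegral_condExp (m := MeasurableSpace.comap (fun ω (g : Fin G) => k g ω)
    inferInstance) (μ := P) hkG.comap_le ((integrable_const (1 : ℝ)).indicator hA')
    ⟨_, hD, rfl⟩
  rw [integral_congr_ae (ae_restrict_of_ae (h G A hA)), setIntegral_indicator hA',
    ← integral_indicator (hkG hD)] at h1
  rw [hset, Set.inter_comm]
  simp only [integral_const, MeasurableSet.univ, measureReal_restrict_apply, Set.univ_inter,
    smul_eq_mul, mul_one] at h1
  rw [← h1]
  refine integral_congr_ae (Eventually.of_forall fun ω => ?_)
  -- If some `k g` misses `B g`, the product on the right has a zero factor.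
  by_cases hω : ∀ g : Fin G, k g ω ∈ B g
  · simp [Set.indicator, hω]
  · have hω' := hω
    push Not at hω'
    obtain ⟨g, hg⟩ := hω'
    simp only [Set.indicator, Set.mem_preimage, Set.mem_pi, Set.mem_univ, true_implies, hω,
      if_false]
    exact (Finset.prod_eq_zero (Finset.mem_univ g) (by simp [hg])).symm

end Marks

/-! ### Convergence in probability to constants -/

section ConvergenceInProbability

variable {Ω : Type*} [MeasurableSpace Ω] {P : Measure Ω}

/-- Convergence in probability of real random variables to a constant. -/
def TendstoProb (P : Measure Ω) (X : ℕ → Ω → ℝ) (a : ℝ) : Prop :=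
  TendstoInMeasure P X atTop fun _ => a

theorem tendstoProb_iff {X : ℕ → Ω → ℝ} {a : ℝ} :
    TendstoProb P X a ↔
      ∀ ε, 0 < ε → Tendsto (fun n => P {ω | ε ≤ |X n ω - a|}) atTop (𝓝 0) := by
  rw [TendstoProb, tendstoInMeasure_iff_norm]
  rfl

theorem TendstoProb.tendsto_measure_notMem {X : ℕ → Ω → ℝ} {a : ℝ} (h : TendstoProb P X a)
    {U : Set ℝ} (hU : U ∈ 𝓝 a) : Tendsto (fun n => P {ω | X n ω ∉ U}) atTop (𝓝 0) := by
  obtain ⟨ε, hε, hεU⟩ := Metric.mem_nhds_iff.1 hU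
  refine tendsto_of_tendsto_of_tendsto_of_le_of_le tendsto_const_nhds
    (tendstoProb_iff.1 h ε hε) (fun _ => zero_le) fun n => measure_mono fun ω hω => ?_
  by_contra hlt
  exact hω (hεU (by simpa [Real.dist_eq] using hlt))

/-- The continuous mapping theorem for two sequences converging in probability to constants. -/
theorem TendstoProb.map₂ {X Y : ℕ → Ω → ℝ} {a b : ℝ} (hX : TendstoProb P X a)
    (hY : TendstoProb P Y b) {φ : ℝ → ℝ → ℝ}
    (hφ : ContinuousAt (fun p : ℝ × ℝ => φ p.1 p.2) (a, b)) :
    TendstoProb P (fun n ω => φ (X n ω) (Y n ω)) (φ a b) := by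
  rw [tendstoProb_iff]
  intro ε hε
  have hmem := hφ (Metric.ball_mem_nhds (φ a b) hε)
  rw [mem_map, nhds_prod_eq, mem_prod_iff] at hmem
  obtain ⟨U, hU, V, hV, hUV⟩ := hmem
  have hlim := (hX.tendsto_measure_notMem hU).add (hY.tendsto_measure_notMem hV)
  rw [add_zero] at hlim
  refine tendsto_of_tendsto_of_tendsto_of_le_of_le tendsto_const_nhds hlim (fun _ => zero_le)
    fun n => (measure_mono fun ω hω => ?_).trans (measure_union_le _ _)
  by_contra hnot
  simp only [Set.mem_union, Set.mem_ofPred_eq, not_or, not_not] at hnot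
  have := hUV (Set.mk_mem_prod hnot.1 hnot.2)
  simp only [Set.mem_preimage, Metric.mem_ball, Real.dist_eq] at this
  exact absurd hω (not_le.2 this)

theorem tendstoProb_const (a : ℝ) : TendstoProb P (fun _ _ => a) a := by
  rw [tendstoProb_iff]
  intro ε hε
  simp [not_le.2 hε]

theorem TendstoProb.add {X Y : ℕ → Ω → ℝ} {a b : ℝ} (hX : TendstoProb P X a)
    (hY : TendstoProb P Y b) : TendstoProb P (fun n ω => X n ω + Y n ω) (a + b) :=
  hX.map₂ hY (φ := fun x y => x + y) (by fun_prop)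

theorem TendstoProb.sub {X Y : ℕ → Ω → ℝ} {a b : ℝ} (hX : TendstoProb P X a)
    (hY : TendstoProb P Y b) : TendstoProb P (fun n ω => X n ω - Y n ω) (a - b) :=
  hX.map₂ hY (φ := fun x y => x - y) (by fun_prop)

theorem TendstoProb.mul {X Y : ℕ → Ω → ℝ} {a b : ℝ} (hX : TendstoProb P X a)
    (hY : TendstoProb P Y b) : TendstoProb P (fun n ω => X n ω * Y n ω) (a * b) :=
  hX.map₂ hY (φ := fun x y => x * y) (by fun_prop)

/-- Denominators may vanish at finite `n`; continuity of division at `(a, b)` suffices. -/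
theorem TendstoProb.div {X Y : ℕ → Ω → ℝ} {a b : ℝ} (hX : TendstoProb P X a)
    (hY : TendstoProb P Y b) (hb : b ≠ 0) : TendstoProb P (fun n ω => X n ω / Y n ω) (a / b) :=
  hX.map₂ hY (φ := fun x y => x / y) (continuousAt_fst.div continuousAt_snd hb)

theorem TendstoProb.pow {X : ℕ → Ω → ℝ} {a : ℝ} (hX : TendstoProb P X a) (k : ℕ) :
    TendstoProb P (fun n ω => X n ω ^ k) (a ^ k) :=
  hX.map₂ hX (φ := fun x _ => x ^ k) (by fun_prop)

theorem TendstoProb.const_mul {X : ℕ → Ω → ℝ} {a : ℝ} (c : ℝ) (hX : TendstoProb P X a) :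
    TendstoProb P (fun n ω => c * X n ω) (c * a) :=
  (tendstoProb_const c).mul hX

theorem TendstoProb.sum {ι : Type*} (s : Finset ι) {X : ι → ℕ → Ω → ℝ} {a : ι → ℝ}
    (h : ∀ i ∈ s, TendstoProb P (X i) (a i)) :
    TendstoProb P (fun n ω => ∑ i ∈ s, X i n ω) (∑ i ∈ s, a i) := by
  classical
  induction s using Finset.induction_on with
  | empty => simpa using tendstoProb_const (P := P) 0
  | insert i s hi ih =>
    simp only [Finset.sum_insert hi]
    exact (h i (Finset.mem_insert_self i s)).add
      (ih fun j hj => h j (Finset.mem_insert_of_mem hj))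

theorem TendstoProb.congr {X Y : ℕ → Ω → ℝ} {a : ℝ} (hX : TendstoProb P X a)
    (h : ∀ n, X n =ᵐ[P] Y n) : TendstoProb P Y a :=
  TendstoInMeasure.congr_left h hX

theorem tendstoProb_of_integral_abs {X : ℕ → Ω → ℝ} (hX : ∀ n, Integrable (X n) P)
    (h : Tendsto (fun n => ∫ ω, |X n ω| ∂P) atTop (𝓝 0)) : TendstoProb P X 0 := by
  refine tendstoInMeasure_of_tendsto_eLpNorm one_ne_zero (fun n => (hX n).1)
    aestronglyMeasurable_const ?_
  have : ∀ n, eLpNorm (X n - fun _ => 0) 1 P = ENNReal.ofReal (∫ ω, |X n ω| ∂P) := by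
    intro n
    have : (X n - fun _ => 0) = X n := by ext; simp
    rw [this, eLpNorm_one_eq_lintegral_enorm, ← ofReal_integral_norm_eq_lintegral_enorm (hX n)]
    rfl
  simp_rw [this]
  have := (ENNReal.continuous_ofReal.tendsto 0).comp h
  rwa [ENNReal.ofReal_zero] at this

end ConvergenceInProbability

/-! ### A law of large numbers for stratified assignment -/

/-- The indicator of `H G g = h`. -/
def armInd {Ω : Type*} (H : ℕ → ℕ → Ω → Bool) (G : ℕ) (h : Bool) (g : ℕ) (ω : Ω) : ℝ :=
  if H G g ω = h then 1 else 0

theorem abs_armInd_le {Ω : Type*} (H : ℕ → ℕ → Ω → Bool) (G : ℕ) (h : Bool) (g : ℕ) (ω : Ω) :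
    |armInd H G h g ω| ≤ 1 := by
  rw [armInd]
  split_ifs <;> simp

section StratifiedLLN

variable {Ω 𝒯 𝒮 : Type*} [mΩ : MeasurableSpace Ω] [m𝒯 : MeasurableSpace 𝒯]
    [m𝒮 : MeasurableSpace 𝒮] {P : Measure Ω}

/-- An i.i.d. sequence `T`, strata `σ (T g)` with finitely many values, and assignments
`H G g`, `g < G`, that are independent of `T 0, …, T (G - 1)` given the strata. -/
structure StratifiedDesign (P : Measure Ω) (T : ℕ → Ω → 𝒯) (σ : 𝒯 → 𝒮) (H : ℕ → ℕ → Ω → Bool) :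
    Prop where
  measurable_T : ∀ g, Measurable (T g)
  measurable_σ : Measurable σ
  measurable_H : ∀ G g, Measurable (H G g)
  indep : iIndepFun T P
  ident : ∀ g, IdentDistrib (T g) (T 0) P P
  exogenous : ∀ G : ℕ, CondIndepGiven P (fun ω (g : Fin G) => T g ω)
    (fun ω (g : Fin G) => H G g ω) (fun ω (g : Fin G) => σ (T g ω))

variable {T : ℕ → Ω → 𝒯} {σ : 𝒯 → 𝒮} {H : ℕ → ℕ → Ω → Bool}

theorem StratifiedDesign.measurable_armInd (hD : StratifiedDesign P T σ H) (G : ℕ) (h : Bool)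
    (g : ℕ) : Measurable (armInd H G h g) :=
  Measurable.ite (hD.measurable_H G g (measurableSet_singleton h)) measurable_const
    measurable_const

theorem StratifiedDesign.memLp_mul_armInd (hD : StratifiedDesign P T σ H) {ψ : 𝒯 → ℝ}
    (hψ : Measurable ψ) {p : ℝ≥0∞} (hψp : MemLp (fun ω => ψ (T 0 ω)) p P) (G : ℕ) (h : Bool)
    (g : ℕ) : MemLp (fun ω => ψ (T g ω) * armInd H G h g ω) p P := by
  have hg : MemLp (fun ω => ψ (T g ω)) p P := ((hD.ident g).comp hψ).memLp_iff.2 hψp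
  refine hg.mono (hg.1.mul (hD.measurable_armInd G h g).aestronglyMeasurable)
    (Eventually.of_forall fun ω => ?_)
  rw [norm_mul]
  exact mul_le_of_le_one_right (norm_nonneg _) (abs_armInd_le H G h g ω)

variable [Fintype 𝒮] [MeasurableSingletonClass 𝒮] [IsProbabilityMeasure P]

/-- Centered functions of different clusters are orthogonal, given the strata. -/
theorem StratifiedDesign.integral_cross (hD : StratifiedDesign P T σ H) {ψ : 𝒯 → ℝ}
    (hψ : Measurable ψ) (hψ2 : MemLp (fun ω => ψ (T 0 ω)) 2 P)
    (hc : ∀ s, ∫ ω, (σ ⁻¹' {s}).indicator ψ (T 0 ω) ∂P = 0) {G : ℕ} {i j : Fin G} (hij : i ≠ j)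
    (h : Bool) :
    ∫ ω, (ψ (T i ω) * armInd H G h i ω) * (ψ (T j ω) * armInd H G h j ω) ∂P = 0 := by
  classical
  have hTG : Measurable fun ω (g : Fin G) => T g ω := measurable_pi_lambda _ fun g =>
    hD.measurable_T g
  have hHG : Measurable fun ω (g : Fin G) => H G g ω := measurable_pi_lambda _ fun g =>
    hD.measurable_H G g
  have hkG : Measurable fun ω (g : Fin G) => σ (T g ω) := measurable_pi_lambda _ fun g =>
    hD.measurable_σ.comp (hD.measurable_T g)
  -- The two arm indicators combine into the indicator of one event of the assignment vector.
  set A : Set (Fin G → Bool) := {v | v i = h ∧ v j = h} with hA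
  have hAm : MeasurableSet A := A.toFinite.measurableSet
  set q := P⟦(fun ω (g : Fin G) => H G g ω) ⁻¹' A |
    MeasurableSpace.comap (fun ω (g : Fin G) => σ (T g ω)) inferInstance⟧ with hq
  -- The conditional probability of that event is a function of the vector of strata, which has
  -- finitely many values.
  obtain ⟨q', hq'm, hq'⟩ : ∃ q' : (Fin G → 𝒮) → ℝ, Measurable q' ∧
      q = q' ∘ fun ω (g : Fin G) => σ (T g ω) := by
    have hqm : Measurable[MeasurableSpace.comap (fun ω (g : Fin G) => σ (T g ω)) inferInstance] q :=
      stronglyMeasurable_condExp.measurable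
    obtain ⟨q', h1, h2⟩ := hqm.exists_eq_measurable_comp
    exact ⟨q', h1, h2⟩
  have hL2 : ∀ g, MemLp (fun ω => ψ (T g ω)) 2 P := fun g =>
    ((hD.ident g).comp hψ).memLp_iff.2 hψ2
  have hind : iIndepFun (fun g : Fin G => T g) P := hD.indep.precomp Fin.val_injective
  -- For a fixed vector `s` of strata, `ψ (T i) * ψ (T j)` on the event that the strata are `s`
  -- becomes a product of functions of single clusters, to which independence applies.
  let a : (Fin G → 𝒮) → Fin G → 𝒯 → ℝ := fun s g t =>
    (σ ⁻¹' {s g}).indicator (fun t => if g = i ∨ g = j then ψ t else 1) t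
  have ham : ∀ s g, Measurable (a s g) := fun s g => by
    refine Measurable.indicator ?_ (hD.measurable_σ (measurableSet_singleton _))
    by_cases hg : g = i ∨ g = j <;> simp only [hg, if_true, if_false]
    · exact hψ
    · exact measurable_const
  have hprod : ∀ s ω, ∏ g, a s g (T g ω) =
      if (fun g : Fin G => σ (T g ω)) = s then ψ (T i ω) * ψ (T j ω) else 0 := by
    intro s ω
    split_ifs with hs
    · have : ∀ g, a s g (T g ω) = if g = i ∨ g = j then ψ (T g ω) else 1 := fun g => by
        have : σ (T g ω) = s g := congrFun hs g
        simp [a, this]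
      simp_rw [this]
      rw [Finset.prod_ite, Finset.prod_const_one, mul_one]
      have : Finset.univ.filter (fun g => g = i ∨ g = j) = {i, j} := by ext; simp
      rw [this, Finset.prod_pair hij]
    · obtain ⟨g, hg⟩ := Function.ne_iff.1 hs
      exact Finset.prod_eq_zero (Finset.mem_univ g) (by simp [a, hg])
  have hzero : ∀ s, ∫ ω, ∏ g, a s g (T g ω) ∂P = 0 := by
    intro s
    rw [hind.integral_fun_prod_comp (fun g => (hD.measurable_T g).aemeasurable) (f := a s)
      (fun g => (ham s g).aestronglyMeasurable)]
    -- The factor of cluster `i` is the integral of `ψ` over the stratum `s i`, zero by centering.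
    refine Finset.prod_eq_zero (Finset.mem_univ i) ?_
    refine ((hD.ident i).comp (ham s i)).integral_eq.trans ?_
    rw [← hc (s i)]
    refine integral_congr_ae (Eventually.of_forall fun ω => ?_)
    simp [a]
  have hint : Integrable (fun ω => ψ (T i ω) * ψ (T j ω)) P := (hL2 i).integrable_mul (hL2 j)
  have hkm : ∀ s : Fin G → 𝒮, MeasurableSet {ω | (fun g : Fin G => σ (T g ω)) = s} := fun s =>
    hkG (measurableSet_singleton s)
  calc ∫ ω, (ψ (T i ω) * armInd H G h i ω) * (ψ (T j ω) * armInd H G h j ω) ∂P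
      = ∫ ω in (fun ω (g : Fin G) => H G g ω) ⁻¹' A, ψ (T i ω) * ψ (T j ω) ∂P := by
        rw [← integral_indicator (hHG hAm)]
        refine integral_congr_ae (Eventually.of_forall fun ω => ?_)
        by_cases h1 : H G i ω = h <;> by_cases h2 : H G j ω = h <;>
          simp [armInd, Set.indicator, hA, h1, h2]
    _ = ∫ ω, q ω * (ψ (T i ω) * ψ (T j ω)) ∂P :=
        (hD.exogenous G).setIntegral hTG hHG hkG hAm
          (u := fun p : (Fin G → 𝒯) × (Fin G → 𝒮) => ψ (p.1 i) * ψ (p.1 j)) (by fun_prop)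
    _ = ∫ ω, ∑ s, q' s * ∏ g, a s g (T g ω) ∂P := by
        refine integral_congr_ae (Eventually.of_forall fun ω => ?_)
        simp only [hprod, hq', Function.comp]
        simp
    _ = ∑ s, ∫ ω, q' s * ∏ g, a s g (T g ω) ∂P := by
        refine integral_finsetSum _ fun s _ => Integrable.const_mul ?_ _
        simp_rw [hprod]
        exact (hint.indicator (hkm s)).congr (Eventually.of_forall fun ω => by
          simp [Set.indicator])
    _ = 0 := by simp [integral_const_mul, hzero]

/-- Off-diagonal terms vanish by `integral_cross`; on the diagonal the indicator can only decrease
the `G` equal second moments. -/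
theorem StratifiedDesign.integral_sum_sq_le (hD : StratifiedDesign P T σ H) {ψ : 𝒯 → ℝ}
    (hψ : Measurable ψ) (hψ2 : MemLp (fun ω => ψ (T 0 ω)) 2 P)
    (hc : ∀ s, ∫ ω, (σ ⁻¹' {s}).indicator ψ (T 0 ω) ∂P = 0) (G : ℕ) (h : Bool) :
    ∫ ω, (∑ g ∈ Finset.range G, ψ (T g ω) * armInd H G h g ω) ^ 2 ∂P ≤
      G * ∫ ω, ψ (T 0 ω) ^ 2 ∂P := by
  have hL : ∀ g, MemLp (fun ω => ψ (T g ω) * armInd H G h g ω) 2 P :=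
    hD.memLp_mul_armInd hψ hψ2 G h
  have hint : ∀ i j : Fin G, Integrable (fun ω => (ψ (T i ω) * armInd H G h i ω) *
      (ψ (T j ω) * armInd H G h j ω)) P := fun i j => (hL i).integrable_mul (hL j)
  have hterm : ∀ i j : Fin G, ∫ ω, (ψ (T i ω) * armInd H G h i ω) *
      (ψ (T j ω) * armInd H G h j ω) ∂P ≤ if i = j then ∫ ω, ψ (T 0 ω) ^ 2 ∂P else 0 := by
    intro i j
    split_ifs with hij
    · subst hij
      have hid : ∫ ω, ψ (T i ω) ^ 2 ∂P = ∫ ω, ψ (T 0 ω) ^ 2 ∂P :=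
        ((hD.ident i).comp (hψ.pow_const 2)).integral_eq
      have hLi : MemLp (fun ω => ψ (T i ω)) 2 P := ((hD.ident i).comp hψ).memLp_iff.2 hψ2
      rw [← hid]
      refine integral_mono (hint i i) hLi.integrable_sq fun ω => ?_
      simp only [armInd]
      split_ifs
      · simp [sq]
      · simpa using sq_nonneg _
    · exact (hD.integral_cross hψ hψ2 hc hij h).le
  calc ∫ ω, (∑ g ∈ Finset.range G, ψ (T g ω) * armInd H G h g ω) ^ 2 ∂P
      = ∫ ω, ∑ i : Fin G, ∑ j : Fin G, (ψ (T i ω) * armInd H G h i ω) *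
          (ψ (T j ω) * armInd H G h j ω) ∂P := by
        refine integral_congr_ae (Eventually.of_forall fun ω => ?_)
        simp only
        rw [← Fin.sum_univ_eq_sum_range (fun g => ψ (T g ω) * armInd H G h g ω), sq,
          Finset.sum_mul_sum]
    _ = ∑ i : Fin G, ∑ j : Fin G, ∫ ω, (ψ (T i ω) * armInd H G h i ω) *
          (ψ (T j ω) * armInd H G h j ω) ∂P := by
        rw [integral_finsetSum _ fun i _ => integrable_finsetSum _ fun j _ => hint i j]
        exact Finset.sum_congr rfl fun i _ => integral_finsetSum _ fun j _ => hint i j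
    _ ≤ ∑ i : Fin G, ∑ j : Fin G, if i = j then ∫ ω, ψ (T 0 ω) ^ 2 ∂P else 0 :=
        Finset.sum_le_sum fun i _ => Finset.sum_le_sum fun j _ => hterm i j
    _ = G * ∫ ω, ψ (T 0 ω) ^ 2 ∂P := by simp

/-- Square-integrable centered functions approximate integrable centered functions. -/
theorem exists_memLp_two_centered {μ : Measure 𝒯} [IsProbabilityMeasure μ] (hσ : Measurable σ)
    {ψ : 𝒯 → ℝ} (hψi : Integrable ψ μ) (hc : ∀ s, ∫ t in σ ⁻¹' {s}, ψ t ∂μ = 0) {ε : ℝ}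
    (hε : 0 < ε) :
    ∃ φ : 𝒯 → ℝ, Measurable φ ∧ MemLp φ 2 μ ∧ (∀ s, ∫ t in σ ⁻¹' {s}, φ t ∂μ = 0) ∧
      ∫ t, |ψ t - φ t| ∂μ ≤ ε := by
  classical
  have hm : m𝒮.comap σ ≤ m𝒯 := hσ.comap_le
  -- Every event of the strata is a finite union of single strata, so centering in each stratum
  -- means that the conditional expectation vanishes.
  have hzero : μ[ψ | m𝒮.comap σ] =ᵐ[μ] 0 := by
    refine (ae_eq_condExp_of_forall_setIntegral_eq hm hψi (fun _ _ _ => integrableOn_zero)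
      ?_ aestronglyMeasurable_zero).symm
    rintro _ ⟨D, hD, rfl⟩ -
    have hU : σ ⁻¹' D = ⋃ s ∈ D.toFinset, σ ⁻¹' {s} := by ext; simp
    rw [hU, integral_biUnion_finset _ (fun s _ => hσ (measurableSet_singleton s)) ?_
      (fun s _ => hψi.integrableOn)]
    · simp [hc]
    · intro s _ s' _ hss'
      exact Disjoint.preimage _ (by simpa using hss')
  obtain ⟨g, hg, hgL⟩ := (memLp_one_iff_integrable.2 hψi).exists_simpleFunc_eLpNorm_sub_lt
    ENNReal.one_ne_top (ε := ENNReal.ofReal (ε / 2)) (by simpa using hε)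
  have hg2 : MemLp g 2 μ := SimpleFunc.memLp_of_isFiniteMeasure g 2 μ
  have hgi : Integrable g μ := memLp_one_iff_integrable.1 hgL
  have hdist : ∫ t, |ψ t - g t| ∂μ ≤ ε / 2 := by
    have h1 := ofReal_integral_norm_eq_lintegral_enorm (hψi.sub hgi)
    rw [← eLpNorm_one_eq_lintegral_enorm] at h1
    rw [← h1, ENNReal.ofReal_lt_ofReal_iff (by positivity)] at hg
    exact hg.le
  -- Recentering the simple function `g` costs another `ε / 2` at most: as `ψ` is centered, `μ[g |
  -- σ] = -μ[ψ - g | σ]`, and conditional expectation contracts `L¹`.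
  refine ⟨fun t => g t - (μ[g | m𝒮.comap σ]) t, g.measurable.sub
    (stronglyMeasurable_condExp.mono hm).measurable, hg2.sub (hg2.condExp (by norm_num)), ?_, ?_⟩
  · intro s
    rw [integral_sub hgi.integrableOn integrable_condExp.integrableOn,
      setIntegral_condExp hm hgi ⟨{s}, measurableSet_singleton s, rfl⟩, sub_self]
  · have hcond : ∫ t, |(μ[g | m𝒮.comap σ]) t| ∂μ ≤ ε / 2 := by
      refine le_trans ?_ hdist
      refine le_trans (le_of_eq ?_) (integral_abs_condExp_le (m := m𝒮.comap σ)
        (ψ - (g : 𝒯 → ℝ)))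
      refine integral_congr_ae ?_
      filter_upwards [condExp_sub hψi hgi (m𝒮.comap σ), hzero] with t h1 h2
      rw [h1, Pi.sub_apply, h2]
      simp
    calc ∫ t, |ψ t - (g t - (μ[g | m𝒮.comap σ]) t)| ∂μ
        ≤ ∫ t, (|ψ t - g t| + |(μ[g | m𝒮.comap σ]) t|) ∂μ := by
          refine integral_mono (hψi.sub (hgi.sub integrable_condExp)).abs
            ((hψi.sub hgi).abs.add integrable_condExp.abs) fun t => ?_
          simp only
          rw [← sub_add]
          exact abs_add_le _ _
      _ = (∫ t, |ψ t - g t| ∂μ) + ∫ t, |(μ[g | m𝒮.comap σ]) t| ∂μ :=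
          integral_add (hψi.sub hgi).abs integrable_condExp.abs
      _ ≤ ε := by linarith

/-- Averages of centered functions over an arm vanish in mean. -/
theorem StratifiedDesign.tendsto_integral_abs (hD : StratifiedDesign P T σ H) {ψ : 𝒯 → ℝ}
    (hψ : Measurable ψ) (hψi : Integrable (fun ω => ψ (T 0 ω)) P)
    (hc : ∀ s, ∫ ω, (σ ⁻¹' {s}).indicator ψ (T 0 ω) ∂P = 0) (h : Bool) :
    Tendsto (fun G : ℕ => ∫ ω, |(∑ g ∈ Finset.range G, ψ (T g ω) * armInd H G h g ω) / G| ∂P)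
      atTop (𝓝 0) := by
  have hT0 := hD.measurable_T 0
  have : IsProbabilityMeasure (P.map (T 0)) := Measure.isProbabilityMeasure_map hT0.aemeasurable
  have htrans : ∀ {φ : 𝒯 → ℝ}, Measurable φ → ∀ s, ∫ t in σ ⁻¹' {s}, φ t ∂(P.map (T 0)) =
      ∫ ω, (σ ⁻¹' {s}).indicator φ (T 0 ω) ∂P := by
    intro φ hφ s
    have hs : MeasurableSet (σ ⁻¹' {s}) := hD.measurable_σ (measurableSet_singleton s)
    rw [← integral_indicator hs, integral_map hT0.aemeasurable
      (hφ.indicator hs).aestronglyMeasurable]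
  have hψi' : Integrable ψ (P.map (T 0)) :=
    (integrable_map_measure hψ.aestronglyMeasurable hT0.aemeasurable).2 hψi
  rw [Metric.tendsto_atTop]
  intro ε hε
  -- The final bound has three terms of size `ε / 4`: the approximation error, and the two terms of
  -- `|y| ≤ y² / (ε/4) + ε/4` applied to the average `y` of `φ`.
  obtain ⟨φ, hφ, hφ2, hφc, hdist⟩ := exists_memLp_two_centered hD.measurable_σ hψi'
    (fun s => (htrans hψ s).trans (hc s)) (ε := ε / 4) (by positivity)
  have hφ2' : MemLp (fun ω => φ (T 0 ω)) 2 P := hφ2.comp_of_map hT0.aemeasurable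
  have hφi' : Integrable (fun ω => φ (T 0 ω)) P := hφ2'.integrable (by norm_num)
  have hdist' : ∫ ω, |ψ (T 0 ω) - φ (T 0 ω)| ∂P ≤ ε / 4 := by
    rwa [integral_map (f := fun t => |ψ t - φ t|) hT0.aemeasurable
      (hψ.sub hφ).abs.aestronglyMeasurable] at hdist
  set C := ∫ ω, φ (T 0 ω) ^ 2 ∂P with hC
  -- Beyond this threshold the second moment term `C / (G * (ε / 4))` is below `ε / 4`.
  obtain ⟨G₀, hG₀⟩ := exists_nat_gt (C / (ε / 4) ^ 2)
  refine ⟨max G₀ 1, fun G hG => ?_⟩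
  have hGpos : (0 : ℝ) < G := by
    exact_mod_cast lt_of_lt_of_le one_pos ((le_max_right _ _).trans hG)
  have hGC : C / (ε / 4) ^ 2 < G := hG₀.trans_le (by exact_mod_cast (le_max_left _ _).trans hG)
  have hψint : ∀ g, Integrable (fun ω => ψ (T g ω) * armInd H G h g ω) P := fun g =>
    memLp_one_iff_integrable.1 (hD.memLp_mul_armInd hψ (memLp_one_iff_integrable.2 hψi) G h g)
  have hφL : ∀ g, MemLp (fun ω => φ (T g ω) * armInd H G h g ω) 2 P :=
    hD.memLp_mul_armInd hφ hφ2' G h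
  have hdg : ∀ g, Integrable (fun ω => |ψ (T g ω) - φ (T g ω)|) P := fun g =>
    ((hD.ident g).comp (hψ.sub hφ).abs).integrable_iff.2 (hψi.sub hφi').abs
  have hsq : Integrable
      (fun ω => (∑ g ∈ Finset.range G, φ (T g ω) * armInd H G h g ω) ^ 2) P :=
    (memLp_finsetSum _ fun g _ => hφL g).integrable_sq
  have hpt : ∀ ω, |(∑ g ∈ Finset.range G, ψ (T g ω) * armInd H G h g ω) / G| ≤
      (∑ g ∈ Finset.range G, |ψ (T g ω) - φ (T g ω)|) / G +
        ((∑ g ∈ Finset.range G, φ (T g ω) * armInd H G h g ω) ^ 2 / (G ^ 2 * (ε / 4))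
          + ε / 4) := by
    intro ω
    set x := ∑ g ∈ Finset.range G, φ (T g ω) * armInd H G h g ω
    have h1 : |(∑ g ∈ Finset.range G, ψ (T g ω) * armInd H G h g ω) - x| ≤
        ∑ g ∈ Finset.range G, |ψ (T g ω) - φ (T g ω)| := by
      rw [← Finset.sum_sub_distrib]
      refine (Finset.abs_sum_le_sum_abs _ _).trans (Finset.sum_le_sum fun g _ => ?_)
      rw [← sub_mul, abs_mul]
      exact mul_le_of_le_one_right (abs_nonneg _) (abs_armInd_le H G h g ω)
    have h2 : |x / G| ≤ x ^ 2 / (G ^ 2 * (ε / 4)) + ε / 4 := by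
      have h3 : x ^ 2 / (G ^ 2 * (ε / 4)) = |x / G| ^ 2 / (ε / 4) := by
        rw [sq_abs]; field_simp
      rw [h3, div_add' _ _ _ (by positivity), le_div_iff₀ (by positivity)]
      nlinarith [sq_nonneg (|x / G| - ε / 4), abs_nonneg (x / G)]
    calc |(∑ g ∈ Finset.range G, ψ (T g ω) * armInd H G h g ω) / G|
        = |((∑ g ∈ Finset.range G, ψ (T g ω) * armInd H G h g ω) - x) / G + x / G| := by
          congr 1; ring
      _ ≤ |((∑ g ∈ Finset.range G, ψ (T g ω) * armInd H G h g ω) - x) / G| + |x / G| :=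
          abs_add_le _ _
      _ ≤ _ := by
          refine add_le_add ?_ h2
          rw [abs_div, abs_of_pos hGpos]
          exact div_le_div_of_nonneg_right h1 hGpos.le
  have hint1 : Integrable (fun ω => (∑ g ∈ Finset.range G, |ψ (T g ω) - φ (T g ω)|) / G) P :=
    (integrable_finsetSum _ fun g _ => hdg g).div_const _
  have hint2 := hsq.div_const ((G : ℝ) ^ 2 * (ε / 4))
  have hint3 := hint2.add (integrable_const (ε / 4))
  have hbound : ∫ ω, |(∑ g ∈ Finset.range G, ψ (T g ω) * armInd H G h g ω) / G| ∂P ≤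
      ε / 4 + (C / (G * (ε / 4)) + ε / 4) := by
    refine (integral_mono ((integrable_finsetSum _ fun g _ => hψint g).div_const _).abs
      (hint1.add hint3) hpt).trans ?_
    rw [integral_add' hint1 hint3, integral_add' hint2 (integrable_const _), integral_div,
      integral_div, integral_finsetSum _ fun g _ => hdg g]
    refine add_le_add ?_ (add_le_add ?_ (by simp))
    · rw [div_le_iff₀ hGpos]
      refine (Finset.sum_le_sum (g := fun _ => ε / 4) fun g _ => ?_).trans (by simp [mul_comm])
      exact (((hD.ident g).comp (hψ.sub hφ).abs).integral_eq).trans_le hdist'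
    · rw [div_le_div_iff₀ (by positivity) (by positivity)]
      have := hD.integral_sum_sq_le hφ hφ2' (fun s => (htrans hφ s).symm.trans (hφc s)) G h
      calc _ ≤ (G * C) * (G * (ε / 4)) := by gcongr
        _ = C * (G ^ 2 * (ε / 4)) := by ring
  have hsmall : C / (G * (ε / 4)) < ε / 4 := by
    rw [div_lt_iff₀ (by positivity)] at hGC ⊢
    nlinarith
  rw [Real.dist_eq, sub_zero, abs_of_nonneg (integral_nonneg fun ω => abs_nonneg _)]
  linarith

/-- The law of large numbers for averages over an arm within a stratum, when the fraction of
clusters in this arm and stratum converges to `ρ` times the probability of the stratum. -/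
theorem StratifiedDesign.tendstoProb_stratum (hD : StratifiedDesign P T σ H) {φ : 𝒯 → ℝ}
    (hφ : Measurable φ) (hφi : Integrable (fun ω => φ (T 0 ω)) P) {h : Bool} {s : 𝒮} {ρ : ℝ}
    (hbal : TendstoProb P (fun G ω => (∑ g ∈ Finset.range G,
      (σ ⁻¹' {s}).indicator 1 (T g ω) * armInd H G h g ω) / G)
      (ρ * ∫ ω, (σ ⁻¹' {s}).indicator 1 (T 0 ω) ∂P)) :
    TendstoProb P (fun G ω => (∑ g ∈ Finset.range G,
      (σ ⁻¹' {s}).indicator φ (T g ω) * armInd H G h g ω) / G)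
      (ρ * ∫ ω, (σ ⁻¹' {s}).indicator φ (T 0 ω) ∂P) := by
  classical
  have hs : MeasurableSet (σ ⁻¹' {s}) := hD.measurable_σ (measurableSet_singleton s)
  have hT0 := hD.measurable_T 0
  set p : ℝ := ∫ ω, (σ ⁻¹' {s}).indicator 1 (T 0 ω) ∂P with hp
  set e : ℝ := ∫ ω, (σ ⁻¹' {s}).indicator φ (T 0 ω) ∂P with he
  have hp' : p = P.real (T 0 ⁻¹' (σ ⁻¹' {s})) := by
    rw [hp, ← integral_indicator_one (hT0 hs)]
    rfl
  -- In a null stratum `e = 0` too, so the convention for division by zero does no harm.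
  have hpe : e = e / p * p := by
    by_cases hp0 : p = 0
    · have : e = 0 := by
        refine integral_eq_zero_of_ae ?_
        have hn : P (T 0 ⁻¹' (σ ⁻¹' {s})) = 0 := by
          rw [hp'] at hp0
          exact (measureReal_eq_zero_iff).1 hp0
        filter_upwards [measure_eq_zero_iff_ae_notMem.1 hn] with ω hω
        exact Set.indicator_of_notMem (s := σ ⁻¹' {s}) hω φ
      simp [this]
    · field_simp
  -- Subtracting the stratum mean `e / p` centers `φ` on `s`; on the other strata `ψ` is zero.
  set ψ : 𝒯 → ℝ := (σ ⁻¹' {s}).indicator fun t => φ t - e / p with hψdef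
  have hψ : Measurable ψ := (hφ.sub_const _).indicator hs
  have hψi : Integrable (fun ω => ψ (T 0 ω)) P :=
    (hφi.sub (integrable_const (e / p))).indicator (hT0 hs)
  have hindi : Integrable (fun ω => (σ ⁻¹' {s}).indicator φ (T 0 ω)) P :=
    hφi.indicator (hT0 hs)
  have hindi1 : Integrable (fun ω => (σ ⁻¹' {s}).indicator (1 : 𝒯 → ℝ) (T 0 ω)) P :=
    (integrable_const (1 : ℝ)).indicator (hT0 hs)
  have hdecomp : ∀ t, ψ t =
      (σ ⁻¹' {s}).indicator φ t - e / p * (σ ⁻¹' {s}).indicator 1 t := by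
    intro t
    by_cases ht : t ∈ σ ⁻¹' {s}
    · simp only [hψdef, Set.indicator_of_mem ht, Pi.one_apply, mul_one]
    · simp only [hψdef, Set.indicator_of_notMem ht, mul_zero, sub_zero]
  have hc : ∀ s', ∫ ω, (σ ⁻¹' {s'}).indicator ψ (T 0 ω) ∂P = 0 := by
    intro s'
    by_cases hss : s' = s
    · subst hss
      have : ∀ t, (σ ⁻¹' {s'}).indicator ψ t = ψ t := fun t => by
        simp only [hψdef, Set.indicator_indicator, Set.inter_self]
      simp_rw [this, hdecomp]
      rw [integral_sub hindi (hindi1.const_mul _), integral_const_mul, ← hp, ← he, ← hpe, sub_self]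
    · have : ∀ t, (σ ⁻¹' {s'}).indicator ψ t = 0 := fun t => by
        by_cases h1 : σ t = s'
        · have h2 : t ∉ σ ⁻¹' {s} := fun h3 => hss (h1.symm.trans h3)
          simp only [hψdef, Set.indicator_indicator]
          exact Set.indicator_of_notMem (fun h3 => h2 h3.2) _
        · exact Set.indicator_of_notMem (s := σ ⁻¹' {s'}) h1 ψ
      simp [this]
  have h1 : TendstoProb P (fun G ω => (∑ g ∈ Finset.range G, ψ (T g ω) * armInd H G h g ω) / G)
      0 := by
    refine tendstoProb_of_integral_abs (fun G => ?_) (hD.tendsto_integral_abs hψ hψi hc h)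
    exact (integrable_finsetSum _ fun g _ => memLp_one_iff_integrable.1
      (hD.memLp_mul_armInd hψ (memLp_one_iff_integrable.2 hψi) G h g)).div_const _
  -- The subtracted mean returns as `e / p` times the fraction of clusters in the arm and stratum,
  -- whose limit is given.
  have h2 := h1.add (hbal.const_mul (e / p))
  have hlim : 0 + e / p * (ρ * p) = ρ * e := by
    rw [zero_add, mul_left_comm, ← hpe]
  rw [hlim] at h2
  refine h2.congr fun G => Eventually.of_forall fun ω => ?_
  simp only [hdecomp]
  rw [mul_div_assoc', ← add_div, Finset.mul_sum, ← Finset.sum_add_distrib]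
  congr 1
  refine Finset.sum_congr rfl fun g _ => ?_
  ring

end StratifiedLLN

/-! ### Measurability for vectors of variable length -/

namespace VarVec

/-- Apply a function to all entries. -/
def map {α β : Type*} (u : α → β) (v : VarVec α) : VarVec β := ⟨v.1, fun i => u (v.2 i)⟩

/-- The entry number `i`, or a default value if there is none. -/
def get {α : Type*} (d : α) (v : VarVec α) (i : ℕ) : α := if h : i < v.1 then v.2 ⟨i, h⟩ else d

theorem get_varVec {Ω α : Type*} (d : α) (N : Ω → ℕ) (a : ℕ → Ω → α) {i : ℕ} {ω : Ω}
    (h : i < N ω) : get d (varVec N a ω) i = a i ω := by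
  simp [get, varVec, h]

variable {α β : Type*} [MeasurableSpace α] [MeasurableSpace β]

theorem measurable_of_forall {f : VarVec α → β}
    (h : ∀ n, Measurable fun v : Fin n → α => f ⟨n, v⟩) : Measurable f := by
  intro s hs
  exact MeasurableSpace.measurableSet_iInf.2 fun n => h n hs

theorem measurable_mk (n : ℕ) : Measurable fun v : Fin n → α => (⟨n, v⟩ : VarVec α) := by
  intro s hs
  exact MeasurableSpace.measurableSet_iInf.1 hs n

theorem measurable_map {u : α → β} (hu : Measurable u) : Measurable (map u) :=
  measurable_of_forall fun n => (measurable_mk n).comp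
    (measurable_pi_lambda _ fun i => hu.comp (measurable_pi_apply i))

theorem measurable_get (d : α) (i : ℕ) : Measurable fun v => get d v i := by
  refine measurable_of_forall fun n => ?_
  by_cases h : i < n
  · simp only [get, h, dif_pos]
    exact measurable_pi_apply (⟨i, h⟩ : Fin n)
  · simp only [get, h, dif_neg, not_false_eq_true]
    exact measurable_const

end VarVec

/-! ### Marks relative to finer data -/

section Marks

variable {Ω α β γ : Type*} [mΩ : MeasurableSpace Ω] [MeasurableSpace α] [MeasurableSpace β]
    [MeasurableSpace γ] {P : Measure Ω} [IsProbabilityMeasure P]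

/-- Marks drawn given `k g = b (w g)` are marks given `w`, if they depend on `w` only through
the `k g`. -/
theorem CondProductLaw.hasMarks_of_condIndepGiven {f : ℕ → Ω → α} {k : ℕ → Ω → β}
    {w : ℕ → Ω → γ} {K : Kernel β α} (h : CondProductLaw P f k K)
    (hci : ∀ G : ℕ, CondIndepGiven P (fun ω (g : Fin G) => w g ω) (fun ω (g : Fin G) => f g ω)
      (fun ω (g : Fin G) => k g ω))
    (hf : ∀ g, Measurable (f g)) (hk : ∀ g, Measurable (k g)) (hw : ∀ g, Measurable (w g))
    {b : γ → β} (hb : Measurable b) (hkb : ∀ g ω, k g ω = b (w g ω)) :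
    HasMarks P f w (K.comap b hb) := by
  intro G A B hA hB
  have hfG : Measurable fun ω (g : Fin G) => f g ω := measurable_pi_lambda _ fun g => hf g
  have hkG : Measurable fun ω (g : Fin G) => k g ω := measurable_pi_lambda _ fun g => hk g
  have hwG : Measurable fun ω (g : Fin G) => w g ω := measurable_pi_lambda _ fun g => hw g
  have key := (hci G).measureReal_inter hwG hfG hkG (MeasurableSet.univ_pi hB)
    (MeasurableSet.univ_pi hA) MeasurableSet.univ
  have hsetA : (fun ω (g : Fin G) => f g ω) ⁻¹' Set.univ.pi A = ⋂ g : Fin G, f g ⁻¹' A g := by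
    ext ω; simp
  have hsetB : (fun ω (g : Fin G) => w g ω) ⁻¹' Set.univ.pi B = ⋂ g : Fin G, w g ⁻¹' B g := by
    ext ω; simp
  rw [Set.preimage_univ, Set.inter_univ, hsetA, hsetB, Set.inter_comm] at key
  rw [key, integral_congr_ae (ae_restrict_of_ae (h G A hA)),
    ← integral_indicator (MeasurableSet.iInter fun g : Fin G => hw g (hB g))]
  refine integral_congr_ae (Eventually.of_forall fun ω => ?_)
  by_cases hω : ∀ g : Fin G, w g ω ∈ B g
  · simp [Set.indicator, hω, hkb]
  · have hω' := hω
    push Not at hω'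
    obtain ⟨g, hg⟩ := hω'
    simp only [Set.indicator, Set.mem_iInter, Set.mem_preimage, hω, if_false]
    exact (Finset.prod_eq_zero (Finset.mem_univ g) (by simp [hg])).symm

end Marks

/-! ### The law of large numbers over all clusters -/

section StratifiedLLN

variable {Ω 𝒯 𝒮 : Type*} [mΩ : MeasurableSpace Ω] [m𝒯 : MeasurableSpace 𝒯]
    [m𝒮 : MeasurableSpace 𝒮] {P : Measure Ω} [IsProbabilityMeasure P]
    {T : ℕ → Ω → 𝒯} {σ : 𝒯 → 𝒮} {H : ℕ → ℕ → Ω → Bool}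

/-- The weak law of large numbers for functions of the clusters. -/
theorem StratifiedDesign.tendstoProb_mean (hD : StratifiedDesign P T σ H) {φ : 𝒯 → ℝ}
    (hφ : Measurable φ) (hφi : Integrable (fun ω => φ (T 0 ω)) P) :
    TendstoProb P (fun G ω => (∑ g ∈ Finset.range G, φ (T g ω)) / G) (∫ ω, φ (T 0 ω) ∂P) := by
  refine tendstoInMeasure_of_tendsto_ae (fun G => ?_)
    (strong_law_ae_real (fun g ω => φ (T g ω)) hφi ?_ fun g => (hD.ident g).comp hφ)
  · exact ((Finset.measurable_sum _ fun g _ => hφ.comp (hD.measurable_T g)).div_const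
      _).aestronglyMeasurable
  · intro i j hij
    exact (hD.indep.indepFun hij).comp hφ hφ

end StratifiedLLN

namespace TwoStageExperiment

variable {Ω 𝒳 𝒞 𝓑 𝒮 : Type*} [MeasurableSpace Ω] [MeasurableSpace 𝒳]
    [MeasurableSpace 𝒞] [MeasurableSpace 𝓑] [MeasurableSpace 𝒮]
    (E : TwoStageExperiment Ω 𝒳 𝒞 𝓑 𝒮)

/-! ### Measurability of the random elements -/

theorem measurable_Yred (g i : ℕ) (z : Bool) (n n₁ : ℕ) : Measurable (E.Yred g i z n n₁) := by
  unfold Yred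
  split_ifs
  · exact E.measurable_Yfull _ _ _ _
  · exact measurable_const

theorem measurable_Y (g i : ℕ) (z h : Bool) : Measurable (E.Y g i z h) := by
  have : Measurable fun p : ℕ × Ω => E.Yred g i z p.1 ⌊(p.1 : ℝ) * E.frac h⌋₊ p.2 :=
    measurable_from_prod_countable_right fun n =>
      E.measurable_Yred g i z n ⌊(n : ℝ) * E.frac h⌋₊
  exact this.comp ((E.measurable_N g).prodMk measurable_id)

theorem measurable_Sg (g : ℕ) : Measurable (E.Sg g) :=
  E.measurable_S.comp ((E.measurable_C g).prodMk (E.measurable_N g))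

theorem measurable_base (g : ℕ) : Measurable (E.base g) :=
  (E.measurable_M g).prodMk ((E.measurable_C g).prodMk (E.measurable_N g))

theorem measurable_YXvec (g : ℕ) : Measurable (E.YXvec g) :=
  measurable_varVec (E.measurable_N g) fun i =>
    (measurable_pi_lambda _ fun z => measurable_pi_lambda _ fun h => E.measurable_Y g i z h).prodMk
      (E.measurable_X g i)

theorem measurable_Yvec (g : ℕ) : Measurable (E.Yvec g) :=
  measurable_varVec (E.measurable_N g) fun i =>
    measurable_pi_lambda _ fun z => measurable_pi_lambda _ fun h => E.measurable_Y g i z h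

theorem measurable_Xvec (g : ℕ) : Measurable (E.Xvec g) :=
  measurable_varVec (E.measurable_N g) (E.measurable_X g)

theorem measurable_Bvec (g : ℕ) : Measurable (E.Bvec g) :=
  measurable_varVec (E.measurable_N g) fun i => E.measurable_B.comp (E.measurable_X g i)

theorem measurable_Zvec (g : ℕ) : Measurable (E.Zvec g) :=
  measurable_varVec (E.measurable_N g) fun i =>
    measurable_pi_lambda _ fun h => E.measurable_Zpot g i h

theorem measurable_W (g : ℕ) : Measurable (E.W g) :=
  (E.measurable_YXvec g).prodMk (E.measurable_base g)

/-! ### The clusters are i.i.d. -/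

/-- The range of the potential treatments, outcomes, covariates and sampled units of a cluster. -/
abbrev Cluster (𝒳 𝒞 : Type*) : Type _ :=
  VarVec (Bool → Bool) × VarVec ((Bool → Bool → ℝ) × 𝒳) × Finset ℕ × 𝒞 × ℕ

/-- Potential treatments, potential outcomes, covariates and sampled units of cluster `g`. -/
noncomputable def cluster (g : ℕ) (ω : Ω) : Cluster 𝒳 𝒞 := (E.Zvec g ω, E.W g ω)

/-- The stratum as a function of the cluster. -/
def stratum (t : Cluster 𝒳 𝒞) : 𝒮 := E.S (t.2.2.2.1, t.2.2.2.2)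

theorem measurable_cluster (g : ℕ) : Measurable (E.cluster g) :=
  (E.measurable_Zvec g).prodMk (E.measurable_W g)

theorem measurable_stratum : Measurable E.stratum :=
  E.measurable_S.comp (by fun_prop)

theorem measurable_D [MeasurableSingletonClass 𝒮] (G : ℕ) (s : 𝒮) : Measurable (E.D G s) := by
  refine Finset.measurable_sum _ fun g _ => Measurable.mul ?_ ?_
  · exact (Measurable.ite (E.measurable_H G g (measurableSet_singleton true)) measurable_const
      measurable_const).sub_const _
  · exact Measurable.ite (E.measurable_Sg g (measurableSet_singleton s)) measurable_const
      measurable_const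

variable {E} {P : Measure Ω} [IsProbabilityMeasure P]

theorem SamplingAssumption.iIndepFun_W (hS : E.SamplingAssumption P) :
    iIndepFun E.W P ∧ ∀ g, IdentDistrib (E.W g) (E.W 0) P P := by
  obtain ⟨R, hR, hlaw⟩ := hS.outcomes
  have hm := hlaw.hasMarks E.measurable_YXvec E.measurable_base
  exact ⟨hm.iIndepFun E.measurable_YXvec E.measurable_base hS.base_indep hS.base_ident,
    hm.identDistrib E.measurable_YXvec E.measurable_base hS.base_indep hS.base_ident⟩

/-- The unit strata `B_g` are a function `b` of `W_g`, so treatments drawn from `κ(B_g)`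
independently of `W` given the unit strata are marks on `W`. -/
theorem SecondStage.exists_hasMarks (hZ : E.SecondStage P) :
    ∃ (κ : Kernel (VarVec 𝓑) (VarVec (Bool → Bool))) (_ : IsMarkovKernel κ)
      (b : VarVec ((Bool → Bool → ℝ) × 𝒳) × Finset ℕ × 𝒞 × ℕ → VarVec 𝓑) (hb : Measurable b),
      (∀ g ω, E.Bvec g ω = b (E.W g ω)) ∧ HasMarks P E.Zvec E.W (κ.comap b hb) := by
  obtain ⟨κ, hκ, hlaw⟩ := hZ.mechanism
  refine ⟨κ, hκ, fun w => VarVec.map (fun y => E.B y.2) w.1,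
    (VarVec.measurable_map (E.measurable_B.comp measurable_snd)).comp measurable_fst,
    fun g ω => rfl, ?_⟩
  exact hlaw.hasMarks_of_condIndepGiven hZ.exogenous E.measurable_Zvec E.measurable_Bvec
    E.measurable_W _ fun g ω => rfl

/-- Marks are attached twice: outcomes to the i.i.d. triples `(M_g, C_g, N_g)`, then treatments to
`W_g`. Exogeneity of the first stage is joint in `W` and `Z`, as required for the tuple. -/
theorem stratifiedDesign [Fintype 𝒮] (hS : E.SamplingAssumption P) (hF : E.FirstStage P)
    (hZ : E.SecondStage P) : StratifiedDesign P E.cluster E.stratum E.H := by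
  obtain ⟨hWi, hWid⟩ := hS.iIndepFun_W
  obtain ⟨κ, hκ, b, hb, -, hm⟩ := hZ.exists_hasMarks
  refine ⟨E.measurable_cluster, E.measurable_stratum, E.measurable_H,
    hm.iIndepFun E.measurable_Zvec E.measurable_W hWi hWid,
    hm.identDistrib E.measurable_Zvec E.measurable_W hWi hWid, fun G => ?_⟩
  exact (hF.exogenous G).comp (u := fun p (g : Fin G) => (p.2 g, p.1 g)) (v := id)
    (by fun_prop) measurable_id

/-! ### Balance of the assignment -/

/-- The almost sure convergence of conditional laws is integrated over `ω` by dominated convergence,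
with dominating constant `‖f‖`. -/
theorem FirstStage.tendsto_integral_D [Fintype 𝒮] [MeasurableSingletonClass 𝒮]
    (hF : E.FirstStage P) (f : BoundedContinuousFunction (𝒮 → ℝ) ℝ) :
    Tendsto (fun G : ℕ => ∫ ω, f (fun s => E.D G s ω / Real.sqrt G) ∂P) atTop
      (𝓝 (∫ x, f x ∂(E.limitLawD P : Measure (𝒮 → ℝ)))) := by
  have hDm : ∀ G : ℕ, Measurable fun ω s => E.D G s ω / Real.sqrt G := fun G =>
    measurable_pi_lambda _ fun s => (E.measurable_D G s).div_const _
  have hSm : ∀ G : ℕ, Measurable fun ω (g : Fin G) => E.Sg g ω := fun G =>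
    measurable_pi_lambda _ fun g => E.measurable_Sg g
  have heq : ∀ G : ℕ, ∫ ω, f (fun s => E.D G s ω / Real.sqrt G) ∂P =
      ∫ ω, ∫ x, f x ∂(E.condLawD P G ω : Measure (𝒮 → ℝ)) ∂P := by
    intro G
    have hint : Integrable (fun ω => f (fun s => E.D G s ω / Real.sqrt G)) P :=
      .of_bound (f.continuous.measurable.comp (hDm G)).aestronglyMeasurable ‖f‖
        (Eventually.of_forall fun ω => f.norm_coe_le_norm _)
    rw [← integral_condExp (hSm G).comap_le]
    exact integral_congr_ae (condExp_ae_eq_integral_condDistrib (hSm G) (hDm G).aemeasurable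
      f.continuous.stronglyMeasurable hint)
  simp_rw [heq]
  have hlim : ∫ x, f x ∂(E.limitLawD P : Measure (𝒮 → ℝ)) =
      ∫ _, ∫ x, f x ∂(E.limitLawD P : Measure (𝒮 → ℝ)) ∂P := by simp
  rw [hlim]
  refine tendsto_integral_of_dominated_convergence (fun _ => ‖f‖) (fun G => ?_)
    (integrable_const _) (fun G => Eventually.of_forall fun ω => ?_) ?_
  · exact AEStronglyMeasurable.integral_condDistrib (f := fun p => f p.2)
      (hSm G).aemeasurable (hDm G).aemeasurable
      (f.continuous.stronglyMeasurable.comp_measurable measurable_snd).aestronglyMeasurable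
  · exact f.norm_integral_le_norm _
  · filter_upwards [hF.balance] with ω hω
    exact (ProbabilityMeasure.tendsto_iff_forall_integral_tendsto.1 hω) f

/-- Convergence in law keeps mass from escaping to infinity at scale `√G`; division by a further
`√G` sends the imbalance to zero. -/
theorem FirstStage.tendstoProb_D [Fintype 𝒮] [MeasurableSingletonClass 𝒮]
    (hF : E.FirstStage P) (s : 𝒮) : TendstoProb P (fun G ω => E.D G s ω / G) 0 := by
  -- A bounded continuous substitute for the indicator of `R + 1 ≤ |x s|`: it equals `1` there and
  -- tends to `0` pointwise as `R` grows.
  let f : ℕ → BoundedContinuousFunction (𝒮 → ℝ) ℝ := fun R =>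
    BoundedContinuousFunction.ofNormedAddCommGroup (fun x => min 1 (|x s| / (R + 1)))
      (by fun_prop) 1 fun x => by
        rw [Real.norm_of_nonneg (le_min zero_le_one (by positivity))]
        exact min_le_left _ _
  have hf : ∀ R x, f R x = min 1 (|x s| / (R + 1)) := fun R x => rfl
  have hfR : Tendsto (fun R => ∫ x, f R x ∂(E.limitLawD P : Measure (𝒮 → ℝ))) atTop (𝓝 0) := by
    have h0 : (0 : ℝ) = ∫ _, (0 : ℝ) ∂(E.limitLawD P : Measure (𝒮 → ℝ)) := by simp
    rw [h0]
    refine tendsto_integral_of_dominated_convergence (fun _ => 1)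
      (fun R => (f R).continuous.aestronglyMeasurable) (integrable_const _)
      (fun R => Eventually.of_forall fun x => ?_) (Eventually.of_forall fun x => ?_)
    · rw [hf, Real.norm_of_nonneg (le_min zero_le_one (by positivity))]
      exact min_le_left _ _
    · simp only [hf]
      have h1 : Tendsto (fun R : ℕ => |x s| * (1 / ((R : ℝ) + 1))) atTop (𝓝 (|x s| * 0)) :=
        tendsto_one_div_add_atTop_nhds_zero_nat.const_mul _
      have h2 := (tendsto_const_nhds (x := (1 : ℝ))).min h1
      simpa [div_eq_mul_inv] using h2
  rw [tendstoProb_iff]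
  intro ε hε
  rw [ENNReal.tendsto_atTop_zero]
  intro δ hδ
  obtain ⟨δ', hδ'0, hδ'⟩ : ∃ δ' : ℝ, 0 < δ' ∧ ENNReal.ofReal δ' ≤ δ := by
    by_cases htop : δ = ∞
    · exact ⟨1, one_pos, by simp [htop]⟩
    · exact ⟨δ.toReal, ENNReal.toReal_pos hδ.ne' htop, ENNReal.ofReal_toReal_le⟩
  obtain ⟨R, hR⟩ := (hfR.eventually_lt_const hδ'0).exists
  obtain ⟨G₁, hG₁⟩ := eventually_atTop.1
    ((hF.tendsto_integral_D (f R)).eventually_lt_const hR)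
  -- Beyond `G₂` one has `R + 1 ≤ ε √G`, so `ε ≤ |D / G|` forces `R + 1 ≤ |D / √G|`.
  obtain ⟨G₂, hG₂⟩ := exists_nat_gt ((((R : ℝ) + 1) / ε) ^ 2)
  refine ⟨max G₁ (max G₂ 1), fun G hG => ?_⟩
  have hGpos : (0 : ℝ) < G := by
    exact_mod_cast lt_of_lt_of_le one_pos (((le_max_right _ _).trans (le_max_right _ _)).trans hG)
  have hGR : (((R : ℝ) + 1) / ε) ^ 2 < G :=
    hG₂.trans_le (by exact_mod_cast ((le_max_left _ _).trans (le_max_right _ _)).trans hG)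
  have hsqrt : ((R : ℝ) + 1) ≤ ε * Real.sqrt G := by
    have := Real.le_sqrt_of_sq_le hGR.le
    rw [div_le_iff₀ hε] at this
    linarith
  have hmeas : Measurable fun ω => f R (fun s => E.D G s ω / Real.sqrt G) :=
    (f R).continuous.measurable.comp
      (measurable_pi_lambda _ fun s => (E.measurable_D G s).div_const _)
  have hint : Integrable (fun ω => f R (fun s => E.D G s ω / Real.sqrt G)) P :=
    .of_bound hmeas.aestronglyMeasurable ‖f R‖
      (Eventually.of_forall fun ω => (f R).norm_coe_le_norm _)
  have hnn : ∀ x, 0 ≤ f R x := fun x => by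
    rw [hf]; exact le_min zero_le_one (by positivity)
  -- Markov's inequality at level `1`, the maximal value of the test function.
  have hmarkov := mul_meas_ge_le_integral_of_nonneg (Eventually.of_forall fun ω => hnn _) hint 1
  rw [one_mul] at hmarkov
  calc P {ω | ε ≤ |E.D G s ω / G - 0|}
      ≤ P {ω | 1 ≤ f R (fun s => E.D G s ω / Real.sqrt G)} := by
        refine measure_mono fun ω hω => ?_
        simp only [Set.mem_ofPred_eq, sub_zero, hf, le_min_iff, le_refl, true_and] at hω ⊢
        rw [one_le_div (by positivity)]
        have hs0 : 0 < Real.sqrt G := Real.sqrt_pos.2 hGpos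
        refine hsqrt.trans ?_
        rw [abs_div, abs_of_pos hGpos, le_div_iff₀ hGpos] at hω
        rw [abs_div, abs_of_pos hs0, le_div_iff₀ hs0, mul_assoc, Real.mul_self_sqrt hGpos.le]
        exact hω
    _ = ENNReal.ofReal (P.real {ω | 1 ≤ f R (fun s => E.D G s ω / Real.sqrt G)}) :=
        (ofReal_measureReal).symm
    _ ≤ ENNReal.ofReal δ' := ENNReal.ofReal_le_ofReal
        (hmarkov.trans (hG₁ G ((le_max_left _ _).trans hG)).le)
    _ ≤ δ := hδ'

end TwoStageExperiment

/-! ### Integration over an event of a mark -/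

section Marks

variable {Ω α β : Type*} [mΩ : MeasurableSpace Ω] [MeasurableSpace α] [MeasurableSpace β]
    {P : Measure Ω} [IsProbabilityMeasure P]

/-- Restricting to an event of the mark reweights the law of `k g` by `K (k g) A`. This integrates
the treatments out of the moment bound. -/
theorem HasMarks.setLIntegral {f : ℕ → Ω → α} {k : ℕ → Ω → β} {K : Kernel β α}
    [IsMarkovKernel K] (h : HasMarks P f k K) (hk : ∀ g, Measurable (k g))
    (hki : ProbabilityTheory.iIndepFun k P)
    (hkid : ∀ g, IdentDistrib (k g) (k 0) P P) (g : ℕ) {A : Set α} (hA : MeasurableSet A)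
    {u : β → ℝ≥0∞} (hu : Measurable u) :
    ∫⁻ ω in f g ⁻¹' A, u (k g ω) ∂P = ∫⁻ ω, K (k g ω) A * u (k g ω) ∂P := by
  have hKA : Measurable fun ω => K (k g ω) A := (K.measurable_coe hA).comp (hk g)
  have hmap : (P.restrict (f g ⁻¹' A)).map (k g) =
      (P.withDensity fun ω => K (k g ω) A).map (k g) := by
    ext B hB
    rw [Measure.map_apply (hk g) hB, Measure.map_apply (hk g) hB,
      Measure.restrict_apply (hk g hB), withDensity_apply _ (hk g hB), Set.inter_comm]
    have hmeas := measurable_indicator_kernel (K := K) hA hB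
    have h1 := h.measure_single hk hki hkid g hA hB
    have h2 := h1.trans ((hkid g).comp hmeas).integral_eq.symm
    simp only [Function.comp_apply] at h2
    rw [← ofReal_measureReal, h2, ofReal_integral_eq_lintegral_ofReal]
    · rw [← lintegral_indicator (hk g hB)]
      refine lintegral_congr fun ω => ?_
      by_cases hω : k g ω ∈ B
      · simp [Set.indicator, hω]
      · simp [Set.indicator, hω]
    · refine .of_bound (hmeas.comp (hk g)).aestronglyMeasurable 1
        (Eventually.of_forall fun ω => ?_)
      by_cases hω : k g ω ∈ B
      · simp [Set.indicator, hω, abs_of_nonneg, measureReal_le_one]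
      · simp [Set.indicator, hω]
    · refine Eventually.of_forall fun ω => ?_
      exact Set.indicator_nonneg (fun _ _ => measureReal_nonneg) _
  rw [← lintegral_map hu (hk g), hmap, lintegral_map hu (hk g),
    lintegral_withDensity_eq_lintegral_mul _ hKA (g := fun ω => u (k g ω)) (hu.comp (hk g))]
  rfl

end Marks

/-! ### Inequalities for the moment bound -/

/-- A bound on a conditional expectation bounds weighted integrals. -/
theorem integral_mul_le_of_condExp_le {Ω : Type*} {m mΩ : MeasurableSpace Ω} {P : Measure Ω}
    [IsProbabilityMeasure P] (hm : m ≤ mΩ) {w X : Ω → ℝ} {K c : ℝ}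
    (hw : StronglyMeasurable[m] w) (hwb : ∀ᵐ ω ∂P, ‖w ω‖ ≤ c) (hX : Integrable X P)
    (hle : ∀ᵐ ω ∂P, w ω * (P[X | m]) ω ≤ K * w ω) :
    ∫ ω, w ω * X ω ∂P ≤ K * ∫ ω, w ω ∂P := by
  have hw' : AEStronglyMeasurable w P := (hw.mono hm).aestronglyMeasurable
  have hwi : Integrable w P := .of_bound hw' c hwb
  have hwX : Integrable (w * X) P := hX.bdd_mul hw' hwb
  have hwE : Integrable (fun ω => w ω * (P[X | m]) ω) P :=
    integrable_condExp.bdd_mul hw' hwb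
  calc ∫ ω, w ω * X ω ∂P = ∫ ω, (P[w * X | m]) ω ∂P := (integral_condExp hm).symm
    _ = ∫ ω, w ω * (P[X | m]) ω ∂P :=
        integral_congr_ae (condExp_mul_of_stronglyMeasurable_left hw hwX hX)
    _ ≤ ∫ ω, K * w ω ∂P := integral_mono_ae hwE (hwi.const_mul K) hle
    _ = K * ∫ ω, w ω ∂P := integral_const_mul _ _

/-- A lower Lebesgue integral is the sum over the values of a discrete random element. -/
theorem lintegral_eq_tsum_preimage {Ω ι : Type*} [MeasurableSpace Ω] [Countable ι]
    [MeasurableSpace ι] [MeasurableSingletonClass ι] {P : Measure Ω} {L : Ω → ι}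
    (hL : Measurable L) (F : Ω → ℝ≥0∞) :
    ∫⁻ ω, F ω ∂P = ∑' l, ∫⁻ ω in L ⁻¹' {l}, F ω ∂P := by
  rw [← lintegral_iUnion (fun l => hL (measurableSet_singleton l))]
  · have : ⋃ l, L ⁻¹' {l} = Set.univ := by ext; simp
    rw [this, Measure.restrict_univ]
  · intro l l' hll
    exact Disjoint.preimage _ (by simpa using hll)

/-- Jensen's inequality for a uniform average; for empty `j` both sides are `0`. -/
theorem sq_sum_div_card_le (j : Finset ℕ) (a : ℕ → ℝ) :
    ((∑ i ∈ j, a i) / (j.card : ℝ)) ^ 2 ≤ ∑ i ∈ j, a i ^ 2 / (j.card : ℝ) := by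
  rcases j.eq_empty_or_nonempty with rfl | hj
  · simp
  have hpos : (0 : ℝ) < j.card := by exact_mod_cast hj.card_pos
  rw [div_pow, ← Finset.sum_div, div_le_div_iff₀ (by positivity) hpos]
  nlinarith [sq_sum_le_card_mul_sum_sq (s := j) (f := a)]

namespace TwoStageExperiment

variable {Ω 𝒳 𝒞 𝓑 𝒮 : Type*} [MeasurableSpace Ω] [MeasurableSpace 𝒳]
    [MeasurableSpace 𝒞] [MeasurableSpace 𝓑] [MeasurableSpace 𝒮]

/-! ### Cluster averages as functions of the cluster -/

/-- The sampled units over which `Ȳ_g(z, h)` averages, out of the set `m`. -/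
def selected (z h : Bool) (m : Finset ℕ) (ζ : VarVec (Bool → Bool)) : Finset ℕ :=
  if h then m.filter fun i => VarVec.get (fun _ => false) ζ i true = z else m

/-- The average of `Y_{i,g}(z, h)` over a set of units. -/
noncomputable def average (z h : Bool) (j : Finset ℕ) (y : VarVec (Bool → Bool → ℝ)) : ℝ :=
  (∑ i ∈ j, VarVec.get 0 y i z h) / (j.card : ℝ)

/-- `Ȳ_g(z, h)` as a function of the cluster. -/
noncomputable def barFun (z h : Bool) (t : Cluster 𝒳 𝒞) : ℝ :=
  average z h (selected z h t.2.2.1 t.1) (VarVec.map Prod.fst t.2.1)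

/-- `N_g` as a function of the cluster. -/
def sizeFun (t : Cluster 𝒳 𝒞) : ℝ := (t.2.2.2.2 : ℝ)

theorem measurable_selected (z h : Bool) (m : Finset ℕ) : Measurable (selected z h m) := by
  rw [measurable_finset_iff]
  intro i
  cases h
  · simp only [selected, Bool.false_eq_true, if_false]
    exact measurable_const
  · simp only [selected, if_true, Finset.mem_filter]
    refine Measurable.and measurable_const ?_
    rw [← measurableSet_setOfPred]
    exact ((measurable_pi_apply true).comp (VarVec.measurable_get (fun _ => false) i))
      (measurableSet_singleton z)

theorem measurable_get_real (i : ℕ) (z h : Bool) :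
    Measurable fun y : VarVec (Bool → Bool → ℝ) => VarVec.get 0 y i z h :=
  (measurable_pi_apply h).comp ((measurable_pi_apply z).comp (VarVec.measurable_get _ i))

theorem measurable_average (z h : Bool) (j : Finset ℕ) : Measurable (average z h j) :=
  (Finset.measurable_sum _ fun i _ => measurable_get_real i z h).div_const _

/-- The sampled set takes countably many values, so measurability can be checked with the set fixed.
-/
theorem measurable_selected_cluster (z h : Bool) :
    Measurable fun t : Cluster 𝒳 𝒞 => selected z h t.2.2.1 t.1 := by
  have : Measurable fun p : Finset ℕ × VarVec (Bool → Bool) => selected z h p.1 p.2 :=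
    measurable_from_prod_countable_right fun m => measurable_selected z h m
  exact this.comp (f := fun t : Cluster 𝒳 𝒞 => (t.2.2.1, t.1)) (by fun_prop)

theorem measurable_barFun (z h : Bool) : Measurable (barFun (𝒳 := 𝒳) (𝒞 := 𝒞) z h) := by
  have : Measurable fun p : Finset ℕ × VarVec (Bool → Bool → ℝ) => average z h p.1 p.2 :=
    measurable_from_prod_countable_right fun m => measurable_average z h m
  exact this.comp ((measurable_selected_cluster z h).prodMk
    ((VarVec.measurable_map measurable_fst).comp (measurable_fst.comp measurable_snd)))

theorem measurable_sizeFun : Measurable (sizeFun (𝒳 := 𝒳) (𝒞 := 𝒞)) :=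
  (measurable_from_top (f := fun n : ℕ => (n : ℝ))).comp (by fun_prop)

variable (E : TwoStageExperiment Ω 𝒳 𝒞 𝓑 𝒮)

theorem selected_Zvec_true (g : ℕ) (z : Bool) (ω : Ω) :
    selected z true (E.M g ω) (E.Zvec g ω) =
      (E.M g ω).filter fun i => E.Zpot g i true ω = z := by
  simp only [selected, if_true]
  refine Finset.filter_congr fun i hi => ?_
  have : i < E.N g ω := Finset.mem_range.1 (E.M_subset g ω hi)
  rw [Zvec, VarVec.get_varVec _ _ _ this]

theorem selected_subset (z h : Bool) (m : Finset ℕ) (ζ : VarVec (Bool → Bool)) :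
    selected z h m ζ ⊆ m := by
  cases h
  · simp [selected]
  · simp [selected, Finset.filter_subset]

theorem get_Yvec {g i : ℕ} {ω : Ω} (hi : i < E.N g ω) (z h : Bool) :
    VarVec.get 0 (E.Yvec g ω) i z h = E.Y g i z h ω := by
  rw [Yvec, VarVec.get_varVec _ _ _ hi]

/-- Sampled units lie below `N_g`, so the default values of `VarVec.get` are never read. -/
theorem YbarPot_eq (g : ℕ) (z h : Bool) (ω : Ω) :
    E.YbarPot g z h ω = barFun z h (E.cluster g ω) := by
  have hb : barFun z h (E.cluster g ω) =
      average z h (selected z h (E.M g ω) (E.Zvec g ω)) (E.Yvec g ω) := rfl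
  have hsum : ∀ j ⊆ E.M g ω, average z h j (E.Yvec g ω) =
      (∑ i ∈ j, E.Y g i z h ω) / (j.card : ℝ) := fun j hj => by
    rw [average, Finset.sum_congr rfl fun i hi =>
      E.get_Yvec (Finset.mem_range.1 (E.M_subset g ω (hj hi))) z h]
  rw [hb, hsum _ (selected_subset z h _ _), YbarPot]
  cases h
  · simp [selected]
  · rw [selected_Zvec_true]
    simp

theorem measurable_YbarPot (g : ℕ) (z h : Bool) :
    Measurable (E.YbarPot g z h) := by
  have : E.YbarPot g z h = fun ω => barFun z h (E.cluster g ω) :=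
    funext fun ω => E.YbarPot_eq g z h ω
  rw [this]
  exact (measurable_barFun z h).comp (E.measurable_cluster g)

theorem measurable_size (g : ℕ) :
    Measurable fun ω => (E.N g ω : ℝ) :=
  measurable_from_top.comp (E.measurable_N g)

variable {E} {P : Measure Ω}

theorem memLp_size (hS : E.SamplingAssumption P) (g : ℕ) :
    MemLp (fun ω => (E.N g ω : ℝ)) 2 P :=
  (memLp_two_iff_integrable_sq (E.measurable_size g).aestronglyMeasurable).2 (hS.size_sq g)

theorem two_le_size (hS : E.SamplingAssumption P) (g : ℕ) : ∀ᵐ ω ∂P, (2 : ℝ) ≤ E.N g ω := by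
  filter_upwards [hS.two_le_card g] with ω hω
  have := Finset.card_le_card (E.M_subset g ω)
  rw [Finset.card_range] at this
  exact_mod_cast hω.trans this

variable [IsProbabilityMeasure P]

/-! ### Second moments -/

/-- The second moment of an outcome on an event determined by the sampled and treated units. -/
theorem setLIntegral_Y_sq_le (hS : E.SamplingAssumption P) (hZ : E.SecondStage P) :
    ∃ K : ℝ, ∀ (z h : Bool) (g i n : ℕ) (m : Finset ℕ) (A : Set (VarVec (Bool → Bool))),
      i < n → MeasurableSet A →
      ∫⁻ ω in E.N g ⁻¹' {n} ∩ E.M g ⁻¹' {m} ∩ E.Zvec g ⁻¹' A, ENNReal.ofReal (E.Y g i z h ω ^ 2) ∂P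
        ≤ ENNReal.ofReal K * P (E.N g ⁻¹' {n} ∩ E.M g ⁻¹' {m} ∩ E.Zvec g ⁻¹' A) := by
  obtain ⟨K, hK⟩ := hS.bounded
  refine ⟨K, fun z h g i n m A hin hA => ?_⟩
  obtain ⟨hWi, hWid⟩ := hS.iIndepFun_W
  obtain ⟨κ, hκ, hlaw⟩ := hZ.mechanism
  have hmap : Measurable (VarVec.map E.B) := VarVec.measurable_map E.measurable_B
  have hmapW : Measurable fun w : VarVec ((Bool → Bool → ℝ) × 𝒳) × Finset ℕ × 𝒞 × ℕ =>
      VarVec.map (fun y => E.B y.2) w.1 :=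
    (VarVec.measurable_map (E.measurable_B.comp measurable_snd)).comp measurable_fst
  have hmarks := hlaw.hasMarks_of_condIndepGiven hZ.exogenous E.measurable_Zvec E.measurable_Bvec
    E.measurable_W hmapW fun g ω => rfl
  set V : Ω → 𝒞 × ℕ × VarVec 𝒳 := fun ω => (E.C g ω, E.N g ω, E.Xvec g ω) with hVdef
  have hV : Measurable V :=
    (E.measurable_C g).prodMk ((E.measurable_N g).prodMk (E.measurable_Xvec g))
  have hVle := hV.comap_le
  -- The weight of `N_g = n` and `Z_g ∈ A` given the cluster data: it depends on size and individual
  -- covariates only.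
  set v : 𝒞 × ℕ × VarVec 𝒳 → ℝ≥0∞ := fun p =>
    ({n} : Set ℕ).indicator 1 p.2.1 * κ (VarVec.map E.B p.2.2) A with hvdef
  have hv : Measurable v := by
    refine Measurable.mul ?_ ?_
    · exact (measurable_one.indicator (measurableSet_singleton n)).comp (by fun_prop)
    · exact (κ.measurable_coe hA).comp (hmap.comp (measurable_snd.comp measurable_snd))
  have hv1 : ∀ p, v p ≤ 1 := fun p => by
    refine mul_le_one' ?_ prob_le_one
    exact Set.indicator_le_self' (fun _ _ => zero_le) _
  set q := P⟦E.M g ⁻¹' {m} | MeasurableSpace.comap V inferInstance⟧ with hq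
  have hMm : MeasurableSet (E.M g ⁻¹' {m}) := E.measurable_M g (measurableSet_singleton m)
  have hNn : MeasurableSet (E.N g ⁻¹' {n}) := E.measurable_N g (measurableSet_singleton n)
  have hq0 : 0 ≤ᵐ[P] q := condProb_nonneg _ _
  -- the integral of a function of the outcomes, in terms of the conditional probabilities
  have key : ∀ u : VarVec (Bool → Bool → ℝ) → ℝ≥0∞, Measurable u →
      ∫⁻ ω in E.N g ⁻¹' {n} ∩ E.M g ⁻¹' {m} ∩ E.Zvec g ⁻¹' A, u (E.Yvec g ω) ∂P =
        ∫⁻ ω, ENNReal.ofReal (q ω) * (v (V ω) * u (E.Yvec g ω)) ∂P := by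
    intro u hu
    have hmapY : Measurable fun w : VarVec ((Bool → Bool → ℝ) × 𝒳) × Finset ℕ × 𝒞 × ℕ =>
        VarVec.map Prod.fst w.1 := (VarVec.measurable_map measurable_fst).comp measurable_fst
    -- The events on `N_g` and `M_g` are absorbed into a function of `W_g`. First the treatments are
    -- integrated out given `W_g` (`h1`), then the sampled set given `(C_g, N_g, X_g)` (`h2`).
    set u' : VarVec ((Bool → Bool → ℝ) × 𝒳) × Finset ℕ × 𝒞 × ℕ → ℝ≥0∞ := fun w =>
      ({n} : Set ℕ).indicator 1 w.2.2.2 * (({m} : Set (Finset ℕ)).indicator 1 w.2.1 *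
        u (VarVec.map Prod.fst w.1)) with hu'def
    have hu' : Measurable u' := by
      refine Measurable.mul ?_ (Measurable.mul ?_ (hu.comp hmapY))
      · exact (measurable_one.indicator (measurableSet_singleton n)).comp (by fun_prop)
      · exact (measurable_one.indicator (measurableSet_singleton m)).comp (by fun_prop)
    have h1 := hmarks.setLIntegral E.measurable_W hWi hWid g hA hu'
    have h2 := (hS.sampling g).symm.setLIntegral (E.measurable_Yvec g) (E.measurable_M g) hV
      (measurableSet_singleton m) (u := fun p => v p.2 * u p.1)
      ((hv.comp measurable_snd).mul (hu.comp measurable_fst))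
    rw [← h2]
    calc ∫⁻ ω in E.N g ⁻¹' {n} ∩ E.M g ⁻¹' {m} ∩ E.Zvec g ⁻¹' A, u (E.Yvec g ω) ∂P
        = ∫⁻ ω in E.Zvec g ⁻¹' A, u' (E.W g ω) ∂P := by
          rw [← setLIntegral_indicator (hNn.inter hMm)]
          refine lintegral_congr fun ω => ?_
          have hu'W : u' (E.W g ω) = ({n} : Set ℕ).indicator 1 (E.N g ω) *
            (({m} : Set (Finset ℕ)).indicator 1 (E.M g ω) * u (E.Yvec g ω)) := rfl
          rw [hu'W]
          by_cases hn : E.N g ω = n <;> by_cases hm : E.M g ω = m <;>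
            simp [Set.indicator, hn, hm]
      _ = ∫⁻ ω, κ (E.Bvec g ω) A * u' (E.W g ω) ∂P := h1
      _ = ∫⁻ ω in E.M g ⁻¹' {m}, v (V ω) * u (E.Yvec g ω) ∂P := by
          rw [← lintegral_indicator hMm]
          refine lintegral_congr fun ω => ?_
          have hu'W : u' (E.W g ω) = ({n} : Set ℕ).indicator 1 (E.N g ω) *
            (({m} : Set (Finset ℕ)).indicator 1 (E.M g ω) * u (E.Yvec g ω)) := rfl
          have hvV : v (V ω) = ({n} : Set ℕ).indicator 1 (E.N g ω) * κ (E.Bvec g ω) A := rfl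
          rw [hu'W]
          by_cases hm : E.M g ω = m
          · rw [Set.indicator_of_mem (show ω ∈ E.M g ⁻¹' {m} from hm), hvV, hm,
              Set.indicator_of_mem (Set.mem_singleton m), Pi.one_apply, one_mul]
            ring
          · simp [Set.indicator, hm]
  have hgood : ∀ u : VarVec (Bool → Bool → ℝ) → ℝ≥0∞, ∀ u₁ : Ω → ℝ≥0∞,
      (∀ ω, E.N g ω = n → u₁ ω = u (E.Yvec g ω)) →
      ∫⁻ ω in E.N g ⁻¹' {n} ∩ E.M g ⁻¹' {m} ∩ E.Zvec g ⁻¹' A, u₁ ω ∂P =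
      ∫⁻ ω in E.N g ⁻¹' {n} ∩ E.M g ⁻¹' {m} ∩ E.Zvec g ⁻¹' A, u (E.Yvec g ω) ∂P :=
    fun u u₁ hu => setLIntegral_congr_fun ((hNn.inter hMm).inter (E.measurable_Zvec g hA))
      fun ω hω => hu ω hω.1.1
  -- The total weight of the event given `(C_g, N_g, X_g)`: measurable for this σ-algebra and almost
  -- surely in `[0, 1]`, so it can multiply the conditional expectation of `Y²`.
  set w : Ω → ℝ := fun ω => q ω * (v (V ω)).toReal with hwdef
  set Q : Ω → ℝ := {ω | i < E.N g ω}.indicator fun ω => E.Y g i z h ω ^ 2 with hQ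
  have hQget : ∀ ω, ENNReal.ofReal (VarVec.get 0 (E.Yvec g ω) i z h ^ 2) =
      ENNReal.ofReal (Q ω) := by
    intro ω
    by_cases hi : i < E.N g ω
    · rw [E.get_Yvec hi]
      simp [hQ, hi]
    · have : VarVec.get 0 (E.Yvec g ω) i = 0 := by
        have hi' : ¬ i < (E.Yvec g ω).1 := hi
        simp [VarVec.get, hi']
      simp [hQ, hi, this]
  have hQ0 : ∀ ω, 0 ≤ Q ω := fun ω => Set.indicator_nonneg (fun ω _ => sq_nonneg _) ω
  have hvr1 : ∀ ω, (v (V ω)).toReal ≤ 1 := fun ω => by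
    have := ENNReal.toReal_mono ENNReal.one_ne_top (hv1 (V ω))
    simpa using this
  have hwm : StronglyMeasurable[MeasurableSpace.comap V inferInstance] w := by
    refine stronglyMeasurable_condExp.mul ?_
    exact (hv.ennreal_toReal.comp (comap_measurable V)).stronglyMeasurable
  have hwb : ∀ᵐ ω ∂P, ‖w ω‖ ≤ 1 := by
    filter_upwards [condProb_norm_le_one (P := P) hVle hMm] with ω hω
    rw [hwdef, norm_mul, Real.norm_of_nonneg ENNReal.toReal_nonneg]
    exact mul_le_one₀ hω ENNReal.toReal_nonneg (hvr1 ω)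
  have hw0 : 0 ≤ᵐ[P] w := by
    filter_upwards [hq0] with ω hω
    exact mul_nonneg hω ENNReal.toReal_nonneg
  have hwi : Integrable w P := .of_bound (hwm.mono hVle).aestronglyMeasurable 1 hwb
  have hQi : Integrable Q P := (hK z h g i).1
  -- The moment bound and the sampling assumption list the same variables in different orders.
  have hcomap : MeasurableSpace.comap (fun ω => (E.N g ω, E.C g ω, E.Xvec g ω)) inferInstance =
      MeasurableSpace.comap V inferInstance :=
    le_antisymm
      (Measurable.comap_le ((measurable_snd.fst.prodMk (measurable_fst.prodMk
        measurable_snd.snd)).comp (comap_measurable V)))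
      (Measurable.comap_le ((measurable_snd.fst.prodMk (measurable_fst.prodMk
        measurable_snd.snd)).comp
        (comap_measurable fun ω => (E.N g ω, E.C g ω, E.Xvec g ω))))
  have hKQ := (hK z h g i).2
  rw [hcomap] at hKQ
  -- The bound `K` is available only where `i < N_g`; the weight vanishes unless `N_g = n`, and `i <
  -- n`.
  have hle := integral_mul_le_of_condExp_le hVle hwm hwb hQi (K := K) (by
    filter_upwards [hw0, hKQ] with ω h0 h1
    by_cases hn : E.N g ω = n
    · rw [mul_comm K]
      exact mul_le_mul_of_nonneg_left (h1 (hn ▸ hin)) h0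
    · have : w ω = 0 := by simp [hwdef, hvdef, hVdef, hn]
      simp [this])
  have hwE : ∀ᵐ ω ∂P, ENNReal.ofReal (q ω) * v (V ω) = ENNReal.ofReal (w ω) := by
    filter_upwards [hq0] with ω hω
    rw [hwdef, ENNReal.ofReal_mul hω, ENNReal.ofReal_toReal
      (ne_top_of_le_ne_top ENNReal.one_ne_top (hv1 _))]
  have hleft : ∫⁻ ω in E.N g ⁻¹' {n} ∩ E.M g ⁻¹' {m} ∩ E.Zvec g ⁻¹' A,
      ENNReal.ofReal (E.Y g i z h ω ^ 2) ∂P = ENNReal.ofReal (∫ ω, w ω * Q ω ∂P) := by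
    rw [hgood (fun y => ENNReal.ofReal (VarVec.get 0 y i z h ^ 2)) _
      fun ω hω => by rw [E.get_Yvec (hω ▸ hin)],
      key _ ((measurable_get_real i z h).pow_const 2).ennreal_ofReal,
      ofReal_integral_eq_lintegral_ofReal (hQi.bdd_mul (hwm.mono hVle).aestronglyMeasurable hwb)
        (by filter_upwards [hw0] with ω hω using mul_nonneg hω (hQ0 ω))]
    refine lintegral_congr_ae ?_
    filter_upwards [hwE, hw0] with ω h1 h2
    rw [← mul_assoc, h1, hQget, ENNReal.ofReal_mul h2]
  -- The same representation with the constant function `1` identifies the total weight as the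
  -- probability of the event.
  have hright : P (E.N g ⁻¹' {n} ∩ E.M g ⁻¹' {m} ∩ E.Zvec g ⁻¹' A) =
      ENNReal.ofReal (∫ ω, w ω ∂P) := by
    rw [← setLIntegral_one, hgood (fun _ => 1) _ fun _ _ => rfl, key _ measurable_const,
      ofReal_integral_eq_lintegral_ofReal hwi hw0]
    refine lintegral_congr_ae ?_
    filter_upwards [hwE] with ω h1
    rw [mul_one, h1]
  rw [hleft, hright, ← ENNReal.ofReal_mul' (integral_nonneg_of_ae hw0)]
  exact ENNReal.ofReal_le_ofReal hle

/-- On each cell where size, sampled set and selected set are fixed, Jensen's inequality bounds the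
squared average by an average of squares over fixed units, and each square has integral at most `K`
times the probability of the cell. Summing over the countably many cells restores `E[N²]`. -/
theorem lintegral_size_mul_YbarPot_sq_le (hS : E.SamplingAssumption P) (hZ : E.SecondStage P) :
    ∃ K : ℝ, ∀ (z h : Bool) (g : ℕ),
      ∫⁻ ω, ENNReal.ofReal (((E.N g ω : ℝ) * E.YbarPot g z h ω) ^ 2) ∂P ≤
        ENNReal.ofReal K * ∫⁻ ω, ENNReal.ofReal ((E.N g ω : ℝ) ^ 2) ∂P := by
  obtain ⟨K, hK⟩ := setLIntegral_Y_sq_le hS hZ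
  refine ⟨K, fun z h g => ?_⟩
  set L : Ω → ℕ × Finset ℕ × Finset ℕ := fun ω =>
    (E.N g ω, E.M g ω, selected z h (E.M g ω) (E.Zvec g ω)) with hLdef
  have hL : Measurable L := (E.measurable_N g).prodMk ((E.measurable_M g).prodMk
    ((measurable_selected_cluster z h).comp (E.measurable_cluster g)))
  rw [lintegral_eq_tsum_preimage hL, lintegral_eq_tsum_preimage hL (fun ω =>
    ENNReal.ofReal ((E.N g ω : ℝ) ^ 2)), ← ENNReal.tsum_mul_left]
  refine ENNReal.tsum_le_tsum fun ⟨n, m, j⟩ => ?_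
  set A : Set (VarVec (Bool → Bool)) := selected z h m ⁻¹' {j} with hA
  have hAm : MeasurableSet A := measurable_selected z h m (measurableSet_singleton j)
  have hset : L ⁻¹' {(n, m, j)} = E.N g ⁻¹' {n} ∩ E.M g ⁻¹' {m} ∩ E.Zvec g ⁻¹' A := by
    ext ω
    simp only [hLdef, hA, Set.mem_preimage, Set.mem_singleton_iff, Prod.mk.injEq,
      Set.mem_inter_iff]
    constructor
    · rintro ⟨h1, rfl, h3⟩
      exact ⟨⟨h1, rfl⟩, h3⟩
    · rintro ⟨⟨h1, rfl⟩, h3⟩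
      exact ⟨h1, rfl, h3⟩
  have hLm : MeasurableSet (L ⁻¹' {(n, m, j)}) := hL (measurableSet_singleton _)
  -- A point of the cell is needed to know that the units in `j` lie below `n`.
  rcases (L ⁻¹' {(n, m, j)}).eq_empty_or_nonempty with hempty | ⟨ω₀, hω₀⟩
  · simp [hempty]
  have hLω : ∀ ω ∈ L ⁻¹' {(n, m, j)}, E.N g ω = n ∧ E.M g ω = m ∧
      selected z h (E.M g ω) (E.Zvec g ω) = j := fun ω hω => by
    simpa [hLdef] using hω
  have hjn : ∀ i ∈ j, i < n := by
    obtain ⟨h1, -, h3⟩ := hLω ω₀ hω₀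
    intro i hi
    rw [← h3] at hi
    rw [← h1]
    exact Finset.mem_range.1 (E.M_subset g ω₀ (selected_subset _ _ _ _ hi))
  have hpt : ∀ ω ∈ L ⁻¹' {(n, m, j)},
      ENNReal.ofReal (((E.N g ω : ℝ) * E.YbarPot g z h ω) ^ 2) ≤
        ∑ i ∈ j, ENNReal.ofReal ((n : ℝ) ^ 2 / j.card) * ENNReal.ofReal (E.Y g i z h ω ^ 2) := by
    intro ω hω
    obtain ⟨h1, -, h3⟩ := hLω ω hω
    have hb : E.YbarPot g z h ω = (∑ i ∈ j, E.Y g i z h ω) / (j.card : ℝ) := by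
      rw [YbarPot_eq]
      change average z h (selected z h (E.M g ω) (E.Zvec g ω)) (E.Yvec g ω) = _
      rw [h3, average, Finset.sum_congr rfl fun i hi => E.get_Yvec (h1 ▸ hjn i hi) z h]
    simp_rw [← ENNReal.ofReal_mul (show 0 ≤ (n : ℝ) ^ 2 / j.card by positivity)]
    rw [← ENNReal.ofReal_sum_of_nonneg fun i _ => by positivity]
    refine ENNReal.ofReal_le_ofReal ?_
    rw [mul_pow, h1, hb]
    refine (mul_le_mul_of_nonneg_left (sq_sum_div_card_le j fun i => E.Y g i z h ω)
      (by positivity)).trans (le_of_eq ?_)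
    rw [Finset.mul_sum]
    exact Finset.sum_congr rfl fun i _ => by ring
  have hY : ∀ i, Measurable fun ω => ENNReal.ofReal (E.Y g i z h ω ^ 2) := fun i =>
    ((E.measurable_Y g i z h).pow_const 2).ennreal_ofReal
  calc ∫⁻ ω in L ⁻¹' {(n, m, j)}, ENNReal.ofReal (((E.N g ω : ℝ) * E.YbarPot g z h ω) ^ 2) ∂P
      ≤ ∫⁻ ω in L ⁻¹' {(n, m, j)}, ∑ i ∈ j, ENNReal.ofReal ((n : ℝ) ^ 2 / j.card) *
          ENNReal.ofReal (E.Y g i z h ω ^ 2) ∂P := setLIntegral_mono' hLm hpt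
    _ = ∑ i ∈ j, ENNReal.ofReal ((n : ℝ) ^ 2 / j.card) *
          ∫⁻ ω in L ⁻¹' {(n, m, j)}, ENNReal.ofReal (E.Y g i z h ω ^ 2) ∂P := by
        rw [lintegral_finsetSum _ fun i _ => (hY i).const_mul _]
        exact Finset.sum_congr rfl fun i _ => lintegral_const_mul _ (hY i)
    _ ≤ ∑ i ∈ j, ENNReal.ofReal ((n : ℝ) ^ 2 / j.card) *
          (ENNReal.ofReal K * P (L ⁻¹' {(n, m, j)})) := by
        refine Finset.sum_le_sum fun i hi => mul_le_mul_right ?_ _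
        rw [hset]
        exact hK z h g i n m A (hjn i hi) hAm
    _ = (j.card * ENNReal.ofReal ((n : ℝ) ^ 2 / j.card)) *
          (ENNReal.ofReal K * P (L ⁻¹' {(n, m, j)})) := by
        rw [Finset.sum_const, nsmul_eq_mul, mul_assoc]
    _ ≤ ENNReal.ofReal ((n : ℝ) ^ 2) * (ENNReal.ofReal K * P (L ⁻¹' {(n, m, j)})) := by
        refine mul_le_mul_left ?_ _
        rw [← ENNReal.ofReal_natCast, ← ENNReal.ofReal_mul (by positivity)]
        refine ENNReal.ofReal_le_ofReal ?_
        -- For empty `j` the left side is `0`, which is why only an inequality is claimed.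
        rcases Nat.eq_zero_or_pos j.card with h0 | h0
        · simp [h0]
        · have : (0 : ℝ) < j.card := by exact_mod_cast h0
          exact (mul_div_cancel₀ _ this.ne').le
    _ = ENNReal.ofReal K * ∫⁻ ω in L ⁻¹' {(n, m, j)}, ENNReal.ofReal ((E.N g ω : ℝ) ^ 2) ∂P := by
        rw [setLIntegral_congr_fun (g := fun _ => ENNReal.ofReal ((n : ℝ) ^ 2)) hLm
          fun ω hω => by rw [(hLω ω hω).1], setLIntegral_const]
        ring

theorem memLp_size_mul_YbarPot (hS : E.SamplingAssumption P) (hZ : E.SecondStage P) (g : ℕ)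
    (z h : Bool) : MemLp (fun ω => (E.N g ω : ℝ) * E.YbarPot g z h ω) 2 P := by
  obtain ⟨K, hK⟩ := lintegral_size_mul_YbarPot_sq_le hS hZ
  have hm : Measurable fun ω => (E.N g ω : ℝ) * E.YbarPot g z h ω :=
    (E.measurable_size g).mul (E.measurable_YbarPot g z h)
  rw [memLp_two_iff_integrable_sq hm.aestronglyMeasurable]
  refine (lintegral_ofReal_ne_top_iff_integrable (hm.pow_const 2).aestronglyMeasurable
    (Eventually.of_forall fun ω => sq_nonneg _)).1 (ne_top_of_le_ne_top ?_ (hK z h g))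
  exact ENNReal.mul_ne_top ENNReal.ofReal_ne_top ((lintegral_ofReal_ne_top_iff_integrable
    ((E.measurable_size g).pow_const 2).aestronglyMeasurable
    (Eventually.of_forall fun ω => sq_nonneg _)).2 (hS.size_sq g))

/-- Since `N_g ≥ 2` almost surely, `Ȳ_g` is dominated by `N_g Ȳ_g`. -/
theorem memLp_YbarPot (hS : E.SamplingAssumption P) (hZ : E.SecondStage P) (g : ℕ) (z h : Bool) :
    MemLp (E.YbarPot g z h) 2 P := by
  refine (memLp_size_mul_YbarPot hS hZ g z h).mono
    (E.measurable_YbarPot g z h).aestronglyMeasurable ?_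
  filter_upwards [two_le_size hS g] with ω hω
  rw [norm_mul, Real.norm_of_nonneg (by positivity : (0 : ℝ) ≤ E.N g ω)]
  exact le_mul_of_one_le_left (norm_nonneg _) (by linarith)

theorem integral_size_pos (hS : E.SamplingAssumption P) (g : ℕ) :
    0 < ∫ ω, (E.N g ω : ℝ) ∂P := by
  have h := integral_mono_ae (integrable_const (2 : ℝ)) ((memLp_size hS g).integrable one_le_two)
    (two_le_size hS g)
  simp only [integral_const, probReal_univ, smul_eq_mul, one_mul] at h
  linarith

theorem memLp_YtildePot (hS : E.SamplingAssumption P) (hZ : E.SecondStage P) (g : ℕ)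
    (z h : Bool) : MemLp (E.YtildePot P g z h) 2 P := by
  set e := ∫ ω, (E.N g ω : ℝ) ∂P with he
  set θ := (∫ ω, E.YbarPot g z h ω * (E.N g ω : ℝ) ∂P) / e with hθ
  have : E.YtildePot P g z h = fun ω =>
      e⁻¹ * ((E.N g ω : ℝ) * E.YbarPot g z h ω) - e⁻¹ * θ * (E.N g ω : ℝ) := by
    ext ω
    simp only [YtildePot, ← he, ← hθ]
    ring
  rw [this]
  exact ((memLp_size_mul_YbarPot hS hZ g z h).const_mul _).sub ((memLp_size hS g).const_mul _)

end TwoStageExperiment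

/-! ### Algebra of the variance and conditioning on finitely many strata -/

/-- The decomposition behind the variance estimators: the limit of the estimator, written with
conditional means `c₁`, `c₀` given the stratum, equals the target variance. -/
theorem variance_decomposition {𝒮 : Type*} [Fintype 𝒮] {π : ℝ} (hπ0 : π ≠ 0) (hπ1 : 1 - π ≠ 0)
    {p c₁ c₀ τ : 𝒮 → ℝ} {Q₁ Q₀ e₁ e₀ : ℝ} (hp : ∑ s, p s = 1) (h₁ : ∑ s, p s * c₁ s = e₁)
    (h₀ : ∑ s, p s * c₀ s = e₀) :
    1 / π * (Q₁ - ∑ s, p s * c₁ s ^ 2) + 1 / (1 - π) * (Q₀ - ∑ s, p s * c₀ s ^ 2)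
      + ∑ s, p s * ((c₁ s - e₁) - (c₀ s - e₀)) ^ 2
      + ∑ s, τ s * (p s * (1 / π * (c₁ s - e₁) + 1 / (1 - π) * (c₀ s - e₀)) ^ 2) =
    1 / π * (Q₁ - e₁ ^ 2) + 1 / (1 - π) * (Q₀ - e₀ ^ 2)
      - π * (1 - π) * ∑ s, p s * (1 / π * (c₁ s - e₁) + 1 / (1 - π) * (c₀ s - e₀)) ^ 2
      + ∑ s, p s * (τ s * (1 / π * (c₁ s - e₁) + 1 / (1 - π) * (c₀ s - e₀)) ^ 2) := by
  -- The second moment of a stratum mean is its variance plus the square of its mean.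
  have hsq : ∀ (c : 𝒮 → ℝ) (e : ℝ), ∑ s, p s * c s = e →
      ∑ s, p s * c s ^ 2 = ∑ s, p s * (c s - e) ^ 2 + e ^ 2 := by
    intro c e he
    have : ∀ s, p s * c s ^ 2 = p s * (c s - e) ^ 2 + 2 * e * (p s * c s) - e ^ 2 * p s :=
      fun s => by ring
    simp_rw [this]
    rw [Finset.sum_sub_distrib, Finset.sum_add_distrib, ← Finset.mul_sum, ← Finset.mul_sum, he, hp]
    ring
  have hτ : ∑ s, τ s * (p s * (1 / π * (c₁ s - e₁) + 1 / (1 - π) * (c₀ s - e₀)) ^ 2) =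
      ∑ s, p s * (τ s * (1 / π * (c₁ s - e₁) + 1 / (1 - π) * (c₀ s - e₀)) ^ 2) :=
    Finset.sum_congr rfl fun s _ => by ring
  -- Stratum by stratum this is `(x - y)² = x²/π + y²/(1-π) - π(1-π)(x/π + y/(1-π))²`, with `x`, `y`
  -- the centered means.
  have hcore : ∑ s, p s * ((c₁ s - e₁) - (c₀ s - e₀)) ^ 2 =
      1 / π * ∑ s, p s * (c₁ s - e₁) ^ 2 + 1 / (1 - π) * ∑ s, p s * (c₀ s - e₀) ^ 2
      - π * (1 - π) * ∑ s, p s * (1 / π * (c₁ s - e₁) + 1 / (1 - π) * (c₀ s - e₀)) ^ 2 := by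
    simp_rw [Finset.mul_sum]
    rw [← Finset.sum_add_distrib, ← Finset.sum_sub_distrib]
    refine Finset.sum_congr rfl fun s _ => ?_
    field_simp
    ring
  rw [hτ, hcore, hsq c₁ e₁ h₁, hsq c₀ e₀ h₀]
  ring

/-- Conditional expectation given a random element with finitely many values. -/
theorem exists_condExp_eq_comp {Ω 𝒮 : Type*} [mΩ : MeasurableSpace Ω] [m𝒮 : MeasurableSpace 𝒮]
    [MeasurableSingletonClass 𝒮] {P : Measure Ω} [IsProbabilityMeasure P] {S : Ω → 𝒮}
    (hS : Measurable S) {X : Ω → ℝ} (hX : Integrable X P) :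
    ∃ c : 𝒮 → ℝ, P[X | m𝒮.comap S] = c ∘ S ∧
      ∀ s, ∫ ω in S ⁻¹' {s}, X ω ∂P = P.real (S ⁻¹' {s}) * c s := by
  have hm : Measurable[m𝒮.comap S] (P[X | m𝒮.comap S]) := stronglyMeasurable_condExp.measurable
  obtain ⟨c, -, hc⟩ := hm.exists_eq_measurable_comp
  refine ⟨c, hc, fun s => ?_⟩
  rw [← setIntegral_condExp hS.comap_le hX ⟨{s}, measurableSet_singleton s, rfl⟩, hc,
    setIntegral_congr_fun (f := c ∘ S) (g := fun _ => c s) (hS (measurableSet_singleton s))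
      (fun ω hω => congrArg c hω), setIntegral_const, smul_eq_mul]

/-- The integral of a function of a random element with finitely many values. -/
theorem integral_comp_eq_sum {Ω 𝒮 : Type*} [mΩ : MeasurableSpace Ω] [Fintype 𝒮]
    [MeasurableSpace 𝒮] [MeasurableSingletonClass 𝒮] {P : Measure Ω} [IsProbabilityMeasure P]
    {S : Ω → 𝒮} (hS : Measurable S) (F : 𝒮 → ℝ) :
    ∫ ω, F (S ω) ∂P = ∑ s, P.real (S ⁻¹' {s}) * F s := by
  have : IsProbabilityMeasure (P.map S) := Measure.isProbabilityMeasure_map hS.aemeasurable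
  rw [← integral_map (f := F) hS.aemeasurable (measurable_of_finite F).aestronglyMeasurable,
    integral_fintype .of_finite]
  refine Finset.sum_congr rfl fun s _ => ?_
  rw [map_measureReal_apply hS (measurableSet_singleton s), smul_eq_mul]

namespace TwoStageExperiment

variable {Ω 𝒳 𝒞 𝓑 𝒮 : Type*} [MeasurableSpace Ω] [MeasurableSpace 𝒳]
    [MeasurableSpace 𝒞] [MeasurableSpace 𝓑] [MeasurableSpace 𝒮]
    {E : TwoStageExperiment Ω 𝒳 𝒞 𝓑 𝒮} {P : Measure Ω}

/-! ### Observed cluster averages -/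

/-- On each arm one of the two summands of `Ybar` vanishes. In the control arm every unit is
untreated whatever `z` is, hence the treatment `h && z`. The null set does not depend on `G` or `g`.
-/
theorem Ybar_eq_YbarPot (hZ : E.SecondStage P) (z h : Bool) :
    ∀ᵐ ω ∂P, ∀ G g, E.H G g ω = h → E.Ybar G z g ω = E.YbarPot g (h && z) h ω := by
  filter_upwards [ae_all_iff.2 fun g => ae_all_iff.2 fun i => hZ.control g i] with ω hω G g hH
  cases h
  · simp only [Ybar, YbarPot, Yobs, Z, indH, hH]
    simp only [Bool.false_and, Bool.false_eq_true, false_and, if_false, mul_zero,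
      Finset.sum_const_zero, zero_div, if_true, mul_one, zero_add]
    congr 1
    refine Finset.sum_congr rfl fun i hi => ?_
    rw [hω g i (Finset.mem_range.1 (E.M_subset g ω hi))]
  · simp only [Ybar, YbarPot, Yobs, Z, indH, hH]
    simp only [Bool.true_and, true_and, if_true, Bool.true_eq_false, if_false, mul_zero,
      Finset.sum_const_zero, zero_div, add_zero]
    congr 1
    rw [Finset.sum_filter]
    refine Finset.sum_congr rfl fun i _ => ?_
    split_ifs with h1
    · rw [h1, mul_one]
    · rw [mul_zero]

/-- The limiting fraction of clusters with target treated fraction `h`. -/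
noncomputable def armProb (E : TwoStageExperiment Ω 𝒳 𝒞 𝓑 𝒮) (h : Bool) : ℝ :=
  if h then E.π₁ else 1 - E.π₁

theorem armProb_ne_zero (E : TwoStageExperiment Ω 𝒳 𝒞 𝓑 𝒮) (h : Bool) : E.armProb h ≠ 0 := by
  cases h
  · simpa [armProb] using (sub_pos.2 E.π₁_lt_one).ne'
  · simpa [armProb] using E.π₁_pos.ne'

theorem indicator_cluster (E : TwoStageExperiment Ω 𝒳 𝒞 𝓑 𝒮) (φ : Cluster 𝒳 𝒞 → ℝ) (s : 𝒮)
    (g : ℕ) (ω : Ω) :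
    (E.stratum ⁻¹' {s}).indicator φ (E.cluster g ω) = φ (E.cluster g ω) * E.indS s g ω := by
  by_cases h : E.Sg g ω = s
  · have h' : E.cluster g ω ∈ E.stratum ⁻¹' {s} := h
    simp [indS, h, Set.indicator_of_mem h']
  · have h' : E.cluster g ω ∉ E.stratum ⁻¹' {s} := h
    simp [indS, h, Set.indicator_of_notMem h']

theorem sum_indS [Fintype 𝒮] (E : TwoStageExperiment Ω 𝒳 𝒞 𝓑 𝒮) (g : ℕ) (ω : Ω) :
    ∑ s, E.indS s g ω = 1 := by
  classical
  simp [indS]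

/-- The target variances may be computed from any cluster, so limits are expressed through an
arbitrary `g₀`; identical laws make this harmless. -/
theorem tendstoProb_clusterMean [IsProbabilityMeasure P] [Fintype 𝒮]
    (hS : E.SamplingAssumption P) (hF : E.FirstStage P) (hZ : E.SecondStage P)
    {φ : Cluster 𝒳 𝒞 → ℝ} (hφ : Measurable φ) (g₀ : ℕ)
    (hφi : Integrable (fun ω => φ (E.cluster g₀ ω)) P) :
    TendstoProb P (fun G ω => (∑ g ∈ Finset.range G, φ (E.cluster g ω)) / G)
      (∫ ω, φ (E.cluster g₀ ω) ∂P) := by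
  have hD := stratifiedDesign hS hF hZ
  have hid := (hD.ident g₀).comp hφ
  have h := hD.tendstoProb_mean hφ (hid.integrable_iff.1 hφi)
  rwa [show ∫ ω, φ (E.cluster 0 ω) ∂P = ∫ ω, φ (E.cluster g₀ ω) ∂P from hid.integral_eq.symm] at h

variable [MeasurableSingletonClass 𝒮]

theorem integral_indS (E : TwoStageExperiment Ω 𝒳 𝒞 𝓑 𝒮) (X : Ω → ℝ) (s : 𝒮) (g : ℕ) :
    ∫ ω, X ω * E.indS s g ω ∂P = ∫ ω in E.Sg g ⁻¹' {s}, X ω ∂P := by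
  rw [← integral_indicator (E.measurable_Sg g (measurableSet_singleton s))]
  refine integral_congr_ae (Eventually.of_forall fun ω => ?_)
  by_cases h : E.Sg g ω = s <;> simp [indS, h]

variable [IsProbabilityMeasure P] [Fintype 𝒮]

/-! ### Laws of large numbers within arms and strata -/

section LLN

variable (hS : E.SamplingAssumption P) (hF : E.FirstStage P) (hZ : E.SecondStage P)

include hS hF hZ

theorem tendstoProb_share (g₀ : ℕ) (s : 𝒮) :
    TendstoProb P (fun G ω => E.share G s ω) (P.real (E.Sg g₀ ⁻¹' {s})) := by
  have hs := E.measurable_stratum (measurableSet_singleton s)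
  have hsg := E.measurable_Sg g₀ (measurableSet_singleton s)
  have h := tendstoProb_clusterMean hS hF hZ
    ((measurable_const (a := (1 : ℝ))).indicator hs) g₀ (by
      exact (integrable_const (1 : ℝ)).indicator hsg)
  have hlim : ∫ ω, (E.stratum ⁻¹' {s}).indicator (fun _ => (1 : ℝ)) (E.cluster g₀ ω) ∂P =
      P.real (E.Sg g₀ ⁻¹' {s}) := by
    rw [← integral_indicator_one hsg]
    rfl
  rw [hlim] at h
  refine h.congr fun G => Eventually.of_forall fun ω => ?_
  simp only [indicator_cluster, one_mul, share]

/-- A stratum contains `π₁ G(s) + D_G(s)` treated and `(1 - π₁) G(s) - D_G(s)` control clusters. As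
`D_G(s) / G` tends to `0`, the balance condition of `tendstoProb_stratum` holds with `ρ = armProb
h`. -/
theorem tendstoProb_stratumSum {φ : Cluster 𝒳 𝒞 → ℝ} (hφ : Measurable φ) (g₀ : ℕ)
    (hφi : Integrable (fun ω => φ (E.cluster g₀ ω)) P) (h : Bool) (s : 𝒮) :
    TendstoProb P (fun G ω => (∑ g ∈ Finset.range G,
        φ (E.cluster g ω) * (E.indH G h g ω * E.indS s g ω)) / G)
      (E.armProb h * ∫ ω in E.Sg g₀ ⁻¹' {s}, φ (E.cluster g₀ ω) ∂P) := by
  have hD := stratifiedDesign hS hF hZ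
  have hs := E.measurable_stratum (measurableSet_singleton s)
  have hid := (hD.ident g₀).comp hφ
  have hlim1 : ∫ ω, (E.stratum ⁻¹' {s}).indicator 1 (E.cluster 0 ω) ∂P =
      P.real (E.Sg 0 ⁻¹' {s}) := by
    rw [← integral_indicator_one (E.measurable_Sg 0 (measurableSet_singleton s))]
    rfl
  have hbal : TendstoProb P (fun G ω => (∑ g ∈ Finset.range G,
      (E.stratum ⁻¹' {s}).indicator 1 (E.cluster g ω) * armInd E.H G h g ω) / G)
      (E.armProb h * ∫ ω, (E.stratum ⁻¹' {s}).indicator 1 (E.cluster 0 ω) ∂P) := by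
    rw [hlim1]
    have hsh := tendstoProb_share hS hF hZ 0 s
    have hDs := hF.tendstoProb_D s
    cases h
    · have h2 := (hsh.const_mul (1 - E.π₁)).sub hDs
      rw [sub_zero] at h2
      refine h2.congr fun G => Eventually.of_forall fun ω => ?_
      simp only [indicator_cluster, Pi.one_apply, one_mul, share, D]
      rw [mul_div_assoc', ← sub_div, Finset.mul_sum, ← Finset.sum_sub_distrib]
      congr 1
      refine Finset.sum_congr rfl fun g _ => ?_
      by_cases hs : E.Sg g ω = s <;> cases hH : E.H G g ω <;> simp [armInd, hH, indS, hs]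
    · have h2 := (hsh.const_mul E.π₁).add hDs
      rw [add_zero] at h2
      refine h2.congr fun G => Eventually.of_forall fun ω => ?_
      simp only [indicator_cluster, Pi.one_apply, one_mul, share, D]
      rw [mul_div_assoc', ← add_div, Finset.mul_sum, ← Finset.sum_add_distrib]
      congr 1
      refine Finset.sum_congr rfl fun g _ => ?_
      by_cases hs : E.Sg g ω = s <;> cases hH : E.H G g ω <;> simp [armInd, hH, indS, hs]
  have hlim : ∫ ω, (E.stratum ⁻¹' {s}).indicator φ (E.cluster 0 ω) ∂P =
      ∫ ω in E.Sg g₀ ⁻¹' {s}, φ (E.cluster g₀ ω) ∂P := by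
    rw [← integral_indS]
    simp_rw [← indicator_cluster]
    exact ((hD.ident g₀).comp (hφ.indicator hs)).integral_eq.symm
  have key := hD.tendstoProb_stratum hφ (hid.integrable_iff.1 hφi) hbal
  rw [hlim] at key
  refine key.congr fun G => Eventually.of_forall fun ω => ?_
  simp only [indicator_cluster]
  congr 1
  refine Finset.sum_congr rfl fun g _ => ?_
  rw [mul_assoc, mul_comm (E.indS s g ω)]
  rfl

theorem tendstoProb_armSum {φ : Cluster 𝒳 𝒞 → ℝ} (hφ : Measurable φ) (g₀ : ℕ)
    (hφi : Integrable (fun ω => φ (E.cluster g₀ ω)) P) (h : Bool) :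
    TendstoProb P (fun G ω => (∑ g ∈ Finset.range G, φ (E.cluster g ω) * E.indH G h g ω) / G)
      (E.armProb h * ∫ ω, φ (E.cluster g₀ ω) ∂P) := by
  have key := TendstoProb.sum Finset.univ fun s _ =>
    tendstoProb_stratumSum hS hF hZ hφ g₀ hφi h s
  have hlim : ∑ s, E.armProb h * ∫ ω in E.Sg g₀ ⁻¹' {s}, φ (E.cluster g₀ ω) ∂P =
      E.armProb h * ∫ ω, φ (E.cluster g₀ ω) ∂P := by
    rw [← Finset.mul_sum, ← integral_iUnion_fintype
      (fun s => E.measurable_Sg g₀ (measurableSet_singleton s)) _ fun s => hφi.integrableOn]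
    · have : ⋃ s, E.Sg g₀ ⁻¹' {s} = Set.univ := by ext; simp
      rw [this, Measure.restrict_univ]
    · intro s s' hss
      exact Disjoint.preimage _ (by simpa using hss)
  rw [hlim] at key
  refine key.congr fun G => Eventually.of_forall fun ω => ?_
  simp only
  rw [← Finset.sum_div, Finset.sum_comm]
  congr 1
  refine Finset.sum_congr rfl fun g _ => ?_
  rw [← Finset.mul_sum, ← Finset.mul_sum, sum_indS, mul_one]

/-- A ratio of two arm sums, in which `armProb h` cancels. The array `U` may depend on `G` and needs
to match `φ` on the arm only, which lets observed averages be replaced by potential ones. -/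
theorem tendstoProb_armMean {φ : Cluster 𝒳 𝒞 → ℝ} (hφ : Measurable φ) (g₀ : ℕ)
    (hφi : Integrable (fun ω => φ (E.cluster g₀ ω)) P) (h : Bool) {U : ℕ → ℕ → Ω → ℝ}
    (hU : ∀ᵐ ω ∂P, ∀ G g, E.H G g ω = h → U G g ω = φ (E.cluster g ω)) :
    TendstoProb P (fun G ω => E.armMean G (U G) h ω) (∫ ω, φ (E.cluster g₀ ω) ∂P) := by
  have hnum := tendstoProb_armSum hS hF hZ hφ g₀ hφi h
  have hden := tendstoProb_armSum hS hF hZ measurable_const g₀ (integrable_const (1 : ℝ)) h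
  simp only [integral_const, probReal_univ, smul_eq_mul, mul_one] at hden
  have key := hnum.div hden (E.armProb_ne_zero h)
  rw [mul_div_cancel_left₀ _ (E.armProb_ne_zero h)] at key
  refine key.congr fun G => ?_
  filter_upwards [hU] with ω hω
  have hsum : ∑ g ∈ Finset.range G, U G g ω * E.indH G h g ω =
      ∑ g ∈ Finset.range G, φ (E.cluster g ω) * E.indH G h g ω := by
    refine Finset.sum_congr rfl fun g _ => ?_
    by_cases hH : E.H G g ω = h
    · rw [hω G g hH]
    · simp [indH, hH]
  rw [armMean, hsum]
  simp only [one_mul, count]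
  -- The factor `1 / G` cancels for `G > 0`; for `G = 0` all sums are empty.
  rcases Nat.eq_zero_or_pos G with rfl | hG
  · simp
  · exact div_div_div_cancel_right₀ (by exact_mod_cast hG.ne') _ _

theorem tendstoProb_stratumMean {φ : Cluster 𝒳 𝒞 → ℝ} (hφ : Measurable φ) (g₀ : ℕ)
    (hφi : Integrable (fun ω => φ (E.cluster g₀ ω)) P) (h : Bool) (s : 𝒮)
    (hp : P.real (E.Sg g₀ ⁻¹' {s}) ≠ 0) {U : ℕ → ℕ → Ω → ℝ}
    (hU : ∀ᵐ ω ∂P, ∀ G g, E.H G g ω = h → U G g ω = φ (E.cluster g ω)) :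
    TendstoProb P (fun G ω => E.stratumMean G (U G) h s ω)
      ((∫ ω in E.Sg g₀ ⁻¹' {s}, φ (E.cluster g₀ ω) ∂P) / P.real (E.Sg g₀ ⁻¹' {s})) := by
  have hnum := tendstoProb_stratumSum hS hF hZ hφ g₀ hφi h s
  have hden := tendstoProb_stratumSum hS hF hZ measurable_const g₀ (integrable_const (1 : ℝ)) h s
  simp only [setIntegral_const, smul_eq_mul, mul_one] at hden
  have key := hnum.div hden (mul_ne_zero (E.armProb_ne_zero h) hp)
  rw [mul_div_mul_left _ _ (E.armProb_ne_zero h)] at key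
  refine key.congr fun G => ?_
  filter_upwards [hU] with ω hω
  have hsum : ∑ g ∈ Finset.range G, U G g ω * (E.indH G h g ω * E.indS s g ω) =
      ∑ g ∈ Finset.range G, φ (E.cluster g ω) * (E.indH G h g ω * E.indS s g ω) := by
    refine Finset.sum_congr rfl fun g _ => ?_
    by_cases hH : E.H G g ω = h
    · rw [hω G g hH]
    · simp [indH, hH]
  rw [stratumMean, hsum]
  simp only [one_mul, countIn]
  rcases Nat.eq_zero_or_pos G with rfl | hG
  · simp
  · exact div_div_div_cancel_right₀ (by exact_mod_cast hG.ne') _ _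

/-- Strata of probability zero do not contribute to weighted sums over strata. -/
theorem tendstoProb_share_mul (g₀ : ℕ) (s : 𝒮) {X : ℕ → Ω → ℝ} {x : ℝ}
    (hX : P.real (E.Sg g₀ ⁻¹' {s}) ≠ 0 → TendstoProb P X x) :
    TendstoProb P (fun G ω => E.share G s ω * X G ω) (P.real (E.Sg g₀ ⁻¹' {s}) * x) := by
  by_cases hp : P.real (E.Sg g₀ ⁻¹' {s}) = 0
  · have hD := stratifiedDesign hS hF hZ
    -- By identical laws almost surely no cluster falls in a null stratum, so its share is exactly
    -- `0` and the behaviour of `X` is irrelevant.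
    have hnull : ∀ g, ∀ᵐ ω ∂P, E.Sg g ω ≠ s := by
      intro g
      have hs := E.measurable_stratum (measurableSet_singleton s)
      have h1 : P (E.Sg g ⁻¹' {s}) = P (E.Sg g₀ ⁻¹' {s}) :=
        ((hD.ident g).trans (hD.ident g₀).symm).measure_mem_eq hs
      rw [(measureReal_eq_zero_iff).1 hp] at h1
      exact measure_eq_zero_iff_ae_notMem.1 h1
    rw [hp, zero_mul]
    refine (tendstoProb_const 0).congr fun G => ?_
    filter_upwards [ae_all_iff.2 hnull] with ω hω
    simp [share, indS, hω]
  · exact (tendstoProb_share hS hF hZ g₀ s).mul (hX hp)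

/-- Consistency of a variance estimator, given the limits of its ingredients. -/
theorem tendstoProb_variance (g₀ : ℕ) {A₁ A₀ B₁ B₀ : ℕ → Ω → ℝ} {M₁ M₀ : 𝒮 → ℕ → Ω → ℝ}
    {X₁ X₀ : Ω → ℝ} {V : ℝ} (hX₁ : MemLp X₁ 2 P) (hX₀ : MemLp X₀ 2 P)
    (hA₁ : TendstoProb P A₁ (∫ ω, X₁ ω ^ 2 ∂P)) (hA₀ : TendstoProb P A₀ (∫ ω, X₀ ω ^ 2 ∂P))
    (hB₁ : TendstoProb P B₁ (∫ ω, X₁ ω ∂P)) (hB₀ : TendstoProb P B₀ (∫ ω, X₀ ω ∂P))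
    (hM₁ : ∀ s, P.real (E.Sg g₀ ⁻¹' {s}) ≠ 0 → TendstoProb P (M₁ s)
      ((∫ ω in E.Sg g₀ ⁻¹' {s}, X₁ ω ∂P) / P.real (E.Sg g₀ ⁻¹' {s})))
    (hM₀ : ∀ s, P.real (E.Sg g₀ ⁻¹' {s}) ≠ 0 → TendstoProb P (M₀ s)
      ((∫ ω in E.Sg g₀ ⁻¹' {s}, X₀ ω ∂P) / P.real (E.Sg g₀ ⁻¹' {s})))
    (hV : V = 1 / E.π₁ * Var[X₁; P] + 1 / (1 - E.π₁) * Var[X₀; P]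
      - E.π₁ * (1 - E.π₁) * ∫ ω, (1 / E.π₁ *
          ((P[X₁ | MeasurableSpace.comap (E.Sg g₀) inferInstance]) ω - ∫ ω, X₁ ω ∂P)
        + 1 / (1 - E.π₁) *
          ((P[X₀ | MeasurableSpace.comap (E.Sg g₀) inferInstance]) ω - ∫ ω, X₀ ω ∂P)) ^ 2 ∂P
      + ∫ ω, E.τ (E.Sg g₀ ω) * (1 / E.π₁ *
          ((P[X₁ | MeasurableSpace.comap (E.Sg g₀) inferInstance]) ω - ∫ ω, X₁ ω ∂P)
        + 1 / (1 - E.π₁) *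
          ((P[X₀ | MeasurableSpace.comap (E.Sg g₀) inferInstance]) ω - ∫ ω, X₀ ω ∂P)) ^ 2 ∂P) :
    TendstoProb P (fun G ω => 1 / E.π₁ * (A₁ G ω - ∑ s, E.share G s ω * M₁ s G ω ^ 2)
      + 1 / (1 - E.π₁) * (A₀ G ω - ∑ s, E.share G s ω * M₀ s G ω ^ 2)
      + ∑ s, E.share G s ω * ((M₁ s G ω - B₁ G ω) - (M₀ s G ω - B₀ G ω)) ^ 2
      + ∑ s, E.τ s * (E.share G s ω *
        (1 / E.π₁ * (M₁ s G ω - B₁ G ω) + 1 / (1 - E.π₁) * (M₀ s G ω - B₀ G ω)) ^ 2)) V := by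
  have hSm := E.measurable_Sg g₀
  obtain ⟨c₁, hc₁, hs₁⟩ := exists_condExp_eq_comp hSm (hX₁.integrable one_le_two)
  obtain ⟨c₀, hc₀, hs₀⟩ := exists_condExp_eq_comp hSm (hX₀.integrable one_le_two)
  set p : 𝒮 → ℝ := fun s => P.real (E.Sg g₀ ⁻¹' {s}) with hp
  set e₁ := ∫ ω, X₁ ω ∂P with he₁
  set e₀ := ∫ ω, X₀ ω ∂P with he₀
  -- The limit of a stratum average is the value of the conditional expectation on that stratum.
  have hM₁' : ∀ s, p s ≠ 0 → TendstoProb P (M₁ s) (c₁ s) := fun s hps => by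
    have := hM₁ s hps
    rwa [hs₁, mul_div_cancel_left₀ _ hps] at this
  have hM₀' : ∀ s, p s ≠ 0 → TendstoProb P (M₀ s) (c₀ s) := fun s hps => by
    have := hM₀ s hps
    rwa [hs₀, mul_div_cancel_left₀ _ hps] at this
  have hsum1 : ∑ s, p s = 1 := by
    have := integral_comp_eq_sum (P := P) hSm fun _ => (1 : ℝ)
    simpa using this.symm
  have hsumc : ∀ (X : Ω → ℝ) (c : 𝒮 → ℝ),
      P[X | MeasurableSpace.comap (E.Sg g₀) inferInstance] = c ∘ E.Sg g₀ →
      ∑ s, p s * c s = ∫ ω, X ω ∂P := fun X c hc => by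
    rw [← integral_condExp hSm.comap_le, hc]
    exact (integral_comp_eq_sum hSm c).symm
  have hlim : V = 1 / E.π₁ * ((∫ ω, X₁ ω ^ 2 ∂P) - ∑ s, p s * c₁ s ^ 2)
      + 1 / (1 - E.π₁) * ((∫ ω, X₀ ω ^ 2 ∂P) - ∑ s, p s * c₀ s ^ 2)
      + ∑ s, p s * ((c₁ s - e₁) - (c₀ s - e₀)) ^ 2
      + ∑ s, E.τ s * (p s *
        (1 / E.π₁ * (c₁ s - e₁) + 1 / (1 - E.π₁) * (c₀ s - e₀)) ^ 2) := by
    rw [variance_decomposition E.π₁_pos.ne' (sub_pos.2 E.π₁_lt_one).ne' hsum1 (hsumc X₁ c₁ hc₁)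
      (hsumc X₀ c₀ hc₀), hV, hc₁, hc₀, variance_eq_sub hX₁, variance_eq_sub hX₀,
      ← integral_comp_eq_sum hSm, ← integral_comp_eq_sum hSm]
    rfl
  rw [hlim]
  refine TendstoProb.add (TendstoProb.add (TendstoProb.add ?_ ?_) ?_) ?_
  · exact (hA₁.sub (.sum _ fun s _ => tendstoProb_share_mul hS hF hZ g₀ s fun hps =>
      (hM₁' s hps).pow 2)).const_mul _
  · exact (hA₀.sub (.sum _ fun s _ => tendstoProb_share_mul hS hF hZ g₀ s fun hps =>
      (hM₀' s hps).pow 2)).const_mul _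
  · exact .sum _ fun s _ => tendstoProb_share_mul hS hF hZ g₀ s fun hps =>
      (((hM₁' s hps).sub hB₁).sub ((hM₀' s hps).sub hB₀)).pow 2
  · exact .sum _ fun s _ => (tendstoProb_share_mul hS hF hZ g₀ s fun hps =>
      ((((hM₁' s hps).sub hB₁).const_mul _).add
        (((hM₀' s hps).sub hB₀).const_mul _)).pow 2).const_mul _

end LLN

end TwoStageExperiment

namespace TwoStageExperiment

variable {Ω 𝒳 𝒞 𝓑 𝒮 : Type*} [MeasurableSpace Ω] [MeasurableSpace 𝒳]
    [MeasurableSpace 𝒞] [MeasurableSpace 𝓑] [MeasurableSpace 𝒮]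
    {E : TwoStageExperiment Ω 𝒳 𝒞 𝓑 𝒮} {P : Measure Ω}

/-! ### Adjusted outcomes -/

/-- The estimated centering of the adjusted outcomes in an arm. -/
noncomputable def centering (E : TwoStageExperiment Ω 𝒳 𝒞 𝓑 𝒮) (G : ℕ) (z h : Bool) (ω : Ω) : ℝ :=
  E.armMean G (fun j ω => E.Ybar G z j ω * (E.N j ω : ℝ)) h ω / E.Nbar G ω

/-- The adjusted outcome depends on the whole sample, but within an arm only through two common
constants. It is therefore linear in `N Ȳ` and `N`, which involve single clusters. -/
theorem Ytilde_eq (E : TwoStageExperiment Ω 𝒳 𝒞 𝓑 𝒮) {G g : ℕ} {z h : Bool} {ω : Ω}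
    (hH : E.H G g ω = h) :
    E.Ytilde G z g ω =
      (E.N g ω * E.Ybar G z g ω - E.centering G z h ω * E.N g ω) / E.Nbar G ω := by
  rw [Ytilde, hH, centering]
  ring

/-- Expanding the square takes the sample-dependent constants out of the average; clusters outside
the arm contribute nothing on either side. -/
theorem armMean_Ytilde_sq (E : TwoStageExperiment Ω 𝒳 𝒞 𝓑 𝒮) (G : ℕ) (z h : Bool) (ω : Ω) :
    E.armMean G (fun g ω => E.Ytilde G z g ω ^ 2) h ω =
      (E.armMean G (fun g ω => (E.N g ω * E.Ybar G z g ω) ^ 2) h ω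
        - 2 * E.centering G z h ω *
          E.armMean G (fun g ω => E.N g ω * (E.N g ω * E.Ybar G z g ω)) h ω
        + E.centering G z h ω ^ 2 * E.armMean G (fun g ω => (E.N g ω : ℝ) ^ 2) h ω)
      / E.Nbar G ω ^ 2 := by
  have hterm : ∀ g, E.Ytilde G z g ω ^ 2 * E.indH G h g ω =
      ((E.N g ω * E.Ybar G z g ω) ^ 2 * E.indH G h g ω
        - 2 * E.centering G z h ω * (E.N g ω * (E.N g ω * E.Ybar G z g ω) * E.indH G h g ω)
        + E.centering G z h ω ^ 2 * ((E.N g ω : ℝ) ^ 2 * E.indH G h g ω)) / E.Nbar G ω ^ 2 := by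
    intro g
    by_cases hH : E.H G g ω = h
    · rw [E.Ytilde_eq hH]
      ring
    · simp [indH, hH]
  simp only [armMean, hterm]
  rw [← Finset.sum_div, Finset.sum_add_distrib, Finset.sum_sub_distrib, ← Finset.mul_sum,
    ← Finset.mul_sum]
  ring

theorem stratumMean_Ytilde (E : TwoStageExperiment Ω 𝒳 𝒞 𝓑 𝒮) (G : ℕ) (z h : Bool) (s : 𝒮)
    (ω : Ω) :
    E.stratumMean G (E.Ytilde G z) h s ω =
      (E.stratumMean G (fun g ω => E.N g ω * E.Ybar G z g ω) h s ω
        - E.centering G z h ω * E.stratumMean G (fun g ω => (E.N g ω : ℝ)) h s ω)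
      / E.Nbar G ω := by
  have hterm : ∀ g, E.Ytilde G z g ω * (E.indH G h g ω * E.indS s g ω) =
      (E.N g ω * E.Ybar G z g ω * (E.indH G h g ω * E.indS s g ω)
        - E.centering G z h ω * ((E.N g ω : ℝ) * (E.indH G h g ω * E.indS s g ω)))
      / E.Nbar G ω := by
    intro g
    by_cases hH : E.H G g ω = h
    · rw [E.Ytilde_eq hH]
      ring
    · simp [indH, hH]
  simp only [stratumMean, hterm]
  rw [← Finset.sum_div, Finset.sum_sub_distrib, ← Finset.mul_sum]
  ring

/-- The centering of the adjusted outcomes in the population. -/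
noncomputable def popCentering (E : TwoStageExperiment Ω 𝒳 𝒞 𝓑 𝒮) (P : Measure Ω) (g : ℕ)
    (z h : Bool) : ℝ :=
  (∫ ω, E.YbarPot g z h ω * (E.N g ω : ℝ) ∂P) / ∫ ω, (E.N g ω : ℝ) ∂P

theorem YtildePot_eq (E : TwoStageExperiment Ω 𝒳 𝒞 𝓑 𝒮) (P : Measure Ω) (g : ℕ) (z h : Bool)
    (ω : Ω) :
    E.YtildePot P g z h ω =
      (E.N g ω * E.YbarPot g z h ω - E.popCentering P g z h * E.N g ω) /
        ∫ ω, (E.N g ω : ℝ) ∂P := by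
  rw [YtildePot, popCentering]
  ring

/-! ### Population moments of the adjusted outcomes -/

section Moments

variable [IsProbabilityMeasure P] (hS : E.SamplingAssumption P) (hZ : E.SecondStage P)

include hS hZ

theorem setIntegral_YtildePot (g : ℕ) (z h : Bool) (A : Set Ω) :
    ∫ ω in A, E.YtildePot P g z h ω ∂P =
      ((∫ ω in A, E.N g ω * E.YbarPot g z h ω ∂P)
        - E.popCentering P g z h * ∫ ω in A, (E.N g ω : ℝ) ∂P) / ∫ ω, (E.N g ω : ℝ) ∂P := by
  have h1 := (memLp_size_mul_YbarPot hS hZ g z h).integrable one_le_two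
  have h2 := ((memLp_size hS g).integrable one_le_two).const_mul (E.popCentering P g z h)
  simp_rw [YtildePot_eq]
  rw [integral_div, integral_sub h1.integrableOn h2.integrableOn, integral_const_mul]

/-- The centering is chosen for this. Consequently `mtilde`, with no mean subtracted, is already the
centered conditional mean. -/
theorem integral_YtildePot (g : ℕ) (z h : Bool) : ∫ ω, E.YtildePot P g z h ω ∂P = 0 := by
  have := setIntegral_YtildePot hS hZ g z h Set.univ
  rw [Measure.restrict_univ] at this
  rw [this, popCentering, div_mul_cancel₀ _ (integral_size_pos hS g).ne']
  simp_rw [mul_comm (E.N g _ : ℝ)]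
  simp

theorem integral_YtildePot_sq (g : ℕ) (z h : Bool) :
    ∫ ω, E.YtildePot P g z h ω ^ 2 ∂P =
      ((∫ ω, (E.N g ω * E.YbarPot g z h ω) ^ 2 ∂P)
        - 2 * E.popCentering P g z h * (∫ ω, E.N g ω * (E.N g ω * E.YbarPot g z h ω) ∂P)
        + E.popCentering P g z h ^ 2 * ∫ ω, (E.N g ω : ℝ) ^ 2 ∂P) /
      (∫ ω, (E.N g ω : ℝ) ∂P) ^ 2 := by
  have hNY := memLp_size_mul_YbarPot hS hZ g z h
  have h1 := hNY.integrable_sq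
  have h2 : Integrable (fun ω => 2 * E.popCentering P g z h *
      (E.N g ω * (E.N g ω * E.YbarPot g z h ω))) P :=
    ((memLp_size hS g).integrable_mul hNY).const_mul _
  have h3 := (hS.size_sq g).const_mul (E.popCentering P g z h ^ 2)
  have h12 : Integrable (fun ω => (E.N g ω * E.YbarPot g z h ω) ^ 2 -
      2 * E.popCentering P g z h * (E.N g ω * (E.N g ω * E.YbarPot g z h ω))) P := h1.sub h2
  have hpt : ∀ ω, E.YtildePot P g z h ω ^ 2 =
      ((E.N g ω * E.YbarPot g z h ω) ^ 2
        - 2 * E.popCentering P g z h * (E.N g ω * (E.N g ω * E.YbarPot g z h ω))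
        + E.popCentering P g z h ^ 2 * (E.N g ω : ℝ) ^ 2) /
      (∫ ω, (E.N g ω : ℝ) ∂P) ^ 2 := fun ω => by
    rw [YtildePot_eq]
    ring
  simp_rw [hpt]
  rw [integral_div, integral_add h12 h3, integral_sub h1 h2, integral_const_mul,
    integral_const_mul]

end Moments

/-! ### Consistency of the two estimators -/

section Consistency

variable [IsProbabilityMeasure P] [Fintype 𝒮] [MeasurableSingletonClass 𝒮]
    (hS : E.SamplingAssumption P) (hF : E.FirstStage P) (hZ : E.SecondStage P)

include hS hF hZ

/-- Averages over an arm of functions of size and observed cluster average. -/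
theorem tendstoProb_armMean_comp (g₀ : ℕ) (z h : Bool)
    {F : ℝ → ℝ → ℝ} (hF' : Measurable fun p : ℝ × ℝ => F p.1 p.2)
    (hint : Integrable (fun ω => F (E.N g₀ ω) (E.YbarPot g₀ (h && z) h ω)) P) :
    TendstoProb P (fun G ω => E.armMean G (fun g ω => F (E.N g ω) (E.Ybar G z g ω)) h ω)
      (∫ ω, F (E.N g₀ ω) (E.YbarPot g₀ (h && z) h ω) ∂P) := by
  simp_rw [YbarPot_eq] at hint ⊢
  refine tendstoProb_armMean hS hF hZ (φ := fun t => F (sizeFun t) (barFun (h && z) h t))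
    (hF'.comp (measurable_sizeFun.prodMk (measurable_barFun (h && z) h))) g₀ hint h ?_
  filter_upwards [Ybar_eq_YbarPot hZ z h] with ω hω G g hH
  rw [hω G g hH, YbarPot_eq]
  rfl

/-- Averages over a stratum within an arm of functions of size and observed cluster average. -/
theorem tendstoProb_stratumMean_comp (g₀ : ℕ) (z h : Bool)
    {F : ℝ → ℝ → ℝ} (hF' : Measurable fun p : ℝ × ℝ => F p.1 p.2)
    (hint : Integrable (fun ω => F (E.N g₀ ω) (E.YbarPot g₀ (h && z) h ω)) P) (s : 𝒮)
    (hp : P.real (E.Sg g₀ ⁻¹' {s}) ≠ 0) :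
    TendstoProb P (fun G ω => E.stratumMean G (fun g ω => F (E.N g ω) (E.Ybar G z g ω)) h s ω)
      ((∫ ω in E.Sg g₀ ⁻¹' {s}, F (E.N g₀ ω) (E.YbarPot g₀ (h && z) h ω) ∂P) /
        P.real (E.Sg g₀ ⁻¹' {s})) := by
  simp_rw [YbarPot_eq] at hint ⊢
  refine tendstoProb_stratumMean hS hF hZ (φ := fun t => F (sizeFun t) (barFun (h && z) h t))
    (hF'.comp (measurable_sizeFun.prodMk (measurable_barFun (h && z) h))) g₀ hint h s hp ?_
  filter_upwards [Ybar_eq_YbarPot hZ z h] with ω hω G g hH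
  rw [hω G g hH, YbarPot_eq]
  rfl

theorem tendstoProb_Nbar (g₀ : ℕ) : TendstoProb P E.Nbar (∫ ω, (E.N g₀ ω : ℝ) ∂P) :=
  tendstoProb_clusterMean hS hF hZ measurable_sizeFun g₀
    ((memLp_size hS g₀).integrable one_le_two)

theorem tendstoProb_centering (g₀ : ℕ) (z h : Bool) :
    TendstoProb P (fun G ω => E.centering G z h ω) (E.popCentering P g₀ (h && z) h) := by
  refine TendstoProb.div (tendstoProb_armMean_comp hS hF hZ g₀ z h (F := fun n y => y * n)
    (by fun_prop) ?_) (tendstoProb_Nbar hS hF hZ g₀) (integral_size_pos hS g₀).ne'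
  simp_rw [mul_comm _ (E.N g₀ _ : ℝ)]
  exact (memLp_size_mul_YbarPot hS hZ g₀ (h && z) h).integrable one_le_two

/-- The sample expansion and the population expansion `integral_YtildePot_sq` have the same form, so
the limit is taken term by term. -/
theorem tendstoProb_armMean_Ytilde_sq (g₀ : ℕ) (z h : Bool) :
    TendstoProb P (fun G ω => E.armMean G (fun g ω => E.Ytilde G z g ω ^ 2) h ω)
      (∫ ω, E.YtildePot P g₀ (h && z) h ω ^ 2 ∂P) := by
  have hNY := memLp_size_mul_YbarPot hS hZ g₀ (h && z) h
  have hθ := tendstoProb_centering hS hF hZ g₀ z h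
  simp_rw [armMean_Ytilde_sq]
  rw [integral_YtildePot_sq hS hZ]
  refine TendstoProb.div (TendstoProb.add (TendstoProb.sub ?_ ((hθ.const_mul 2).mul ?_))
    ((hθ.pow 2).mul ?_)) ((tendstoProb_Nbar hS hF hZ g₀).pow 2)
    (pow_ne_zero 2 (integral_size_pos hS g₀).ne')
  · exact tendstoProb_armMean_comp hS hF hZ g₀ z h (F := fun n y => (n * y) ^ 2) (by fun_prop)
      hNY.integrable_sq
  · exact tendstoProb_armMean_comp hS hF hZ g₀ z h (F := fun n y => n * (n * y)) (by fun_prop)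
      ((memLp_size hS g₀).integrable_mul hNY)
  · exact tendstoProb_armMean_comp hS hF hZ g₀ z h (F := fun n _ => n ^ 2) (by fun_prop)
      (hS.size_sq g₀)

theorem tendstoProb_stratumMean_Ytilde (g₀ : ℕ) (z h : Bool)
    (s : 𝒮) (hp : P.real (E.Sg g₀ ⁻¹' {s}) ≠ 0) :
    TendstoProb P (fun G ω => E.stratumMean G (E.Ytilde G z) h s ω)
      ((∫ ω in E.Sg g₀ ⁻¹' {s}, E.YtildePot P g₀ (h && z) h ω ∂P) / P.real (E.Sg g₀ ⁻¹' {s})) := by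
  have hNY := (memLp_size_mul_YbarPot hS hZ g₀ (h && z) h).integrable one_le_two
  have hN := (memLp_size hS g₀).integrable one_le_two
  simp_rw [stratumMean_Ytilde]
  rw [setIntegral_YtildePot hS hZ, div_right_comm, sub_div, mul_div_assoc]
  refine TendstoProb.div (TendstoProb.sub ?_ ((tendstoProb_centering hS hF hZ g₀ z h).mul ?_))
    (tendstoProb_Nbar hS hF hZ g₀) (integral_size_pos hS g₀).ne'
  · exact tendstoProb_stratumMean_comp hS hF hZ g₀ z h (F := fun n y => n * y) (by fun_prop)
      hNY s hp
  · exact tendstoProb_stratumMean_comp hS hF hZ g₀ z h (F := fun n _ => n) (by fun_prop)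
      hN s hp

theorem tendstoProb_V₃hat (g₀ : ℕ) (z : Bool) :
    TendstoProb P (fun G => E.V₃hat G z) (E.V₃ P g₀ z) := by
  have hL1 := memLp_YbarPot hS hZ g₀ z true
  have hL0 := memLp_YbarPot hS hZ g₀ false false
  have hmeas : Measurable fun p : ℝ × ℝ => p.2 := measurable_snd
  have hmeas2 : Measurable fun p : ℝ × ℝ => p.2 ^ 2 := by fun_prop
  have key := tendstoProb_variance hS hF hZ g₀ hL1 hL0
    (tendstoProb_armMean_comp hS hF hZ g₀ z true (F := fun _ y => y ^ 2) hmeas2 hL1.integrable_sq)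
    -- The control second moment is formed from `Ybar G z`, yet its limit involves `YbarPot` at
    -- `false`, because `false && z` reduces to `false`.
    (tendstoProb_armMean_comp hS hF hZ g₀ z false (F := fun _ y => y ^ 2) hmeas2 hL0.integrable_sq)
    (tendstoProb_armMean_comp hS hF hZ g₀ z true (F := fun _ y => y) hmeas
      (hL1.integrable one_le_two))
    (tendstoProb_armMean_comp hS hF hZ g₀ false false (F := fun _ y => y) hmeas
      (hL0.integrable one_le_two))
    (fun s => tendstoProb_stratumMean_comp hS hF hZ g₀ z true (F := fun _ y => y) hmeas
      (hL1.integrable one_le_two) s)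
    (fun s => tendstoProb_stratumMean_comp hS hF hZ g₀ false false (F := fun _ y => y) hmeas
      (hL0.integrable one_le_two) s)
    (V := E.V₃ P g₀ z) rfl
  refine key.congr fun G => Eventually.of_forall fun ω => ?_
  simp only [V₃hat, mul_assoc]

theorem tendstoProb_V₄hat (g₀ : ℕ) (z : Bool) :
    TendstoProb P (fun G => E.V₄hat G z) (E.V₄ P g₀ z) := by
  have hE : ∀ z h, ∫ ω, E.YtildePot P g₀ z h ω ∂P = 0 := integral_YtildePot hS hZ g₀
  -- `V₄hat` subtracts no arm means. Taking them to be identically `0` fits `tendstoProb_variance`,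
  -- since the population means are `0`.
  have hB : ∀ z h, TendstoProb P (fun _ _ => 0) (∫ ω, E.YtildePot P g₀ z h ω ∂P) := fun z h => by
    rw [hE z h]
    exact tendstoProb_const 0
  have key := tendstoProb_variance hS hF hZ g₀ (memLp_YtildePot hS hZ g₀ z true)
    (memLp_YtildePot hS hZ g₀ false false)
    (tendstoProb_armMean_Ytilde_sq hS hF hZ g₀ z true)
    (tendstoProb_armMean_Ytilde_sq hS hF hZ g₀ z false) (hB z true) (hB false false)
    (fun s => tendstoProb_stratumMean_Ytilde hS hF hZ g₀ z true s)
    (fun s => tendstoProb_stratumMean_Ytilde hS hF hZ g₀ false false s)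
    (V := E.V₄ P g₀ z) (by simp only [hE, sub_zero]; rfl)
  refine key.congr fun G => Eventually.of_forall fun ω => ?_
  simp only [V₄hat, mul_assoc, sub_zero]

end Consistency

end TwoStageExperiment

theorem theoremA2 {Ω 𝒳 𝒞 𝓑 𝒮 : Type*} [MeasurableSpace Ω] [MeasurableSpace 𝒳]
    [MeasurableSpace 𝒞] [MeasurableSpace 𝓑]
    [Fintype 𝒮] [MeasurableSpace 𝒮] [MeasurableSingletonClass 𝒮]
    (P : Measure Ω) [IsProbabilityMeasure P] (E : TwoStageExperiment Ω 𝒳 𝒞 𝓑 𝒮)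
    (hInterference : E.Interference P) (hSampling : E.SamplingAssumption P)
    (hFirst : E.FirstStage P) (hSecond : E.SecondStage P) :
    ∀ (g : ℕ) (z : Bool),
      (MemLp (E.YbarPot g z true) 2 P ∧ MemLp (E.YbarPot g false false) 2 P ∧
        TendstoInMeasure P (fun G : ℕ => E.V₃hat G z) atTop (fun _ => E.V₃ P g z)) ∧
      (MemLp (E.YtildePot P g z true) 2 P ∧ MemLp (E.YtildePot P g false false) 2 P ∧
        TendstoInMeasure P (fun G : ℕ => E.V₄hat G z) atTop (fun _ => E.V₄ P g z)) := by
  intro g z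
  exact ⟨⟨TwoStageExperiment.memLp_YbarPot hSampling hSecond g z true,
      TwoStageExperiment.memLp_YbarPot hSampling hSecond g false false,
      TwoStageExperiment.tendstoProb_V₃hat hSampling hFirst hSecond g z⟩,
    TwoStageExperiment.memLp_YtildePot hSampling hSecond g z true,
    TwoStageExperiment.memLp_YtildePot hSampling hSecond g false false,
    TwoStageExperiment.tendstoProb_V₄hat hSampling hFirst hSecond g z⟩
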